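/- **Parametrization of labels.** Let $n\ge 3$, $0\le d\le n$; indices in $\{0,1,2\}$ are taken modulo $3$. Let $\alpha,\beta,\gamma\in\mathcal H_{reg}=\{1>\theta_1>\dots>\theta_n\ge 0\}$. *Triangular honeycombs.* Let $T\subset\mathbb C$ be the closed triangle with vertices $0,1,e^{i\pi/3}$. Write $z=z_1+z_2e^{i\pi/3}$, $z_0=1-z_1-z_2$ for $z \in T$, and $\partial_iT=\{z\in T: z_i=0\}$. A non-degenerate honeycomb $h=(\mathcal E,c)$ in $T$ is a finite set $\mathcal E$ of non-trivial segments of $T$ with a coloring $c:\mathcal E\to\{0,1,3\}$ such that (1) the interiors of two distinct segments meet only if, up to exchanging them, their colors are $0$ and $1$ and the angle (in $(0,\pi)$, counterclockwise) from the first to the second is $\pi/3$; (2) if two distinct segments share an endpoint $v$, then, up to exchanging them, their colors are $(0,0),(1,1),(0,1),(1,3)$ or $(3,0)$ and the counterclockwise angle at $v$ from the first to the second is $2\pi/3$. Its structure graph $G(h)$ has the endpoints as vertices and the segments as colored edges; put $t(h)=\bigcup_{e\in\mathcal E}e$. The honeycomb is triangular of size $n$ if: all vertices of $G(h)$ have degree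 $1$ or $3$, and $t(h)\cap\partial T$ is the set of vertices of degree $1$; each $e\in\mathcal E$ is contained in a line $x+\mathbb R e^{2\pi i(\ell+1)/3}$, $\ell=\ell(e)\in\{0,1,2\}$ (its type; its height is $L(e)=x_{\ell}$); for each $i$, $\#(t(h)\cap\partial_iT)=n$, an edge with an endpoint on $\partial_iT$ has color $0$ and type $i+1$, or color $1$ and type $i+2$, and along $\partial_iT$ the color of these edges is nondecreasing in the coordinate of index $i+1$ of the endpoint. The boundary vertices are indexed by $(i,j)$, $1\le j\le n$: the $j$-th one on $\partial_iT$ in decreasing order of the coordinate of index $i+1$. Let $\mathrm{HONEY}_{n,d}(\alpha,\beta,\gamma)$ be the set of those with $d$ edges of color $1$ meeting each side, and whose coordinates of index $i+1$ at the boundary vertices on $\partial_iT$ are $\beta,\alpha,\gamma$ for $i=0,1,2$ respectively. For a graph $G$ with edge colors and ordered boundary, $\mathrm{HONEY}^G_{n,d}(\alpha,\beta,\gamma)$ is the subset with $G(h)\cong G$ (as colored graphs with ordered boundary). *Flow.* $\Omega^1(G)$ is the space of antisymmetric real functions on the oriented edges of $G$, and $\mathcal F_G(\phi)=\{\omega\in\Omega^1(G):\sum_{w\sim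 v}\omega(v,w)=\phi(v)\ \forall v\}$. For a vertex $v$ of a triangular honeycomb, $s(v)=1$ if the edges at $v$ leave $v$ in directions $-e^{2\pi i(\ell+1)/3}$ and $s(v)=-1$ if they leave it in directions $e^{2\pi i(\ell+1)/3}$. The flow of $h$ is $\mathcal L[h](v,w)=s(v)L(\{v,w\})$, regarded as a flow on $G$ via $G\cong G(h)$. *Color maps and reduced graphs.* Let $H_{d,n}$ be the part of the triangular lattice with vertices $p=r+se^{i\pi/3}$ whose coordinates $(p_0,p_1,p_2)=(n+d-r-s,r,s)$ lie in $\{0,\dots,n\}^3$. An edge $\{p,p-e^{2\pi i\ell/3}\}$ has type $\ell$ and height $p_\ell$; a triangular face $f$ has coordinates $(f_0,f_1,f_2)$, the heights of its edges of type $0,1,2$. A color map $C$ assigns to each edge of $H_{d,n}$ a color in $\{0,1,3,m\}$ so that the colors around each triangular face, clockwise and up to rotation, are $(0,0,0),(1,1,1),(1,0,3)$ or $(0,1,m)$, and the boundary edges with $p_i=0$ (resp. $p_i=n$) have color $0$ (resp. $1$). The dual graph $\Gamma_{d,n}$ has one vertex per triangular face and one per boundary edge of $H_{d,n}$, and one edge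 dual to each edge of $H_{d,n}$, of the same color and type. The vertices of $G^C$ are the boundary vertices of $\Gamma_{d,n}$ and the faces without edge of color $m$; its edges $\{x,y\}$ are the maximal chains, i.e. the paths of $\Gamma_{d,n}$ from $x$ to $y$ with edges of colors $c,m,c,\dots,m,c$, $c\ne m$ (such a chain has color $c$ and the type of its edges of color $c$). The boundary vertex $(i,j)$ of $G^C$ is the $j$-th boundary edge, counterclockwise, among the $d$ edges with $p_{i+1}=n$ followed by the $n-d$ edges with $p_i=0$. On $G^C$ the sign is $s=1$ at upward-pointing and $s=-1$ at downward-pointing triangles, and at a boundary vertex $s=1$ (resp. $-1$) if its edge has color $1$ (resp. $0$). Let $\phi_{\alpha,\beta,\gamma}(v)=s(v)$ at the inner vertices, and at the boundary vertex $(i,j)$ let it be $1-b$ if its edge has color $1$ and $-b$ if it has color $0$, where $b=\beta_j,\alpha_j,\gamma_j$ for $i=0,1,2$. *Cone.* For edges $e=\{v,w\}$ and $e'=\{v',w'\}$ of $G^C$ of the same type $\ell$, write $e<e'$ if, up to exchanging the names of the endpoints, $\{w,v'\}$ is an edge of $G^C$ of type $\ell+1$ and $v'_\ell>w_\ell$.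 Let $$K_{G^C}=\{\omega\in\Omega^1(G^C):\ s(v)\,\omega(v,w)>0 \text{ for every oriented edge } (v,w),\ \ |\omega(e)|<|\omega(e')| \text{ if } e<e'\}.$$ **Statement.** For every color map $C$, $$\mathcal L\big(\mathrm{HONEY}^{G^C}_{n,d}(\alpha,\beta,\gamma)\big)=\mathcal F_{G^C}(\phi_{\alpha,\beta,\gamma})\cap K_{G^C}.$$ -/

import Mathlib

/-! ## Plane geometry of the equilateral triangle -/

/-- The vertices of the equilateral triangle are `0`, `1` and `exp (iπ/3)`.  `bary i z` is the
coordinate `z_i` of `z = z_1 + z_2 exp (iπ/3)`, with `z_0 = 1 - z_1 - z_2`. -/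
noncomputable def bary (i : Fin 3) (z : ℂ) : ℝ :=
  ![1 - z.re - z.im / √3, z.re - z.im / √3, 2 * z.im / √3] i

theorem bary_spec (z : ℂ) :
    z = (bary 1 z : ℂ) + (bary 2 z : ℂ) * Complex.exp ((Real.pi / 3 : ℝ) * Complex.I) ∧
      bary 0 z = 1 - bary 1 z - bary 2 z := by
  have h3 : (√3 : ℝ) ≠ 0 := by positivity
  have hs : (√3 : ℝ) * √3 = 3 := Real.mul_self_sqrt (by norm_num)
  constructor
  · apply Complex.ext
    · rw [Complex.add_re, Complex.re_ofReal_mul, Complex.exp_ofReal_mul_I_re, Real.cos_pi_div_three]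
      simp [bary]
      ring
    · rw [Complex.add_im, Complex.im_ofReal_mul, Complex.exp_ofReal_mul_I_im, Real.sin_pi_div_three]
      simp [bary]
      field_simp
  · simp [bary]
    field_simp
    ring

/-- The closed equilateral triangle `T`. -/
def triangle : Set ℂ := {z | ∀ i, 0 ≤ bary i z}

/-- The side `∂_i T` of the triangle. -/
def triangleSide (i : Fin 3) : Set ℂ := {z | z ∈ triangle ∧ bary i z = 0}

/-- The boundary `∂T`. -/
def triangleBoundary : Set ℂ := ⋃ i, triangleSide i

/-- The direction `exp (2πi(ℓ+1)/3)` of the segments of type `ℓ`. -/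
noncomputable def typeDir (ℓ : Fin 3) : ℂ :=
  Complex.exp ((2 * Real.pi * ((ℓ : ℕ) + 1) / 3 : ℝ) * Complex.I)

/-- The segment `[a, b]` is contained in a line `x + ℝ exp (2πi(ℓ+1)/3)`. -/
def HasType (ℓ : Fin 3) (a b : ℂ) : Prop := ∃ t : ℝ, b - a = t * typeDir ℓ

/-- The oriented angle from `u` to `u'` lies in `(0, π)` and is equal to `θ`:
`det (u, u') > 0` and `arccos ⟨u/|u|, u'/|u'|⟩ = θ`. -/
def IsAngle (u u' : ℂ) (θ : ℝ) : Prop :=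
  0 < u.re * u'.im - u.im * u'.re ∧ InnerProductGeometry.angle u u' = θ

/-! ## Colored graphs with ordered boundary -/

/-- The colors `0`, `1`, `3` of the edges of a honeycomb. -/
inductive EdgeColor
  | zero
  | one
  | three

/-- The color, as a number. -/
def EdgeColor.value : EdgeColor → ℕ
  | zero => 0
  | one => 1
  | three => 3

/-- A graph on `V` with edges colored by `0, 1, 3` and with a family of boundary vertices indexed
by `Fin 3 × Fin n` (ordered lexicographically).  `colorClass c` is the graph of the edges of
color `c`, and `Bdry i j v` says that `v` is the boundary vertex of index `(i, j)`. -/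
structure BdryColoredGraph (n : ℕ) (V : Type) where
  colorClass : EdgeColor → SimpleGraph V
  Bdry : Fin 3 → Fin n → V → Prop

/-- The underlying graph. -/
def BdryColoredGraph.graph {n : ℕ} {V : Type} (G : BdryColoredGraph n V) : SimpleGraph V :=
  ⨆ c, G.colorClass c

/-- Isomorphisms of colored graphs with ordered boundary. -/
structure BdryColoredIso {n : ℕ} {V W : Type} (G : BdryColoredGraph n V)
    (H : BdryColoredGraph n W) extends V ≃ W where
  adj_iff : ∀ c v w, (G.colorClass c).Adj v w ↔ (H.colorClass c).Adj (toEquiv v) (toEquiv w)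
  bdry_iff : ∀ i j v, G.Bdry i j v ↔ H.Bdry i j (toEquiv v)

/-! ## Flows on a graph -/

/-- The space `Ω¹(G)` of flows: antisymmetric real functions on the oriented edges. -/
def flowSpace {V : Type} (G : SimpleGraph V) : Submodule ℝ (G.Dart → ℝ) where
  carrier := {ω | ∀ p, ω p.symm = - ω p}
  add_mem' := fun ha hb p => by simp only [Pi.add_apply, ha p, hb p]; ring
  zero_mem' := fun p => by simp
  smul_mem' := fun c ω h p => by simp only [Pi.smul_apply, h p, smul_eq_mul]; ring

/-- The affine space `𝓕_G(φ)` of flows `ω` with `∑_{w ∼ v} ω(v, w) = φ(v)` for all `v`. -/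
def divergenceSpace {V : Type} (G : SimpleGraph V) (φ : V → ℝ) : Set (G.Dart → ℝ) :=
  {ω | ω ∈ flowSpace G ∧ ∀ v, ∑ᶠ p : {p : G.Dart // p.fst = v}, ω p = φ v}

/-! ## Honeycombs -/

/-- A finite set of segments of the plane, given by their unordered pairs of endpoints, together
with a coloring of these segments. -/
structure ColoredSegments where
  edges : Finset (Sym2 ℂ)
  color : {e : Sym2 ℂ // e ∈ edges} → EdgeColor

namespace ColoredSegments

variable (h : ColoredSegments)

/-- `[a, b]` is one of the segments, and it has color `c`. -/
def HasColor (c : EdgeColor) (a b : ℂ) : Prop := ∃ he : s(a, b) ∈ h.edges, h.color ⟨s(a, b), he⟩ = c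

/-- The union `t(h)` of the segments. -/
def support : Set ℂ := {z | ∃ a b, s(a, b) ∈ h.edges ∧ z ∈ segment ℝ a b}

/-- The set of endpoints of the segments. -/
def vertices : Set ℂ := {v | ∃ e ∈ h.edges, v ∈ e}

/-- The segment `[a, b]` has color `0`, the segment `[a', b']` has color `1`, and the angle from the
first one to the second one (for tangent vectors chosen so that the determinant is positive)
is `π/3`. -/
def AllowedCrossing (a b a' b' : ℂ) : Prop :=
  h.HasColor .zero a b ∧ h.HasColor .one a' b' ∧
    (IsAngle (b - a) (b' - a') (Real.pi / 3) ∨ IsAngle (b - a) (a' - b') (Real.pi / 3))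

/-- The pair of segments `[v, a]`, `[v, b]` has colors `(0,0), (1,1), (0,1), (1,3)` or `(3,0)`, and
the angle at `v` from the first one to the second one is `2π/3`. -/
def AllowedCorner (v a b : ℂ) : Prop :=
  ((h.HasColor .zero v a ∧ h.HasColor .zero v b) ∨
    (h.HasColor .one v a ∧ h.HasColor .one v b) ∨
    (h.HasColor .zero v a ∧ h.HasColor .one v b) ∨
    (h.HasColor .one v a ∧ h.HasColor .three v b) ∨
    (h.HasColor .three v a ∧ h.HasColor .zero v b)) ∧
  IsAngle (a - v) (b - v) (2 * Real.pi / 3)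

/-- Non-degenerate honeycombs in a convex domain `S` of the plane. -/
structure IsHoneycomb (S : Set ℂ) : Prop where
  nontrivial : ∀ e ∈ h.edges, ¬ e.IsDiag
  subset : h.vertices ⊆ S
  crossing : ∀ a b a' b', s(a, b) ∈ h.edges → s(a', b') ∈ h.edges → s(a, b) ≠ s(a', b') →
    (openSegment ℝ a b ∩ openSegment ℝ a' b').Nonempty →
      h.AllowedCrossing a b a' b' ∨ h.AllowedCrossing a' b' a b
  corner : ∀ v a b, s(v, a) ∈ h.edges → s(v, b) ∈ h.edges → a ≠ b →
      h.AllowedCorner v a b ∨ h.AllowedCorner v b a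

/-- The structure graph, as a colored graph with ordered boundary.  The boundary vertex of index
`(i, j)` is the vertex on `∂_i T` whose `(i+1)`-coordinate is exceeded by that of exactly `j`
points of `t(h) ∩ ∂_i T`; thus boundary vertices are enumerated counterclockwise. -/
def structureGraph (n : ℕ) : BdryColoredGraph n h.vertices where
  colorClass := fun c =>
    { Adj := fun v w => v ≠ w ∧ h.HasColor c v w
      symm := ⟨fun v w hvw => ⟨hvw.1.symm, by
        obtain ⟨-, he, hc⟩ := hvw
        have hs : s((w : ℂ), (v : ℂ)) = s((v : ℂ), (w : ℂ)) := Sym2.eq_swap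
        refine ⟨hs ▸ he, ?_⟩
        rw [← hc]
        congr 2⟩⟩
      loopless := ⟨fun v hv => hv.1 rfl⟩ }
  Bdry := fun i j v => (v : ℂ) ∈ triangleSide i ∧
    {z ∈ h.support ∩ triangleSide i | bary (i + 1) v < bary (i + 1) z}.ncard = j

/-- The number of segments that have `v` as an endpoint. -/
noncomputable def degree (v : ℂ) : ℕ := {w | s(v, w) ∈ h.edges}.ncard

/-- Triangular honeycombs of size `n`. -/
structure IsTriangular (n : ℕ) : Prop where
  isHoneycomb : h.IsHoneycomb triangle
  degree_eq : ∀ v ∈ h.vertices, h.degree v = 1 ∨ h.degree v = 3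
  support_inter : h.support ∩ triangleBoundary = {v ∈ h.vertices | h.degree v = 1}
  hasType : ∀ a b, s(a, b) ∈ h.edges → ∃ ℓ, HasType ℓ a b
  card_side : ∀ i, (h.support ∩ triangleSide i).ncard = n
  boundary_edge : ∀ i v w, s(v, w) ∈ h.edges → v ∈ triangleSide i →
    (h.HasColor .zero v w ∧ HasType (i + 1) v w) ∨ (h.HasColor .one v w ∧ HasType (i + 2) v w)
  color_mono : ∀ i v w v' w' c c', h.HasColor c v w → h.HasColor c' v' w' →
    v ∈ triangleSide i → v' ∈ triangleSide i → bary (i + 1) v < bary (i + 1) v' →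
      c.value ≤ c'.value

open Classical in
/-- The type of the segment `[v, w]`. -/
noncomputable def edgeType (v w : ℂ) : Fin 3 :=
  if HasType 0 v w then 0 else if HasType 1 v w then 1 else 2

/-- The height `L` of a segment `[v, w]` of type `ℓ`: the constant value of the coordinate of
index `ℓ` on this segment. -/
noncomputable def edgeHeight (v w : ℂ) : ℝ := bary (edgeType v w) v

open Classical in
/-- The sign `s(v)`: it is `1` if the segments at `v` leave `v` in directions
`-exp (2πi(ℓ+1)/3)`, and `-1` if they leave `v` in directions `exp (2πi(ℓ+1)/3)`. -/
noncomputable def vertexSign (v : ℂ) : ℝ :=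
  if ∃ (w : ℂ) (ℓ : Fin 3) (t : ℝ), s(v, w) ∈ h.edges ∧ 0 < t ∧ w = v - t * typeDir ℓ
  then 1 else -1

/-- The flow `𝓛[h](v, w) = s(v) L({v, w})` on oriented edges. -/
noncomputable def flow (v w : ℂ) : ℝ := h.vertexSign v * edgeHeight v w

end ColoredSegments

/-- `H_reg`: the tuples `1 > θ_1 > ⋯ > θ_n ≥ 0`. -/
structure IsRegularClass {n : ℕ} (θ : Fin n → ℝ) : Prop where
  strictAnti : StrictAnti θ
  mem_Ico : ∀ j, θ j ∈ Set.Ico (0 : ℝ) 1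

/-- The triangular honeycombs of size `n` with `d` edges of color `1` meeting each side of the
triangle, and with boundary values `(β, α, γ)`. -/
def honeycombs (n d : ℕ) (α β γ : Fin n → ℝ) : Set ColoredSegments :=
  {h | h.IsTriangular n ∧
    (∀ i, {e : Sym2 ℂ | ∃ v w, e = s(v, w) ∧ h.HasColor .one v w ∧ v ∈ triangleSide i}.ncard = d) ∧
    ∀ i : Fin 3, bary (i + 1) '' (h.support ∩ triangleSide i) = Set.range (![β, α, γ] i)}

/-! ## The hexagon, color maps, and the dual graph

Vertices `r + s exp (iπ/3)` of the triangular lattice have integer coordinates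
`(n + d - r - s, r, s)`. -/

/-- Vertices of `H_{d,n}`. -/
def IsHexPoint (n d : ℕ) (p : Fin 3 → ℤ) : Prop :=
  p 0 + p 1 + p 2 = n + d ∧ ∀ i, 0 ≤ p i ∧ p i ≤ n

/-- Edges of `H_{d,n}`: an edge of type `ℓ` joins `v` and `v - exp (2πiℓ/3)`, that is, adding to `v`
the vector `v ↦ v + ε_ℓ - ε_{ℓ+1}` in coordinates. -/
@[ext]
structure HexEdge (n d : ℕ) where
  type : Fin 3
  src : Fin 3 → ℤ
  src_mem : IsHexPoint n d src
  tgt_mem : IsHexPoint n d (src + Pi.single type 1 - Pi.single (type + 1) 1)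

/-- The other endpoint `v - exp (2πiℓ/3)`. -/
def HexEdge.tgt {n d : ℕ} (e : HexEdge n d) : Fin 3 → ℤ :=
  e.src + Pi.single e.type 1 - Pi.single (e.type + 1) 1

/-- The height `h(e) = v_ℓ`. -/
def HexEdge.height {n d : ℕ} (e : HexEdge n d) : ℤ := e.src e.type

/-- The corners of the upper triangle (`up = true`) and of the lower triangle (`up = false`)
of coordinates `x`. -/
def faceCorner (up : Bool) (x : Fin 3 → ℤ) (i : Fin 3) : Fin 3 → ℤ :=
  if up then x + Pi.single i 1 else x + 1 - Pi.single i 1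

/-- Triangular faces of `H_{d,n}`.  The coordinates `x` of a face are the heights of its edges of
types `0, 1, 2`. -/
@[ext]
structure HexFace (n d : ℕ) where
  up : Bool
  coord : Fin 3 → ℤ
  corner_mem : ∀ i, IsHexPoint n d (faceCorner up coord i)

/-- The edge of type `ℓ` of a triangular face. -/
def HexFace.edge {n d : ℕ} (f : HexFace n d) (ℓ : Fin 3) : HexEdge n d where
  type := ℓ
  src := if f.up then faceCorner f.up f.coord (ℓ + 1) else faceCorner f.up f.coord ℓ
  src_mem := by split <;> exact f.corner_mem _
  tgt_mem := by
    obtain ⟨up, x, hx⟩ := f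
    cases up
    · have := hx (ℓ + 1)
      simp only [faceCorner, Bool.false_eq_true, if_false] at this ⊢
      convert this using 1
      abel
    · have := hx ℓ
      simp only [faceCorner, if_true] at this ⊢
      convert this using 1
      abel

theorem HexFace.edge_height {n d : ℕ} (f : HexFace n d) (ℓ : Fin 3) :
    (f.edge ℓ).height = f.coord ℓ := by
  obtain ⟨up, x, hx⟩ := f
  cases up <;> fin_cases ℓ <;> simp [HexFace.edge, HexEdge.height, faceCorner]

theorem HexFace.coord_mem {n d : ℕ} (f : HexFace n d) (ℓ : Fin 3) :
    f.coord ℓ ∈ Set.Icc (0 : ℤ) n := by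
  rw [← f.edge_height ℓ]
  exact (f.edge ℓ).src_mem.2 _

instance (n d : ℕ) : Finite (HexFace n d) :=
  Finite.of_injective
    (fun f : HexFace n d => (f.up, fun ℓ => (⟨f.coord ℓ, f.coord_mem ℓ⟩ : Set.Icc (0 : ℤ) n)))
    (by
      intro f g hfg
      simp only [Prod.mk.injEq, funext_iff, Subtype.mk.injEq] at hfg
      exact HexFace.ext hfg.1 (funext hfg.2))

/-- The colors `0, 1, 3, m` of the edges of `H_{d,n}`. -/
inductive HiveColor
  | col (c : EdgeColor)
  | m

/-- Color maps: the colors around each triangular face, read clockwise (which is the order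
`0, 2, 1` of the types of its edges), are `(0,0,0)`, `(1,1,1)`, `(1,0,3)` or `(0,1,m)` up to a cyclic
rotation; the sides `p_i = 0` of the hexagon have color `0`, the sides `p_i = n` have color `1`. -/
structure IsColorMap {n d : ℕ} (C : HexEdge n d → HiveColor) : Prop where
  face : ∀ f : HexFace n d, ∃ k : Fin 3,
    (C (f.edge k), C (f.edge (k + 2)), C (f.edge (k + 1))) ∈
      ({(.col .zero, .col .zero, .col .zero), (.col .one, .col .one, .col .one),
        (.col .one, .col .zero, .col .three), (.col .zero, .col .one, .m)} :
        Set (HiveColor × HiveColor × HiveColor))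
  boundary_zero : ∀ (e : HexEdge n d) (i : Fin 3), e.src i = 0 → e.tgt i = 0 → C e = .col .zero
  boundary_one : ∀ (e : HexEdge n d) (i : Fin 3), e.src i = n → e.tgt i = n → C e = .col .one

/-- Vertices of the dual graph `Γ_{d,n}`: one for each triangular face, and one for each of the
`3n` outer edges, where `(i, j)` is the outer edge described in `IsOuterEdge`. -/
abbrev DualVertex (n d : ℕ) : Type := HexFace n d ⊕ (Fin 3 × Fin n)

/-- The outer edge of index `(i, j)`.  Along the hexagon, counterclockwise, these are for each `i`
first the `d` edges (of type `i + 2`) of the side `p_{i+1} = n`, then the `n - d` edges (of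
type `i + 1`) of the side `p_i = 0`. -/
def IsOuterEdge {n d : ℕ} (i : Fin 3) (j : Fin n) (e : HexEdge n d) : Prop :=
  (e.type = i + 2 ∧ e.src (i + 1) = n ∧ e.height = (j : ℕ)) ∨
    (e.type = i + 1 ∧ e.src i = 0 ∧ e.height = (n : ℤ) + d - 1 - (j : ℕ))

/-- The edge of `Γ_{d,n}` dual to `e` has `x` as an endpoint. -/
def IsIncident {n d : ℕ} (e : HexEdge n d) : DualVertex n d → Prop
  | .inl f => ∃ ℓ, f.edge ℓ = e
  | .inr (i, j) => IsOuterEdge i j e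

/-- The edge of `Γ_{d,n}` dual to `e` joins `x` and `y`. -/
def Joins {n d : ℕ} (e : HexEdge n d) (x y : DualVertex n d) : Prop :=
  x ≠ y ∧ IsIncident e x ∧ IsIncident e y

/-- The vertices of `Γ_{d,n}` that remain in the reduced graph: the boundary vertices, and the
faces without edge of color `m`. -/
def IsReducedVertex {n d : ℕ} (C : HexEdge n d → HiveColor) : DualVertex n d → Prop
  | .inl f => ∀ ℓ, C (f.edge ℓ) ≠ .m
  | .inr _ => True

/-- Vertices of the reduced graph `G^C`. -/
abbrev ReducedVertex {n d : ℕ} (C : HexEdge n d → HiveColor) : Type :=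
  {x : DualVertex n d // IsReducedVertex C x}

/-- There is a maximal chain from `x` to `y` of color `c` and type `ℓ`: a path in `Γ_{d,n}` with an
odd number of edges, the colors of which are alternately `c, m, c, …, m, c`. -/
def IsMaximalChain {n d : ℕ} (C : HexEdge n d → HiveColor) (c : EdgeColor) (ℓ : Fin 3)
    (x y : ReducedVertex C) : Prop :=
  ∃ (r : ℕ) (u : ℕ → DualVertex n d) (e : ℕ → HexEdge n d),
    u 0 = x ∧ u (2 * r + 1) = y ∧ Set.InjOn u (Set.Iic (2 * r + 1)) ∧
    (∀ i ≤ 2 * r, Joins (e i) (u i) (u (i + 1))) ∧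
    (∀ i ≤ r, C (e (2 * i)) = .col c ∧ (e (2 * i)).type = ℓ) ∧
    (∀ i < r, C (e (2 * i + 1)) = .m)

/-- The reduced graph `G^C`, as a colored graph with ordered boundary. -/
def reducedGraph {n d : ℕ} (C : HexEdge n d → HiveColor) :
    BdryColoredGraph n (ReducedVertex C) where
  colorClass := fun c => SimpleGraph.fromRel fun x y => ∃ ℓ, IsMaximalChain C c ℓ x y
  Bdry := fun i j x => x.1 = .inr (i, j)

/-- `{x, y}` is an edge of type `ℓ` of `G^C`. -/
def IsTypedEdge {n d : ℕ} (C : HexEdge n d → HiveColor) (ℓ : Fin 3) (x y : ReducedVertex C) : Prop :=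
  ∃ c, IsMaximalChain C c ℓ x y ∨ IsMaximalChain C c ℓ y x

/-- The sign `s` on the vertices of `G^C`: `1` on upper faces and `-1` on lower faces; on a boundary
vertex, `1` if its edge has color `1` and `-1` if its edge has color `0`. -/
def reducedSign {n d : ℕ} (C : HexEdge n d → HiveColor) (x : ReducedVertex C) : ℝ :=
  match x.1 with
  | .inl f => if f.up then 1 else -1
  | .inr (_, j) => if (j : ℕ) < d then 1 else -1

/-- The divergence `φ_{α,β,γ}` on `G^C`: it is `s(v)` at inner vertices, and at the boundary vertex of
index `(i, j)` with boundary value `b` it is `1 - b` if the edge has color `1` (that is, `j < d`),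
and `-b` if the edge has color `0`. -/
def flowDivergence {n d : ℕ} (C : HexEdge n d → HiveColor) (α β γ : Fin n → ℝ)
    (x : ReducedVertex C) : ℝ :=
  match x.1 with
  | .inl _ => reducedSign C x
  | .inr (i, j) => if (j : ℕ) < d then 1 - ![β, α, γ] i j else - ![β, α, γ] i j

/-- The cover relation on (oriented) edges of `G^C`: `{v, w} < {v', w'}` if both edges have the same
type `ℓ`, if `{w, v'}` is an edge of type `ℓ + 1`, and if `w_ℓ < v'_ℓ`. -/
def Covers {n d : ℕ} (C : HexEdge n d → HiveColor) (p p' : (reducedGraph C).graph.Dart) : Prop :=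
  ∃ (ℓ : Fin 3) (f f' : HexFace n d), p.snd.1 = .inl f ∧ p'.fst.1 = .inl f' ∧
    IsTypedEdge C ℓ p.fst p.snd ∧ IsTypedEdge C ℓ p'.fst p'.snd ∧
    IsTypedEdge C (ℓ + 1) p.snd p'.fst ∧ f.coord ℓ < f'.coord ℓ

/-- The cone `K_{G^C}`: the flows `ω = s · L` with `L` positive on all edges and strictly increasing
along the cover relation. -/
def flowCone {n d : ℕ} (C : HexEdge n d → HiveColor) : Set ((reducedGraph C).graph.Dart → ℝ) :=
  {ω | ω ∈ flowSpace (reducedGraph C).graph ∧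
    (∀ p, 0 < reducedSign C p.fst * ω p) ∧
    ∀ p p', Covers C p p' → |ω p| < |ω p'|}

/-- The image under `𝓛` of the set of the honeycombs with boundary `(α, β, γ)` whose structure graph
is isomorphic to `G^C`.  The flow of `h` is carried to `G^C` along the isomorphism. -/
def honeycombFlows {n d : ℕ} (C : HexEdge n d → HiveColor) (α β γ : Fin n → ℝ) :
    Set ((reducedGraph C).graph.Dart → ℝ) :=
  {ω | ∃ h ∈ honeycombs n d α β γ, ∃ ι : BdryColoredIso (reducedGraph C) (h.structureGraph n),
    ω = fun p => h.flow (ι.toEquiv p.fst) (ι.toEquiv p.snd)}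

/-! From honeycombs to flows. An isomorphism of `G^C` with the structure graph of a honeycomb
respects colors and boundary vertices only, so one first shows that it also respects the types and
the directions of the edges (`isDrawing_iso`). For every edge, compare its length with its component
along the direction that `G^C` prescribes. The difference is nonnegative and vanishes only when the
directions agree. Its sum over the edges can be rearranged as a sum over the vertices, and there it
vanishes: at an inner vertex both the actual and the prescribed directions sum to zero, and at a
boundary vertex they coincide. So all differences are zero. The rest is read off from coordinates
(`IsDrawing.flow_mem`). The three heights at an inner vertex are its barycentric coordinates and sum
to `1`. A height cannot be `0`, since the edge would then lie in a side of the triangle, which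
contains only `n` points of the honeycomb. The cover relation compares two parallel edges separated
by an edge of positive length.

From flows to honeycombs. A flow in the cone gives heights of the edges (`isHeight_of_flow`). The
heights at an inner vertex sum to `1`, hence define a point, and the inequalities of the cone say
that edges between inner vertices have positive length in the right direction. What remains is
global: distinct vertices must have distinct positions, and edges may cross only in the permitted
way.

This follows from a weighted count of crossings. Let `e_0 + e_1 + e_2 = 0` in the plane with `det
(e_ℓ, e_{ℓ+1}) = 1`. Attach to an edge of type `ℓ` and color `0, 1, 3, m` the vector `e_ℓ`,
`-e_{ℓ+1}`, `e_ℓ - e_{ℓ+1}`, `0`, and let the weight of a pair of edges be the determinant of their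
vectors. The vectors around a face sum to zero. For distinct types and colors other than `m`, the
weight times the sign of the types is nonnegative. It vanishes only if an edge of color `1` and type
`ℓ` is paired with one of color `0` and type `ℓ + 1`, which is the crossing that honeycombs permit
(`colorWeight_nonneg`, `colorWeight_eq_zero`).

Because the vectors balance at every vertex, the weighted number of crossings depends on the
positions only through coincidences of vertices; the rest is a constant `rayConst` of the boundary
rays (`EdgeSystem.sum_meet`). This constant is computed in another drawing with the same rays: the
whole dual graph of the hexagon, drawn as a regular hexagonal lattice, where edges of distinct types
meet only at common vertices (`rayConst_hex`). Faces with an edge of color `m` have area zero there,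
so the constant is exactly what the common ends of the edges of `G^C` account for. In the drawing
given by the flow, every further meeting of edges of nonzero weight and every coincidence of
vertices adds a nonnegative term, and these terms sum to zero (`EdgeSystem.Directed.eq_zero`). Hence
edges of distinct types meet only at common ends or with weight `0`. No two vertices coincide and no
upper vertex lies inside an edge, because three legs cannot all have weight `0` where they need to.
The drawing is then a honeycomb whose flow is the given one. -/

/-! ## Crossings in a system of edges of three directions -/

/-- The sign of a pair of types: `1` if the second one follows the first one cyclically. -/
def typeSign (ℓ k : Fin 3) : ℝ := if k = ℓ + 1 then 1 else if k = ℓ + 2 then -1 else 0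

/-- The sign of the upper (`true`) and of the lower (`false`) end of an edge. -/
def endSign (b : Bool) : ℝ := if b then 1 else -1

theorem endSign_mul_self (b : Bool) : endSign b * endSign b = 1 := by
  cases b <;> simp [endSign]

theorem typeSign_self (ℓ : Fin 3) : typeSign ℓ ℓ = 0 := by
  fin_cases ℓ <;> simp [typeSign]

theorem typeSign_swap (ℓ k : Fin 3) : typeSign k ℓ = - typeSign ℓ k := by
  fin_cases ℓ <;> fin_cases k <;> simp [typeSign]

theorem typeSign_mul_swap (ℓ k : Fin 3) :
    typeSign ℓ k * typeSign k ℓ = if ℓ = k then 0 else -1 := by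
  fin_cases ℓ <;> fin_cases k <;> simp [typeSign]

/-- A finite system of segments and rays of three directions.  The vertices `v : I` have one edge
of each type, and `B` is the set of rays.  `ends` enumerates the ends of the edges. -/
structure EdgeSystem (I B E : Type) where
  ends : (I × Fin 3) ⊕ B ≃ E × Bool
  type : E → Fin 3
  up : I → Bool
  upRay : B → Bool
  weight : E → E → ℝ
  hgt : E → ℝ
  pos : I → Fin 3 → ℝ
  type_ends : ∀ v ℓ, type (ends (.inl (v, ℓ))).1 = ℓ
  ends_up : ∀ v ℓ, (ends (.inl (v, ℓ))).2 = up v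
  ends_upRay : ∀ b, (ends (.inr b)).2 = upRay b
  weight_swap : ∀ e e', weight e' e = - weight e e'
  sum_weight : ∀ v e', ∑ ℓ, weight (ends (.inl (v, ℓ))).1 e' = 0
  weight_ray : ∀ b b', type (ends (.inr b)).1 = type (ends (.inr b')).1 → upRay b = upRay b' →
    weight (ends (.inr b)).1 (ends (.inr b')).1 = 0
  pos_eq : ∀ v ℓ, pos v ℓ = hgt (ends (.inl (v, ℓ))).1
  sum_pos : ∀ v v', ∑ ℓ, pos v ℓ = ∑ ℓ, pos v' ℓ

namespace EdgeSystem

variable {I B E : Type} (S : EdgeSystem I B E)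

/-- The edge of type `ℓ` at `v`. -/
def leg (v : I) (ℓ : Fin 3) : E := (S.ends (.inl (v, ℓ))).1

/-- The ray of index `b`. -/
def ray (b : B) : E := (S.ends (.inr b)).1

theorem type_leg (v : I) (ℓ : Fin 3) : S.type (S.leg v ℓ) = ℓ := S.type_ends v ℓ

theorem hgt_leg (v : I) (ℓ : Fin 3) : S.hgt (S.leg v ℓ) = S.pos v ℓ := (S.pos_eq v ℓ).symm

theorem ends_inl (v : I) (ℓ : Fin 3) : S.ends (.inl (v, ℓ)) = (S.leg v ℓ, S.up v) :=
  Prod.ext rfl (S.ends_up v ℓ)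

theorem ends_inr (b : B) : S.ends (.inr b) = (S.ray b, S.upRay b) :=
  Prod.ext rfl (S.ends_upRay b)

/-- The side of the line of height `h` and type `k` on which an end of an edge lies; the ends of
rays are at infinity. -/
noncomputable def side (k : Fin 3) (h : ℝ) : (I × Fin 3) ⊕ B → ℝ
  | .inl (v, _) => Real.sign (S.pos v k - h)
  | .inr b => - (endSign (S.upRay b) * typeSign (S.type (S.ray b)) k)

/-- The signed crossing number of an edge with the line of height `h` and type `k`. -/
noncomputable def cross (e : E) (k : Fin 3) (h : ℝ) : ℝ :=
  ∑ b, endSign b * S.side k h (S.ends.symm (e, b))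

/-- Four times the crossing number of two edges of distinct types. -/
noncomputable def meet (e e' : E) : ℝ :=
  - (S.cross e (S.type e') (S.hgt e') * S.cross e' (S.type e) (S.hgt e))

/-- The mutual area of two vertices. -/
def area (v v' : I) : ℝ :=
  S.weight (S.leg v 0) (S.leg v' 1) - S.weight (S.leg v 1) (S.leg v' 0)

theorem sum_weight_leg (v : I) (e' : E) : ∑ ℓ, S.weight (S.leg v ℓ) e' = 0 := S.sum_weight v e'

theorem sum_weight_leg_right (e : E) (v : I) : ∑ ℓ, S.weight e (S.leg v ℓ) = 0 := by
  rw [← neg_eq_zero, ← Finset.sum_neg_distrib, ← S.sum_weight_leg v e]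
  exact Finset.sum_congr rfl fun ℓ _ => (S.weight_swap _ _).symm

/-- The local form of the invariance: `M` collects the weights between the legs of two vertices and
`δ` is the difference of their positions. Balance at both vertices makes the sum independent of `δ`,
as long as `δ` is nonzero. The possible sign patterns of a triple of sum zero are checked one by
one. -/
theorem sum_typeSign_mul_sign (M : Fin 3 → Fin 3 → ℝ) (δ : Fin 3 → ℝ)
    (hr : ∀ i, ∑ j, M i j = 0) (hc : ∀ j, ∑ i, M i j = 0) (hδ : ∑ i, δ i = 0) :
    ∑ i, ∑ j, typeSign i j * M i j * (Real.sign (δ j) * Real.sign (δ i)) =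
      if δ = 0 then 0 else - (M 0 1 - M 1 0) := by
  split_ifs with h
  · simp [h]
  have h0 := hr 0; have h1 := hr 1; have h2 := hr 2
  have k0 := hc 0; have k1 := hc 1; have k2 := hc 2
  simp only [Fin.sum_univ_three] at *
  have e : typeSign 0 0 = 0 ∧ typeSign 0 1 = 1 ∧ typeSign 0 2 = -1 ∧ typeSign 1 0 = -1 ∧
      typeSign 1 1 = 0 ∧ typeSign 1 2 = 1 ∧ typeSign 2 0 = 1 ∧ typeSign 2 1 = -1 ∧
      typeSign 2 2 = 0 := by simp [typeSign]
  obtain ⟨e1, e2, e3, e4, e5, e6, e7, e8, e9⟩ := e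
  rw [e1, e2, e3, e4, e5, e6, e7, e8, e9]
  have hne : ¬ (δ 0 = 0 ∧ δ 1 = 0 ∧ δ 2 = 0) := fun ⟨a, b, c⟩ => h (by
    funext i; fin_cases i <;> assumption)
  rcases lt_trichotomy (δ 0) 0 with a | a | a <;> rcases lt_trichotomy (δ 1) 0 with b | b | b <;>
    rcases lt_trichotomy (δ 2) 0 with c | c | c <;>
    first
    | (exfalso; linarith)
    | (exfalso; exact hne ⟨a, b, c⟩)
    | (simp only [a, b, c, Real.sign_of_neg, Real.sign_of_pos, Real.sign_zero]; linarith)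

variable [Fintype I] [Fintype B] [Fintype E]

theorem sum_ends (F : E × Bool → ℝ) :
    ∑ e, ∑ b, F (e, b) =
      ∑ v, ∑ ℓ, F (S.leg v ℓ, S.up v) + ∑ b, F (S.ray b, S.upRay b) := by
  rw [← Fintype.sum_prod_type', ← S.ends.sum_comp, Fintype.sum_sum_type, Fintype.sum_prod_type]
  simp only [ends_inl, ends_inr]

/-- The two ends of an edge have opposite signs, so the sum over all ends of edges of type `ℓ` is
zero; the ends that are not at a vertex are those of rays. -/
theorem sum_sign_leg (f : E → ℝ) (ℓ : Fin 3) :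
    ∑ v, endSign (S.up v) * f (S.leg v ℓ) =
      - ∑ b, if S.type (S.ray b) = ℓ then endSign (S.upRay b) * f (S.ray b) else 0 := by
  have h := S.sum_ends fun q => if S.type q.1 = ℓ then endSign q.2 * f q.1 else 0
  have h0 : ∑ e, ∑ b, (fun q : E × Bool => if S.type q.1 = ℓ then endSign q.2 * f q.1 else 0) (e, b)
      = 0 := by
    refine Finset.sum_eq_zero fun e _ => ?_
    by_cases he : S.type e = ℓ <;> simp [he, endSign]
  rw [h0] at h
  simp only [type_leg, Finset.sum_ite_eq', Finset.mem_univ, if_true] at h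
  linarith

/-- The contribution of the rays to the sum of the crossing numbers. -/
noncomputable def rayConst (t : B → Fin 3) (u : B → Bool) (w : B → B → ℝ) : ℝ :=
  ∑ b, ∑ b', typeSign (t b) (t b') * w b b' -
    ∑ b, ∑ b', endSign (u b) * endSign (u b') *
      ((if t b = 0 ∧ t b' = 1 then w b b' else 0) - if t b = 1 ∧ t b' = 0 then w b b' else 0)

/-- Applying `sum_sign_leg` in each of the two variables moves the sum from the vertices to the
rays, where positions no longer enter. -/
theorem sum_sign_area :
    ∑ v, ∑ v', endSign (S.up v) * endSign (S.up v') * S.area v v' =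
      ∑ b, ∑ b', endSign (S.upRay b) * endSign (S.upRay b') *
        ((if S.type (S.ray b) = 0 ∧ S.type (S.ray b') = 1 then S.weight (S.ray b) (S.ray b') else 0)
        - if S.type (S.ray b) = 1 ∧ S.type (S.ray b') = 0 then S.weight (S.ray b) (S.ray b')
          else 0) := by
  have key : ∀ ℓ ℓ' : Fin 3, ∑ v, ∑ v', endSign (S.up v) * endSign (S.up v') *
      S.weight (S.leg v ℓ) (S.leg v' ℓ') = ∑ b, ∑ b', endSign (S.upRay b) * endSign (S.upRay b') *
        (if S.type (S.ray b) = ℓ ∧ S.type (S.ray b') = ℓ' then S.weight (S.ray b) (S.ray b')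
          else 0) := by
    intro ℓ ℓ'
    have h1 : ∀ v, ∑ v', endSign (S.up v) * endSign (S.up v') *
        S.weight (S.leg v ℓ) (S.leg v' ℓ') = endSign (S.up v) *
        (- ∑ b', if S.type (S.ray b') = ℓ' then endSign (S.upRay b') *
          S.weight (S.leg v ℓ) (S.ray b') else 0) := by
      intro v
      rw [← S.sum_sign_leg (fun e => S.weight (S.leg v ℓ) e) ℓ', Finset.mul_sum]
      exact Finset.sum_congr rfl fun v' _ => by ring
    rw [Finset.sum_congr rfl fun v _ => h1 v,
      S.sum_sign_leg (fun e => - ∑ b', if S.type (S.ray b') = ℓ' then endSign (S.upRay b') *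
          S.weight e (S.ray b') else 0) ℓ, ← Finset.sum_neg_distrib]
    refine Finset.sum_congr rfl fun b _ => ?_
    split_ifs with h
    · rw [mul_neg, neg_neg, Finset.mul_sum]
      refine Finset.sum_congr rfl fun b' _ => ?_
      by_cases h' : S.type (S.ray b') = ℓ' <;> simp [h, h', mul_assoc]
    · simp [h]
  simp only [area, mul_sub, Finset.sum_sub_distrib, key]

/-- By `sum_sign_leg` only pairs of parallel rays remain, and exchanging the two rays changes the
sign of the term: rays in the same direction have weight `0`, and for opposite rays the end sign,
the weight and the sign of the height difference all change. -/
theorem sum_vertex_ray :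
    ∑ b', ∑ v, endSign (S.up v) * (S.weight (S.leg v (S.type (S.ray b'))) (S.ray b') *
      Real.sign (S.pos v (S.type (S.ray b')) - S.hgt (S.ray b'))) = 0 := by
  have h1 : ∀ b', ∑ v, endSign (S.up v) * (S.weight (S.leg v (S.type (S.ray b'))) (S.ray b') *
      Real.sign (S.pos v (S.type (S.ray b')) - S.hgt (S.ray b'))) =
      - ∑ b, if S.type (S.ray b) = S.type (S.ray b') then endSign (S.upRay b) *
        (S.weight (S.ray b) (S.ray b') * Real.sign (S.hgt (S.ray b) - S.hgt (S.ray b'))) else 0 := by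
    intro b'
    rw [← S.sum_sign_leg (fun e => S.weight e (S.ray b') *
      Real.sign (S.hgt e - S.hgt (S.ray b'))) (S.type (S.ray b'))]
    simp only [hgt_leg]
  rw [Finset.sum_congr rfl fun b' _ => h1 b', Finset.sum_neg_distrib, neg_eq_zero]
  set f : B → B → ℝ := fun b' b => if S.type (S.ray b) = S.type (S.ray b') then endSign (S.upRay b) *
        (S.weight (S.ray b) (S.ray b') * Real.sign (S.hgt (S.ray b) - S.hgt (S.ray b'))) else 0
    with hf
  have hsymm : ∀ b b', f b b' + f b' b = 0 := by
    intro b b'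
    simp only [hf]
    by_cases h : S.type (S.ray b) = S.type (S.ray b')
    · rw [if_pos h, if_pos h.symm]
      by_cases hu : S.upRay b = S.upRay b'
      · have h1 : S.weight (S.ray b) (S.ray b') = 0 := S.weight_ray b b' h hu
        have h2 : S.weight (S.ray b') (S.ray b) = 0 := S.weight_ray b' b h.symm hu.symm
        simp [h1, h2]
      · have h3 : endSign (S.upRay b') = - endSign (S.upRay b) := by
          revert hu; cases S.upRay b <;> cases S.upRay b' <;> simp [endSign]
        rw [h3, S.weight_swap (S.ray b) (S.ray b'),
          ← neg_sub (S.hgt (S.ray b)) (S.hgt (S.ray b')), Real.sign_neg]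
        ring
    · rw [if_neg h, if_neg (Ne.symm h), add_zero]
  have h2 : ∑ b', ∑ b, f b' b + ∑ b', ∑ b, f b' b = 0 := by
    nth_rewrite 2 [Finset.sum_comm]
    simp only [← Finset.sum_add_distrib, hsymm, Finset.sum_const_zero]
  linarith

-- Expanding each crossing number over the ends of the edges gives a double sum over ends. Pairs of
-- vertices are handled by `sum_typeSign_mul_sign`, a vertex and a ray by `sum_vertex_ray`, and
-- pairs of rays give constants. The last term corrects for coinciding vertices, all of whose sides
-- are `0`.
open Classical in
theorem sum_meet :
    ∑ e, ∑ e', typeSign (S.type e) (S.type e') * S.weight e e' * S.meet e e' =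
      rayConst (fun b => S.type (S.ray b)) S.upRay (fun b b' => S.weight (S.ray b) (S.ray b')) +
      ∑ v, ∑ v', if S.pos v = S.pos v' then endSign (S.up v) * endSign (S.up v') * S.area v v'
        else 0 := by
  set K : E × Bool → E × Bool → ℝ := fun q q' =>
    - (typeSign (S.type q.1) (S.type q'.1) * S.weight q.1 q'.1 *
      (endSign q.2 * S.side (S.type q'.1) (S.hgt q'.1) (S.ends.symm q)) *
      (endSign q'.2 * S.side (S.type q.1) (S.hgt q.1) (S.ends.symm q'))) with hK
  have hKs : ∀ q q', K q q' = K q' q := by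
    intro q q'
    simp only [hK]
    rw [typeSign_swap (S.type q.1) (S.type q'.1), S.weight_swap q.1 q'.1]
    ring
  have h1 : ∑ e, ∑ e', typeSign (S.type e) (S.type e') * S.weight e e' * S.meet e e' =
      ∑ q, ∑ q', K q q' := by
    rw [Fintype.sum_prod_type]
    refine Finset.sum_congr rfl fun e _ => ?_
    simp only [Fintype.sum_prod_type]
    rw [Finset.sum_comm]
    refine Finset.sum_congr rfl fun e' _ => ?_
    simp only [hK, meet, cross, Fintype.sum_bool]
    ring
  have hII : ∀ v v', ∑ ℓ, ∑ ℓ', K (S.leg v ℓ, S.up v) (S.leg v' ℓ', S.up v') =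
      (if S.pos v = S.pos v' then endSign (S.up v) * endSign (S.up v') * S.area v v' else 0) -
        endSign (S.up v) * endSign (S.up v') * S.area v v' := by
    intro v v'
    have h := sum_typeSign_mul_sign (fun ℓ ℓ' => S.weight (S.leg v ℓ) (S.leg v' ℓ'))
      (fun ℓ => S.pos v ℓ - S.pos v' ℓ) (fun ℓ => S.sum_weight_leg_right _ v')
      (fun ℓ => S.sum_weight_leg v _) (by rw [Finset.sum_sub_distrib, S.sum_pos v v', sub_self])
    have hz : ((fun ℓ => S.pos v ℓ - S.pos v' ℓ) = 0) ↔ S.pos v = S.pos v' := by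
      simp only [funext_iff, Pi.zero_apply, sub_eq_zero]
    have hs : ∑ ℓ, ∑ ℓ', K (S.leg v ℓ, S.up v) (S.leg v' ℓ', S.up v') =
        endSign (S.up v) * endSign (S.up v') * ∑ ℓ, ∑ ℓ', typeSign ℓ ℓ' *
          S.weight (S.leg v ℓ) (S.leg v' ℓ') * (Real.sign (S.pos v ℓ' - S.pos v' ℓ') *
          Real.sign (S.pos v ℓ - S.pos v' ℓ)) := by
      simp only [Finset.mul_sum]
      refine Finset.sum_congr rfl fun ℓ _ => Finset.sum_congr rfl fun ℓ' _ => ?_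
      simp only [hK, ← ends_inl, Equiv.symm_apply_apply, side]
      simp only [ends_inl, type_leg, hgt_leg]
      rw [← neg_sub (S.pos v ℓ) (S.pos v' ℓ), Real.sign_neg]
      ring
    rw [hs, h]
    simp only [hz]
    split_ifs <;> simp only [area] <;> ring
  have hIB : ∑ p : I × Fin 3, ∑ b', K (S.ends (.inl p)) (S.ends (.inr b')) = 0 := by
    rw [Finset.sum_comm, ← S.sum_vertex_ray]
    refine Finset.sum_congr rfl fun b' _ => ?_
    rw [Fintype.sum_prod_type]
    refine Finset.sum_congr rfl fun v _ => ?_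
    set k := S.type (S.ray b') with hk
    -- The product of the two type signs is `0` for the leg parallel to the ray and `-1` for the
    -- others, so the balance at `v` trades the other two legs for the parallel one.
    have hterm : ∀ ℓ, K (S.ends (.inl (v, ℓ))) (S.ends (.inr b')) =
        (endSign (S.up v) * Real.sign (S.pos v k - S.hgt (S.ray b'))) *
          ((if ℓ = k then S.weight (S.leg v ℓ) (S.ray b') else 0) -
            S.weight (S.leg v ℓ) (S.ray b')) := by
      intro ℓ
      have h2 := typeSign_mul_swap ℓ k
      have h3 := endSign_mul_self (S.upRay b')
      simp only [hK, Equiv.symm_apply_apply, side]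
      simp only [ends_inl, ends_inr, type_leg, ← hk]
      have : ∀ a w s x u t t' : ℝ, u * u = 1 →
          -(t * w * (s * x) * (u * -(u * t'))) = s * x * (t * t' * w) := by
        intro a w s x u t t' hu
        linear_combination (t * w * s * x * t') * hu
      rw [this 0 _ _ _ _ _ _ h3, h2]
      split_ifs <;> ring
    rw [Finset.sum_congr rfl fun ℓ _ => hterm ℓ, ← Finset.mul_sum, Finset.sum_sub_distrib,
      S.sum_weight_leg, Finset.sum_ite_eq' Finset.univ k, if_pos (Finset.mem_univ _)]
    ring
  have hBB : ∀ b b', K (S.ends (.inr b)) (S.ends (.inr b')) =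
      typeSign (S.type (S.ray b)) (S.type (S.ray b')) * S.weight (S.ray b) (S.ray b') := by
    intro b b'
    simp only [hK, Equiv.symm_apply_apply, side]
    simp only [ends_inr]
    have h2 := typeSign_mul_swap (S.type (S.ray b)) (S.type (S.ray b'))
    have h3 := endSign_mul_self (S.upRay b)
    have h4 := endSign_mul_self (S.upRay b')
    by_cases h : S.type (S.ray b) = S.type (S.ray b')
    · simp [h, typeSign_self]
    · rw [if_neg h] at h2
      generalize typeSign (S.type (S.ray b)) (S.type (S.ray b')) = t at *
      generalize typeSign (S.type (S.ray b')) (S.type (S.ray b)) = t' at *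
      generalize endSign (S.upRay b) = u at *
      generalize endSign (S.upRay b') = u' at *
      generalize S.weight (S.ray b) (S.ray b') = w at *
      linear_combination (-(t * w * t * t') * u' * u') * h3 - (t * w * t * t') * h4 - t * w * h2
  rw [h1, ← S.ends.sum_comp]
  simp only [← S.ends.sum_comp (fun q' => K _ q'), Fintype.sum_sum_type, Finset.sum_add_distrib]
  rw [hIB, Finset.sum_comm (f := fun b p => K (S.ends (.inr b)) (S.ends (.inl p)))]
  simp only [hKs (S.ends (.inr _)) (S.ends (.inl _))]
  rw [hIB]
  simp only [hBB, Fintype.sum_prod_type, ends_inl]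
  have h5 : ∑ v, ∑ ℓ, ∑ v', ∑ ℓ', K (S.leg v ℓ, S.up v) (S.leg v' ℓ', S.up v') =
      ∑ v, ∑ v', ((if S.pos v = S.pos v' then endSign (S.up v) * endSign (S.up v') * S.area v v'
        else 0) - endSign (S.up v) * endSign (S.up v') * S.area v v') := by
    refine Finset.sum_congr rfl fun v _ => ?_
    rw [Finset.sum_comm]
    exact Finset.sum_congr rfl fun v' _ => hII v v'
  rw [h5]
  simp only [Finset.sum_sub_distrib]
  rw [S.sum_sign_area, rayConst]
  ring

end EdgeSystem

/-! ### Directed systems: nonnegativity of crossings, and incidences. -/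

namespace EdgeSystem

variable {I B E : Type} (S : EdgeSystem I B E)

/-- The end `b` of the edge `e`. -/
def fin (e : E) (b : Bool) : (I × Fin 3) ⊕ B := S.ends.symm (e, b)

theorem fin_inl {e : E} {b : Bool} {v : I} {ℓ : Fin 3} (h : S.fin e b = .inl (v, ℓ)) :
    e = S.leg v ℓ ∧ b = S.up v ∧ ℓ = S.type e := by
  have h1 : (e, b) = (S.leg v ℓ, S.up v) := by
    rw [← S.ends_inl, ← h, fin, Equiv.apply_symm_apply]
  obtain ⟨h2, h3⟩ := Prod.mk.inj h1
  exact ⟨h2, h3, by rw [h2, S.type_leg]⟩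

theorem fin_inr {e : E} {b : Bool} {r : B} (h : S.fin e b = .inr r) :
    e = S.ray r ∧ b = S.upRay r := by
  have h1 : (e, b) = (S.ray r, S.upRay r) := by
    rw [← S.ends_inr, ← h, fin, Equiv.apply_symm_apply]
  exact Prod.mk.inj h1

open Classical in
/-- Two ends of edges are at the same vertex. -/
noncomputable def near : (I × Fin 3) ⊕ B → (I × Fin 3) ⊕ B → ℝ
  | .inl (v, _), .inl (v', _) => if S.pos v = S.pos v' then 1 else 0
  | _, _ => 0

/-- The number of pairs of ends of two edges that are at the same vertex. -/
noncomputable def inc (e e' : E) : ℝ := ∑ b, ∑ b', S.near (S.fin e b) (S.fin e' b')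

/-- The edges between two vertices go in the right direction. -/
def Directed : Prop := ∀ e v v' ℓ ℓ', S.fin e true = .inl (v, ℓ) → S.fin e false = .inl (v', ℓ') →
  S.pos v (S.type e + 1) < S.pos v' (S.type e + 1)

theorem pos_eq_hgt {e : E} {b : Bool} {v : I} {ℓ : Fin 3} (h : S.fin e b = .inl (v, ℓ)) :
    S.pos v (S.type e) = S.hgt e := by
  obtain ⟨h1, -, h3⟩ := S.fin_inl h
  rw [← h3, h1, S.hgt_leg]

-- The coordinate of index `type e` agrees at both ends and the sums of the coordinates are equal,
-- so a gain at index `+ 1` is a loss at index `+ 2`.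
variable {S} in
theorem Directed.lt (hS : S.Directed) {e : E} {v v' : I} {ℓ ℓ' : Fin 3}
    (h : S.fin e true = .inl (v, ℓ)) (h' : S.fin e false = .inl (v', ℓ')) :
    S.pos v' (S.type e + 2) < S.pos v (S.type e + 2) := by
  have h1 := hS e v v' ℓ ℓ' h h'
  have h2 := S.pos_eq_hgt h
  have h3 := S.pos_eq_hgt h'
  have h4 := S.sum_pos v v'
  simp only [Fin.sum_univ_three] at h4
  generalize S.type e = t at *
  fin_cases t <;> simp at * <;> linarith

theorem sign_cases {x y : ℝ} (h : x < y) (t : ℝ) (a b : ℝ) (ha : a = Real.sign (x - t))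
    (hb : b = Real.sign (y - t)) : a - b ≤ 0 ∧ (a = 0 → b = 1) ∧ (b = 0 → a = -1) := by
  subst ha hb
  rcases lt_trichotomy (x - t) 0 with h1 | h1 | h1 <;>
    rcases lt_trichotomy (y - t) 0 with h2 | h2 | h2 <;>
    first
    | (exfalso; linarith)
    | (simp only [h1, h2, Real.sign_of_neg, Real.sign_of_pos, Real.sign_zero]; norm_num)

-- A line of another type is traversed by a directed edge in the sense given by `typeSign`, the end
-- of a ray counting as infinitely far. In particular at most one end lies on the line.
variable {S} in
theorem Directed.side_cases (hS : S.Directed) (e : E) (k : Fin 3) (h : ℝ) (hk : S.type e ≠ k) :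
    typeSign (S.type e) k * (S.side k h (S.fin e true) - S.side k h (S.fin e false)) ≤ 0 ∧
    (S.side k h (S.fin e true) = 0 → S.side k h (S.fin e false) = typeSign (S.type e) k) ∧
    (S.side k h (S.fin e false) = 0 → S.side k h (S.fin e true) = - typeSign (S.type e) k) := by
  have hk' : (k = S.type e + 1 ∧ typeSign (S.type e) k = 1) ∨
      (k = S.type e + 2 ∧ typeSign (S.type e) k = -1) := by
    generalize S.type e = t at *
    fin_cases t <;> fin_cases k <;> simp [typeSign] at hk ⊢
  have hray : ∀ b r, S.fin e b = .inr r →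
      S.side k h (S.fin e b) = - (endSign b * typeSign (S.type e) k) := by
    intro b r hr
    obtain ⟨h1, h2⟩ := S.fin_inr hr
    rw [hr, side, ← h2, ← h1]
  have hs1 : ∀ x : ℝ, x.sign = -1 ∨ x.sign = 0 ∨ x.sign = 1 := Real.sign_apply_eq
  rcases ht : S.fin e true with ⟨v, ℓ⟩ | r <;> rcases hf : S.fin e false with ⟨v', ℓ'⟩ | r'
  · have h1 := hS e v v' ℓ ℓ' ht hf
    have h2 := hS.lt ht hf
    rcases hk' with ⟨rfl, hk'⟩ | ⟨rfl, hk'⟩ <;> rw [hk'] <;> simp only [side]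
    · have := sign_cases h1 h _ _ rfl rfl
      exact ⟨by linarith, this.2⟩
    · have := sign_cases h2 h _ _ rfl rfl
      exact ⟨by linarith, fun h => this.2.2 h, fun h => by rw [this.2.1 h]; norm_num⟩
  · have := hray false r' hf
    rw [hf] at this
    rw [this]
    simp only [side]
    rcases hk' with ⟨rfl, hk'⟩ | ⟨rfl, hk'⟩ <;> rw [hk'] <;>
      rcases hs1 (S.pos v _ - h) with h1 | h1 | h1 <;> rw [h1] <;> norm_num [endSign]
  · have := hray true r ht
    rw [ht] at this
    rw [this]
    simp only [side]
    rcases hk' with ⟨rfl, hk'⟩ | ⟨rfl, hk'⟩ <;> rw [hk'] <;>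
      rcases hs1 (S.pos v' _ - h) with h1 | h1 | h1 <;> rw [h1] <;> norm_num [endSign]
  · have h1 := hray true r ht
    have h2 := hray false r' hf
    rw [ht] at h1
    rw [hf] at h2
    rw [h1, h2]
    rcases hk' with ⟨rfl, hk'⟩ | ⟨rfl, hk'⟩ <;> rw [hk'] <;> norm_num [endSign]

theorem cross_eq (e : E) (k : Fin 3) (h : ℝ) :
    S.cross e k h = S.side k h (S.fin e true) - S.side k h (S.fin e false) := by
  simp [cross, fin, endSign, sub_eq_add_neg]

theorem typeSign_ne {ℓ k : Fin 3} (h : ℓ ≠ k) :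
    typeSign ℓ k * typeSign ℓ k = 1 ∧ typeSign k ℓ = - typeSign ℓ k :=
  ⟨by have := typeSign_mul_swap ℓ k
      rw [if_neg h, typeSign_swap ℓ k] at this
      linarith, typeSign_swap ℓ k⟩

-- The sign of each crossing number is prescribed by `typeSign`, whose antisymmetry is compensated
-- by the minus sign in `meet`.
variable {S} in
theorem Directed.meet_nonneg (hS : S.Directed) {e e' : E} (h : S.type e ≠ S.type e') :
    0 ≤ S.meet e e' := by
  have h1 := (hS.side_cases e _ (S.hgt e') h).1
  have h2 := (hS.side_cases e' _ (S.hgt e) h.symm).1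
  rw [← cross_eq] at h1 h2
  obtain ⟨h3, h4⟩ := typeSign_ne h
  rw [h4] at h2
  rw [meet]
  nlinarith [mul_nonneg_of_nonpos_of_nonpos h1 h2]

theorem near_cases (q q' : (I × Fin 3) ⊕ B) : S.near q q' = 0 ∨
    (S.near q q' = 1 ∧ ∃ v ℓ v' ℓ', q = .inl (v, ℓ) ∧ q' = .inl (v', ℓ') ∧ S.pos v = S.pos v') := by
  rcases q with ⟨v, ℓ⟩ | r <;> rcases q' with ⟨v', ℓ'⟩ | r' <;> simp [near]
  tauto

/-- A common position lies on the lines of both edges. -/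
theorem side_eq_zero_of_near {e e' : E} {b b' : Bool} (h : S.near (S.fin e b) (S.fin e' b') ≠ 0) :
    S.side (S.type e') (S.hgt e') (S.fin e b) = 0 ∧
      S.side (S.type e) (S.hgt e) (S.fin e' b') = 0 := by
  obtain ⟨-, v, ℓ, v', ℓ', h1, h2, h3⟩ := (S.near_cases _ _).resolve_left h
  rw [h1, h2]
  simp only [side]
  rw [h3, S.pos_eq_hgt h2, ← h3, S.pos_eq_hgt h1]
  simp

-- A common vertex lies on both lines, and by `side_cases` no other end does. So one pair of ends is
-- counted, and both crossing numbers are `±1` instead of the `±2` of a transversal crossing.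
variable {S} in
theorem Directed.inc_cases (hS : S.Directed) {e e' : E} (h : S.type e ≠ S.type e') :
    S.inc e e' = 0 ∨ (S.inc e e' = 1 ∧ S.meet e e' = 1) := by
  obtain ⟨-, p1, p2⟩ := hS.side_cases e _ (S.hgt e') h
  obtain ⟨-, r1, r2⟩ := hS.side_cases e' _ (S.hgt e) h.symm
  obtain ⟨h3, h4⟩ := typeSign_ne h
  have hne : typeSign (S.type e) (S.type e') ≠ 0 := fun h0 => by rw [h0] at h3; norm_num at h3
  have hn1 : ∀ b b', S.side (S.type e') (S.hgt e') (S.fin e b) ≠ 0 →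
      S.near (S.fin e b) (S.fin e' b') = 0 := fun b b' hb => by
    by_contra hc; exact hb (S.side_eq_zero_of_near hc).1
  have hn2 : ∀ b b', S.side (S.type e) (S.hgt e) (S.fin e' b') ≠ 0 →
      S.near (S.fin e b) (S.fin e' b') = 0 := fun b b' hb => by
    by_contra hc; exact hb (S.side_eq_zero_of_near hc).2
  rw [h4] at r1 r2
  have key : ∀ b b', S.near (S.fin e b) (S.fin e' b') ≠ 0 →
      S.inc e e' = 1 ∧ S.meet e e' = 1 := by
    intro b b' hb
    obtain ⟨s1, s2⟩ := S.side_eq_zero_of_near hb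
    have hb1 := ((S.near_cases _ _).resolve_left hb).1
    rw [meet, cross_eq, cross_eq, inc]
    simp only [Fintype.sum_bool]
    cases b <;> cases b'
    · have t1 := p2 s1; have t2 := r2 s2
      have u1 := hn1 true false (by rw [t1]; simpa using hne)
      have u2 := hn1 true true (by rw [t1]; simpa using hne)
      have u3 := hn2 false true (by rw [t2]; simpa using hne)
      rw [t1, t2, s1, s2, u1, u2, u3, hb1]
      exact ⟨by norm_num, by linarith⟩
    · have t1 := p2 s1; have t2 := r1 s2
      have u1 := hn1 true false (by rw [t1]; simpa using hne)
      have u2 := hn1 true true (by rw [t1]; simpa using hne)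
      have u3 := hn2 false false (by rw [t2]; simpa using hne)
      rw [t1, t2, s1, s2, u1, u2, u3, hb1]
      exact ⟨by norm_num, by linarith⟩
    · have t1 := p1 s1; have t2 := r2 s2
      have u1 := hn1 false false (by rw [t1]; simpa using hne)
      have u2 := hn1 false true (by rw [t1]; simpa using hne)
      have u3 := hn2 true true (by rw [t2]; simpa using hne)
      rw [t1, t2, s1, s2, u1, u2, u3, hb1]
      exact ⟨by norm_num, by linarith⟩
    · have t1 := p1 s1; have t2 := r1 s2
      have u1 := hn1 false false (by rw [t1]; simpa using hne)
      have u2 := hn1 false true (by rw [t1]; simpa using hne)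
      have u3 := hn2 true false (by rw [t2]; simpa using hne)
      rw [t1, t2, s1, s2, u1, u2, u3, hb1]
      exact ⟨by norm_num, by linarith⟩
  by_cases hall : ∃ b b', S.near (S.fin e b) (S.fin e' b') ≠ 0
  · obtain ⟨b, b', hb⟩ := hall
    exact Or.inr (key b b' hb)
  · push Not at hall
    left
    simp [inc, hall]

/-- Zero row and column sums make the antisymmetric part of `M` a multiple of `typeSign`, with
factor `(M 0 1 - M 1 0) / 2`. -/
theorem sum_typeSign_mul (M : Fin 3 → Fin 3 → ℝ) 
    (hr : ∀ i, ∑ j, M i j = 0) (hc : ∀ j, ∑ i, M i j = 0) :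
    ∑ i, ∑ j, typeSign i j * M i j = 3 * (M 0 1 - M 1 0) := by
  have h0 := hr 0; have h1 := hr 1; have h2 := hr 2
  have k0 := hc 0; have k1 := hc 1; have k2 := hc 2
  simp only [Fin.sum_univ_three] at *
  simp [typeSign]
  linarith

theorem sum_typeSign_leg (v v' : I) :
    ∑ ℓ, ∑ ℓ', typeSign ℓ ℓ' * S.weight (S.leg v ℓ) (S.leg v' ℓ') = 3 * S.area v v' :=
  sum_typeSign_mul _ (fun _ => S.sum_weight_leg_right _ v') (fun _ => S.sum_weight_leg v _)

variable [Fintype I] [Fintype B] [Fintype E]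

-- Only ends at coinciding vertices contribute, and the legs of two such vertices contribute three
-- times their mutual area.
open Classical in
theorem sum_inc : ∑ e, ∑ e', typeSign (S.type e) (S.type e') * S.weight e e' * S.inc e e' =
    ∑ v, ∑ v', if S.pos v = S.pos v' then 3 * S.area v v' else 0 := by
  set K : E × Bool → E × Bool → ℝ := fun q q' =>
    typeSign (S.type q.1) (S.type q'.1) * S.weight q.1 q'.1 *
      S.near (S.ends.symm q) (S.ends.symm q') with hK
  have h1 : ∑ e, ∑ e', typeSign (S.type e) (S.type e') * S.weight e e' * S.inc e e' =
      ∑ q, ∑ q', K q q' := by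
    rw [Fintype.sum_prod_type]
    refine Finset.sum_congr rfl fun e _ => ?_
    simp only [Fintype.sum_prod_type]
    rw [Finset.sum_comm]
    refine Finset.sum_congr rfl fun e' _ => ?_
    simp only [hK, inc, Finset.mul_sum, fin]
  rw [h1, ← S.ends.sum_comp]
  simp only [← S.ends.sum_comp (fun q' => K _ q'), Fintype.sum_sum_type]
  have h2 : ∀ q r, K (S.ends q) (S.ends (.inr r)) = 0 := by
    intro q r
    rcases q with ⟨v, ℓ⟩ | q <;> simp [hK, near]
  have h3 : ∀ q r, K (S.ends (.inr r)) (S.ends q) = 0 := by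
    intro q r
    rcases q with ⟨v, ℓ⟩ | q <;> simp [hK, near]
  simp only [h2, h3, Finset.sum_const_zero, add_zero]
  rw [Fintype.sum_prod_type]
  refine Finset.sum_congr rfl fun v _ => ?_
  simp only [Fintype.sum_prod_type]
  rw [Finset.sum_comm]
  refine Finset.sum_congr rfl fun v' _ => ?_
  simp only [hK, Equiv.symm_apply_apply, near]
  simp only [ends_inl, type_leg]
  split_ifs with h
  · simp only [mul_one, sum_typeSign_leg]
  · simp

/-- If distinct edges only meet at common vertices, the contribution of the rays is given by the
areas of the vertices. -/
theorem rayConst_eq (hpos : Function.Injective S.pos)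
    (h : ∀ e e', S.type e ≠ S.type e' → S.meet e e' = S.inc e e') :
    rayConst (fun b => S.type (S.ray b)) S.upRay (fun b b' => S.weight (S.ray b) (S.ray b')) =
      2 * ∑ v, S.area v v := by
  classical
  have h1 := S.sum_meet
  have h2 := S.sum_inc
  have h3 : ∑ e, ∑ e', typeSign (S.type e) (S.type e') * S.weight e e' * S.meet e e' =
      ∑ e, ∑ e', typeSign (S.type e) (S.type e') * S.weight e e' * S.inc e e' := by
    refine Finset.sum_congr rfl fun e _ => Finset.sum_congr rfl fun e' _ => ?_
    by_cases he : S.type e = S.type e'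
    · simp [he, typeSign_self]
    · rw [h e e' he]
  -- For injective positions the sum equals `rayConst + ∑ area` by `sum_meet` and `3 * ∑ area` by
  -- `sum_inc`; the difference explains the factor `2`.
  simp only [hpos.eq_iff, Finset.sum_ite_eq, Finset.mem_univ, if_true, endSign_mul_self] at h1 h2
  rw [← Finset.mul_sum] at h2
  simp only [one_mul] at h1
  linarith

variable {S} in
/-- If the weights are nonnegative and the contribution of the rays is given by the areas of the
vertices, then pairs of positive weight only meet at common vertices. -/
theorem Directed.eq_zero (hS : S.Directed)
    (hw : ∀ e e', 0 ≤ typeSign (S.type e) (S.type e') * S.weight e e')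
    (hc : rayConst (fun b => S.type (S.ray b)) S.upRay (fun b b' => S.weight (S.ray b) (S.ray b')) =
      2 * ∑ v, S.area v v) :
    (∀ e e', typeSign (S.type e) (S.type e') * S.weight e e' = 0 ∨ S.meet e e' = S.inc e e') ∧
    ∀ v v', v ≠ v' → S.pos v = S.pos v' → ∀ ℓ ℓ',
      typeSign ℓ ℓ' * S.weight (S.leg v ℓ) (S.leg v' ℓ') = 0 := by
  classical
  have harea : ∀ v v', 0 ≤ S.area v v' := by
    intro v v'
    have h1 := S.sum_typeSign_leg v v'
    have h2 : 0 ≤ ∑ ℓ, ∑ ℓ', typeSign ℓ ℓ' * S.weight (S.leg v ℓ) (S.leg v' ℓ') :=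
      Finset.sum_nonneg fun ℓ _ => Finset.sum_nonneg fun ℓ' _ => by
        have := hw (S.leg v ℓ) (S.leg v' ℓ')
        rwa [S.type_leg, S.type_leg] at this
    linarith
  have h1 := S.sum_meet
  have h2 := S.sum_inc
  rw [hc] at h1
  -- The weighted surplus of crossings over common ends.
  set F : E → E → ℝ := fun e e' => typeSign (S.type e) (S.type e') * S.weight e e' *
    (S.meet e e' - S.inc e e') with hF
  have hF0 : ∀ e e', 0 ≤ F e e' := by
    intro e e'
    by_cases he : S.type e = S.type e'
    · simp [hF, he, typeSign_self]
    · refine mul_nonneg (hw e e') ?_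
      rcases hS.inc_cases he with h | h
      · rw [h, sub_zero]; exact hS.meet_nonneg he
      · rw [h.1, h.2, sub_self]
  -- Distinct vertices at the same place enter `sum_inc` with factor `3` but `sum_meet` only with
  -- the product of their signs. The diagonal terms cancel against `hc`, so `F` and `D` together sum
  -- to zero.
  set D : I → I → ℝ := fun v v' => if S.pos v = S.pos v' ∧ v ≠ v' then
    (3 - endSign (S.up v) * endSign (S.up v')) * S.area v v' else 0 with hD
  have hs : ∀ b b', 0 < 3 - endSign b * endSign b' := by
    intro b b'; cases b <;> cases b' <;> norm_num [endSign]
  have hD0 : ∀ v v', 0 ≤ D v v' := by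
    intro v v'
    simp only [hD]
    split_ifs
    · exact mul_nonneg (hs _ _).le (harea _ _)
    · exact le_rfl
  have hsum : ∑ e, ∑ e', F e e' + ∑ v, ∑ v', D v v' = 0 := by
    have h3 : ∑ e, ∑ e', F e e' = 2 * ∑ v, S.area v v + (∑ v, ∑ v', if S.pos v = S.pos v' then
        endSign (S.up v) * endSign (S.up v') * S.area v v' else 0) -
        ∑ v, ∑ v', if S.pos v = S.pos v' then 3 * S.area v v' else 0 := by
      rw [← h1, ← h2]
      simp only [hF, mul_sub, Finset.sum_sub_distrib]
    have h4 : ∑ v, S.area v v = ∑ v, ∑ v', if v = v' then S.area v v' else 0 := by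
      simp
    rw [h3, h4, Finset.mul_sum]
    simp only [Finset.mul_sum]
    simp only [← Finset.sum_add_distrib, ← Finset.sum_sub_distrib]
    refine Finset.sum_eq_zero fun v _ => Finset.sum_eq_zero fun v' _ => ?_
    by_cases hv : v = v'
    · subst hv
      simp [hD, endSign_mul_self]
      ring
    · by_cases hp : S.pos v = S.pos v' <;> simp [hD, hp, hv]
      ring
  have hFz : ∑ e, ∑ e', F e e' = 0 :=
    le_antisymm (by
      have := Finset.sum_nonneg (s := Finset.univ) fun v _ =>
        Finset.sum_nonneg (s := Finset.univ) fun v' _ => hD0 v v'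
      linarith)
      (Finset.sum_nonneg fun e _ => Finset.sum_nonneg fun e' _ => hF0 e e')
  have hDz : ∑ v, ∑ v', D v v' = 0 := by linarith
  constructor
  · intro e e'
    have h3 := (Finset.sum_eq_zero_iff_of_nonneg fun e _ => Finset.sum_nonneg fun e' _ =>
      hF0 e e').1 hFz e (Finset.mem_univ e)
    have h4 := (Finset.sum_eq_zero_iff_of_nonneg fun e' _ => hF0 e e').1 h3 e' (Finset.mem_univ e')
    rcases mul_eq_zero.1 h4 with h | h
    · exact Or.inl h
    · exact Or.inr (sub_eq_zero.1 h)
  · intro v v' hv hp ℓ ℓ'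
    have h3 := (Finset.sum_eq_zero_iff_of_nonneg fun e _ => Finset.sum_nonneg fun e' _ =>
      hD0 e e').1 hDz v (Finset.mem_univ v)
    have h4 := (Finset.sum_eq_zero_iff_of_nonneg fun e' _ => hD0 v e').1 h3 v' (Finset.mem_univ v')
    simp only [hD, if_pos (And.intro hp hv)] at h4
    have h5 : S.area v v' = 0 := (mul_eq_zero.1 h4).resolve_left (hs _ _).ne'
    have h6 := S.sum_typeSign_leg v v'
    rw [h5, mul_zero] at h6
    have h7 : ∀ ℓ ℓ', 0 ≤ typeSign ℓ ℓ' * S.weight (S.leg v ℓ) (S.leg v' ℓ') := by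
      intro ℓ ℓ'
      have := hw (S.leg v ℓ) (S.leg v' ℓ')
      rwa [S.type_leg, S.type_leg] at this
    have h8 := (Finset.sum_eq_zero_iff_of_nonneg fun e _ => Finset.sum_nonneg fun e' _ =>
      h7 e e').1 h6 ℓ (Finset.mem_univ ℓ)
    exact (Finset.sum_eq_zero_iff_of_nonneg fun e' _ => h7 ℓ e').1 h8 ℓ' (Finset.mem_univ ℓ')

end EdgeSystem

/-! ## The edges and faces of the hexagon -/

theorem three_add_one_one (ℓ : Fin 3) : ℓ + 1 + 1 = ℓ + 2 := by fin_cases ℓ <;> rfl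
theorem three_add_one_two (ℓ : Fin 3) : ℓ + 1 + 2 = ℓ := by fin_cases ℓ <;> rfl
theorem three_add_two_one (ℓ : Fin 3) : ℓ + 2 + 1 = ℓ := by fin_cases ℓ <;> rfl
theorem three_add_two_two (ℓ : Fin 3) : ℓ + 2 + 2 = ℓ + 1 := by fin_cases ℓ <;> rfl
theorem three_one_ne (ℓ : Fin 3) : ℓ + 1 ≠ ℓ := by fin_cases ℓ <;> decide
theorem three_two_ne (ℓ : Fin 3) : ℓ + 2 ≠ ℓ := by fin_cases ℓ <;> decide

theorem three_cases (ℓ k : Fin 3) : k = ℓ ∨ k = ℓ + 1 ∨ k = ℓ + 2 := by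
  fin_cases ℓ <;> fin_cases k <;> decide

theorem three_forall (ℓ : Fin 3) {P : Fin 3 → Prop} :
    (∀ k, P k) ↔ P ℓ ∧ P (ℓ + 1) ∧ P (ℓ + 2) :=
  ⟨fun h => ⟨h _, h _, h _⟩, fun h k => by
    rcases three_cases ℓ k with rfl | rfl | rfl
    exacts [h.1, h.2.1, h.2.2]⟩

theorem three_ext (ℓ : Fin 3) {α : Type*} {p q : Fin 3 → α} (h0 : p ℓ = q ℓ)
    (h1 : p (ℓ + 1) = q (ℓ + 1)) (h2 : p (ℓ + 2) = q (ℓ + 2)) : p = q :=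
  funext ((three_forall ℓ).2 ⟨h0, h1, h2⟩)

theorem three_sum (ℓ : Fin 3) {α : Type*} [AddCommMonoid α] (p : Fin 3 → α) :
    ∑ k, p k = p ℓ + p (ℓ + 1) + p (ℓ + 2) := by
  rw [Fin.sum_univ_three]
  fin_cases ℓ
  · rfl
  · simp; abel
  · simp; abel

/-- The function with given values at `ℓ`, `ℓ + 1` and `ℓ + 2`. -/
def tri {α : Type*} (ℓ : Fin 3) (a b c : α) : Fin 3 → α :=
  fun k => if k = ℓ then a else if k = ℓ + 1 then b else c

theorem tri_zero {α : Type*} (ℓ : Fin 3) (a b c : α) : tri ℓ a b c ℓ = a := by simp [tri]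
theorem tri_one {α : Type*} (ℓ : Fin 3) (a b c : α) : tri ℓ a b c (ℓ + 1) = b := by
  simp [tri]
theorem tri_two {α : Type*} (ℓ : Fin 3) (a b c : α) : tri ℓ a b c (ℓ + 2) = c := by
  simp [tri]

theorem isHexPoint_iff {n d : ℕ} (ℓ : Fin 3) (p : Fin 3 → ℤ) : IsHexPoint n d p ↔
    p ℓ + p (ℓ + 1) + p (ℓ + 2) = n + d ∧ (0 ≤ p ℓ ∧ p ℓ ≤ n) ∧
      (0 ≤ p (ℓ + 1) ∧ p (ℓ + 1) ≤ n) ∧ (0 ≤ p (ℓ + 2) ∧ p (ℓ + 2) ≤ n) := by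
  rw [IsHexPoint, three_forall ℓ, ← Fin.sum_univ_three, three_sum ℓ]

theorem single_three (ℓ : Fin 3) : (Pi.single ℓ 1 : Fin 3 → ℤ) = tri ℓ 1 0 0 :=
  three_ext ℓ (by simp [tri]) (by simp [tri]) (by simp [tri])

theorem tri_succ {α : Type*} (ℓ : Fin 3) (a b c : α) : tri (ℓ + 1) a b c = tri ℓ c a b := by
  refine three_ext ℓ ?_ (by rw [tri_zero, tri_one]) ?_
  · rw [tri_zero]
    simp only [tri, three_add_one_one, (three_two_ne ℓ).symm, (three_one_ne ℓ).symm, if_false]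
  · rw [tri_two, ← three_add_one_one, tri_one]

theorem tri_succ_succ {α : Type*} (ℓ : Fin 3) (a b c : α) :
    tri (ℓ + 2) a b c = tri ℓ b c a := by
  rw [← three_add_one_one, tri_succ, tri_succ]

theorem isHexPoint_tgt {n d : ℕ} (ℓ : Fin 3) {p : Fin 3 → ℤ} (hp : IsHexPoint n d p) :
    IsHexPoint n d (p + Pi.single ℓ 1 - Pi.single (ℓ + 1) 1) ↔ p ℓ < n ∧ 0 < p (ℓ + 1) := by
  rw [isHexPoint_iff ℓ] at hp ⊢
  simp only [single_three, tri_succ, Pi.add_apply, Pi.sub_apply, tri_zero, tri_one, tri_two]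
  omega

namespace HexEdge

variable {n d : ℕ} (e : HexEdge n d)

theorem src_bounds : e.src e.type + e.src (e.type + 1) + e.src (e.type + 2) = n + d ∧
    (0 ≤ e.src e.type ∧ e.src e.type < n) ∧
    (0 < e.src (e.type + 1) ∧ e.src (e.type + 1) ≤ n) ∧
    (0 ≤ e.src (e.type + 2) ∧ e.src (e.type + 2) ≤ n) := by
  have h1 := (isHexPoint_iff e.type _).1 e.src_mem
  have h2 := (isHexPoint_tgt e.type e.src_mem).1 e.tgt_mem
  omega

theorem tgt_apply_two : e.tgt (e.type + 2) = e.src (e.type + 2) := by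
  simp only [tgt, single_three, tri_succ, Pi.add_apply, Pi.sub_apply, tri_two]
  omega

variable {e} in
theorem ext_src {e' : HexEdge n d} (ht : e.type = e'.type)
    (h0 : e.src e.type = e'.src e'.type)
    (h2 : e.src (e.type + 2) = e'.src (e'.type + 2)) : e = e' := by
  have h3 := e.src_bounds
  have h4 := e'.src_bounds
  refine HexEdge.ext ht (three_ext e.type ?_ ?_ ?_) <;> rw [← ht] at * <;> omega

/-- The edge of type `ℓ` with given coordinates of the source. -/
def mk' (ℓ : Fin 3) (a b c : ℤ) (h : a + b + c = n + d ∧ (0 ≤ a ∧ a < n) ∧ (0 < b ∧ b ≤ n) ∧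
    (0 ≤ c ∧ c ≤ n)) : HexEdge n d where
  type := ℓ
  src := tri ℓ a b c
  src_mem := by
    rw [isHexPoint_iff ℓ, tri_zero, tri_one, tri_two]
    omega
  tgt_mem := by
    rw [isHexPoint_tgt, tri_zero, tri_one]
    · omega
    · rw [isHexPoint_iff ℓ, tri_zero, tri_one, tri_two]
      omega

end HexEdge

/-- `0` for `true` and `1` for `false`. -/
def lowerOne (b : Bool) : ℤ := if b then 0 else 1

theorem lowerOne_true : lowerOne true = 0 := rfl
theorem lowerOne_false : lowerOne false = 1 := rfl

theorem forall_isHexPoint_corner {n d : ℕ} (ℓ : Fin 3) (up : Bool) (x : Fin 3 → ℤ) :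
    (∀ i, IsHexPoint n d (faceCorner up x i)) ↔
      x ℓ + x (ℓ + 1) + x (ℓ + 2) = n + d - 1 - lowerOne up ∧ (0 ≤ x ℓ ∧ x ℓ < n) ∧
      (0 ≤ x (ℓ + 1) ∧ x (ℓ + 1) < n) ∧ (0 ≤ x (ℓ + 2) ∧ x (ℓ + 2) < n) := by
  rw [three_forall ℓ]
  simp only [isHexPoint_iff ℓ]
  cases up
  · simp only [faceCorner, single_three, tri_succ, tri_succ_succ, Pi.add_apply, Pi.sub_apply,
      tri_zero, tri_one, tri_two, Bool.false_eq_true, if_false, lowerOne, Pi.one_apply]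
    omega
  · simp only [faceCorner, single_three, tri_succ, tri_succ_succ, Pi.add_apply,
      tri_zero, tri_one, tri_two, if_true, lowerOne]
    omega

namespace HexFace

variable {n d : ℕ} (f : HexFace n d)

theorem coord_bounds (ℓ : Fin 3) :
    f.coord ℓ + f.coord (ℓ + 1) + f.coord (ℓ + 2) = n + d - 1 - lowerOne f.up ∧
      (0 ≤ f.coord ℓ ∧ f.coord ℓ < n) ∧ (0 ≤ f.coord (ℓ + 1) ∧ f.coord (ℓ + 1) < n) ∧
      (0 ≤ f.coord (ℓ + 2) ∧ f.coord (ℓ + 2) < n) :=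
  (forall_isHexPoint_corner ℓ f.up f.coord).1 f.corner_mem

theorem edge_src (ℓ : Fin 3) : (f.edge ℓ).src ℓ = f.coord ℓ ∧
    (f.edge ℓ).src (ℓ + 1) = f.coord (ℓ + 1) + 1 ∧
    (f.edge ℓ).src (ℓ + 2) = f.coord (ℓ + 2) + lowerOne f.up := by
  rcases f with ⟨_ | _, x, h⟩
  · simp only [edge, faceCorner, single_three, tri_succ, Pi.add_apply, Pi.sub_apply,
      tri_zero, tri_one, tri_two, Bool.false_eq_true, if_false, lowerOne, Pi.one_apply]
    simp
  · simp only [edge, faceCorner, single_three, tri_succ, Pi.add_apply,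
      tri_zero, tri_one, tri_two, if_true, lowerOne]
    simp

theorem edge_type (ℓ : Fin 3) : (f.edge ℓ).type = ℓ := rfl

variable {f} in
theorem edge_inj {g : HexFace n d} {ℓ k : Fin 3} (h : f.edge ℓ = g.edge k) (hu : f.up = g.up) :
    f = g ∧ ℓ = k := by
  have hk : ℓ = k := congrArg HexEdge.type h
  subst hk
  obtain ⟨h0, h1, h2⟩ := f.edge_src ℓ
  obtain ⟨k0, k1, k2⟩ := g.edge_src ℓ
  rw [h] at h0 h1 h2
  refine ⟨HexFace.ext hu (three_ext ℓ ?_ ?_ ?_), rfl⟩ <;> rw [hu] at * <;> omega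

end HexFace

/-- The boundary edge of index `(i, j)`. -/
def outerEdge {n d : ℕ} (hd : d ≤ n) (i : Fin 3) (j : Fin n) : HexEdge n d :=
  if h : (j : ℕ) < d then HexEdge.mk' (i + 2) (j : ℕ) (d - (j : ℕ)) n (by have := j.2; omega)
  else HexEdge.mk' (i + 1) (n + d - 1 - (j : ℕ)) ((j : ℕ) + 1) 0 (by have := j.2; omega)

theorem isOuterEdge_iff {n d : ℕ} (hd : d ≤ n) (i : Fin 3) (j : Fin n) (e : HexEdge n d) :
    IsOuterEdge i j e ↔ outerEdge hd i j = e := by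
  constructor
  · have hb := e.src_bounds
    have hj := j.2
    rintro (⟨ht, h1, h2⟩ | ⟨ht, h1, h2⟩)
    · rw [HexEdge.height] at h2
      have h3 : e.src (e.type + 2) = n := by rw [ht, three_add_two_two, h1]
      -- The coordinate of index `type + 1` is positive and the three sum to `n + d`. In the other
      -- case `d ≤ j` comes from `src type < n`.
      have : (j : ℕ) < d := by omega
      rw [outerEdge, dif_pos this]
      refine HexEdge.ext_src ht.symm ?_ ?_
      · simp only [HexEdge.mk', tri_zero]; omega
      · simp only [HexEdge.mk', tri_two]; omega
    · rw [HexEdge.height] at h2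
      have h3 : e.src (e.type + 2) = 0 := by rw [ht, three_add_one_two, h1]
      have : ¬ (j : ℕ) < d := by omega
      rw [outerEdge, dif_neg this]
      refine HexEdge.ext_src ht.symm ?_ ?_
      · simp only [HexEdge.mk', tri_zero]; omega
      · simp only [HexEdge.mk', tri_two]; omega
  · rintro rfl
    rw [outerEdge]
    split_ifs with h
    · left
      refine ⟨rfl, ?_, ?_⟩
      · rw [← three_add_two_two]; simp only [HexEdge.mk', tri_two]
      · simp only [HexEdge.height, HexEdge.mk', tri_zero]
    · right
      refine ⟨rfl, ?_, ?_⟩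
      · conv_lhs => rw [← three_add_one_two i]
        simp only [HexEdge.mk', tri_succ, three_add_one_two, tri_zero]
      · simp only [HexEdge.height, HexEdge.mk', tri_zero]

/-- The ends of the edges of the dual graph. -/
abbrev HexEnd (n d : ℕ) : Type := (HexFace n d × Fin 3) ⊕ (Fin 3 × Fin n)

/-- The edge and its end corresponding to a face and a type, or to a boundary edge. -/
def hexEnd {n d : ℕ} (hd : d ≤ n) : HexEnd n d → HexEdge n d × Bool
  | .inl (f, ℓ) => (f.edge ℓ, f.up)
  | .inr (i, j) => (outerEdge hd i j, decide ((j : ℕ) < d))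

theorem outerEdge_src {n d : ℕ} (hd : d ≤ n) (i : Fin 3) (j : Fin n) :
    ((j : ℕ) < d ∧ (outerEdge hd i j).type = i + 2 ∧
      (outerEdge hd i j).src ((outerEdge hd i j).type) = (j : ℕ) ∧
      (outerEdge hd i j).src ((outerEdge hd i j).type + 1) = d - (j : ℕ) ∧
      (outerEdge hd i j).src ((outerEdge hd i j).type + 2) = n) ∨
    (d ≤ (j : ℕ) ∧ (outerEdge hd i j).type = i + 1 ∧
      (outerEdge hd i j).src ((outerEdge hd i j).type) = n + d - 1 - (j : ℕ) ∧
      (outerEdge hd i j).src ((outerEdge hd i j).type + 1) = (j : ℕ) + 1 ∧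
      (outerEdge hd i j).src ((outerEdge hd i j).type + 2) = 0) := by
  by_cases h : (j : ℕ) < d
  · left
    simp only [outerEdge, h, dif_pos, HexEdge.mk', tri_zero, tri_one, tri_two, and_self]
  · right
    simp only [outerEdge, h, dif_neg, not_false_eq_true, HexEdge.mk', tri_zero, tri_one, tri_two,
      and_self, and_true]
    omega

/-- An edge has an upper face unless `src (type + 2) = n`, and a lower face unless `src (type + 2) =
0`; in these two cases a boundary vertex takes the place of the missing face. -/
theorem hexEnd_bijective {n d : ℕ} (hd : d ≤ n) : Function.Bijective (hexEnd (n := n) hd) := by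
  constructor
  · rintro (⟨f, ℓ⟩ | ⟨i, j⟩) (⟨g, k⟩ | ⟨i', j'⟩) h
    · obtain ⟨h1, h2⟩ := Prod.mk.inj h
      obtain ⟨rfl, rfl⟩ := HexFace.edge_inj h1 h2
      rfl
    · exfalso
      obtain ⟨h1, h2⟩ := Prod.mk.inj h
      have h3 := outerEdge_src hd i' j'
      rw [← h1, f.edge_type] at h3
      have h4 := f.edge_src ℓ
      have h5 := f.coord_bounds ℓ
      rcases h3 with h3 | h3
      · rw [decide_eq_true h3.1] at h2
        rw [h2, lowerOne_true] at h4
        omega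
      · rw [decide_eq_false (by omega)] at h2
        rw [h2, lowerOne_false] at h4
        omega
    · exfalso
      obtain ⟨h1, h2⟩ := Prod.mk.inj h.symm
      have h3 := outerEdge_src hd i j
      rw [← h1, g.edge_type] at h3
      have h4 := g.edge_src k
      have h5 := g.coord_bounds k
      rcases h3 with h3 | h3
      · rw [decide_eq_true h3.1] at h2
        rw [h2, lowerOne_true] at h4
        omega
      · rw [decide_eq_false (by omega)] at h2
        rw [h2, lowerOne_false] at h4
        omega
    · obtain ⟨h1, h2⟩ := Prod.mk.inj h
      have h3 := outerEdge_src hd i j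
      have h4 := outerEdge_src hd i' j'
      rw [h1] at h3
      rw [decide_eq_decide] at h2
      rcases h3 with h3 | h3 <;> rcases h4 with h4 | h4 <;> try omega
      · have : i = i' := add_right_cancel (h3.2.1.symm.trans h4.2.1)
        have : j = j' := Fin.ext (by omega)
        simp [*]
      · have : i = i' := add_right_cancel (h3.2.1.symm.trans h4.2.1)
        have : j = j' := Fin.ext (by omega)
        simp [*]
  · rintro ⟨e, b⟩
    have hb := e.src_bounds
    by_cases hin : (0 < e.src (e.type + 2) ∨ b = true) ∧ (e.src (e.type + 2) < n ∨ b = false)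
    · have hc : ∀ i, IsHexPoint n d (faceCorner b (tri e.type (e.src e.type)
          (e.src (e.type + 1) - 1) (e.src (e.type + 2) - lowerOne b)) i) := by
        rw [forall_isHexPoint_corner e.type, tri_zero, tri_one, tri_two]
        cases b
        · simp [lowerOne_false] at hin ⊢; omega
        · simp [lowerOne_true] at hin ⊢; omega
      refine ⟨.inl (⟨b, _, hc⟩, e.type), Prod.ext (HexEdge.ext_src rfl ?_ ?_) rfl⟩
      · have h := (HexFace.edge_src ⟨b, _, hc⟩ e.type).1
        simp only [tri_zero] at h
        exact h
      · have h := (HexFace.edge_src ⟨b, _, hc⟩ e.type).2.2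
        simp only [tri_two, sub_add_cancel] at h
        exact h
    · cases b
      · have h0 : e.src (e.type + 2) = 0 := by
          simp at hin; omega
        refine ⟨.inr (e.type + 2, ⟨(n + d - 1 - e.src e.type).toNat, by omega⟩), Prod.ext ?_ ?_⟩
        · refine (isOuterEdge_iff hd _ _ _).1 (Or.inr ⟨?_, h0, ?_⟩)
          · rw [three_add_two_one]
          · simp only [HexEdge.height]; omega
        · simp only [hexEnd, decide_eq_false_iff_not]; omega
      · have h0 : e.src (e.type + 2) = n := by
          simp at hin; omega
        refine ⟨.inr (e.type + 1, ⟨(e.src e.type).toNat, by omega⟩), Prod.ext ?_ ?_⟩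
        · refine (isOuterEdge_iff hd _ _ _).1 (Or.inl ⟨?_, ?_, ?_⟩)
          · rw [three_add_one_two]
          · rw [three_add_one_one, h0]
          · simp only [HexEdge.height]; omega
        · simp only [hexEnd, decide_eq_true_eq]; omega

/-- The ends of the edges of the dual graph, as pairs of an edge and a direction. -/
noncomputable def hexEnds {n d : ℕ} (hd : d ≤ n) : HexEnd n d ≃ HexEdge n d × Bool :=
  Equiv.ofBijective _ (hexEnd_bijective hd)

/-- The vertex at which an end of an edge lies. -/
def HexEnd.vertex {n d : ℕ} : HexEnd n d → DualVertex n d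
  | .inl (f, _) => .inl f
  | .inr b => .inr b

/-- The vertex at the upper (`true`) or the lower (`false`) end of the edge dual to `e`. -/
noncomputable def endv {n d : ℕ} (hd : d ≤ n) (e : HexEdge n d) (b : Bool) : DualVertex n d :=
  HexEnd.vertex ((hexEnds hd).symm (e, b))

/-- Upper faces, and boundary vertices whose edge has color `1`. -/
def DualVertex.isUp {n d : ℕ} : DualVertex n d → Bool
  | .inl f => f.up
  | .inr (_, j) => decide ((j : ℕ) < d)

section

variable {n d : ℕ} (hd : d ≤ n)

theorem endv_eq_inl {e : HexEdge n d} {b : Bool} {f : HexFace n d} :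
    endv hd e b = .inl f ↔ f.edge e.type = e ∧ f.up = b := by
  constructor
  · intro h
    rcases hq : (hexEnds hd).symm (e, b) with ⟨g, ℓ⟩ | r
    · have hg : g = f := by
        rw [endv, hq] at h; exact Sum.inl.inj h
      subst hg
      have h2 := (hexEnds hd).apply_symm_apply (e, b)
      rw [hq] at h2
      obtain ⟨h3, h4⟩ := Prod.mk.inj h2
      refine ⟨?_, h4⟩
      rw [← h3, HexFace.edge_type]
    · rw [endv, hq] at h; cases h
  · rintro ⟨h1, h2⟩
    have : hexEnds hd (.inl (f, e.type)) = (e, b) := Prod.ext h1 h2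
    rw [endv, ← this, Equiv.symm_apply_apply]
    rfl

theorem endv_eq_inr {e : HexEdge n d} {b : Bool} {i : Fin 3} {j : Fin n} :
    endv hd e b = .inr (i, j) ↔ outerEdge hd i j = e ∧ decide ((j : ℕ) < d) = b := by
  constructor
  · intro h
    rcases hq : (hexEnds hd).symm (e, b) with ⟨g, ℓ⟩ | r
    · rw [endv, hq] at h; cases h
    · have hg : r = (i, j) := by
        rw [endv, hq] at h; exact Sum.inr.inj h
      subst hg
      have h2 := (hexEnds hd).apply_symm_apply (e, b)
      rw [hq] at h2
      exact Prod.mk.inj h2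
  · rintro ⟨h1, h2⟩
    have : hexEnds hd (.inr (i, j)) = (e, b) := Prod.ext h1 h2
    rw [endv, ← this, Equiv.symm_apply_apply]
    rfl

theorem isUp_endv (e : HexEdge n d) (b : Bool) : (endv hd e b).isUp = b := by
  rcases h : endv hd e b with f | ⟨i, j⟩
  · exact ((endv_eq_inl hd).1 h).2
  · exact ((endv_eq_inr hd).1 h).2

theorem isIncident_iff (e : HexEdge n d) (x : DualVertex n d) :
    IsIncident e x ↔ endv hd e x.isUp = x := by
  rcases x with f | ⟨i, j⟩
  · rw [endv_eq_inl]
    constructor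
    · rintro ⟨ℓ, rfl⟩
      exact ⟨rfl, rfl⟩
    · exact fun h => ⟨_, h.1⟩
  · rw [endv_eq_inr, and_iff_left (by rfl), ← isOuterEdge_iff]
    rfl

theorem isIncident_endv (e : HexEdge n d) (b : Bool) : IsIncident e (endv hd e b) := by
  rw [isIncident_iff hd, isUp_endv]

theorem eq_of_endv_eq {e e' : HexEdge n d} {b b' : Bool} (h : endv hd e b = endv hd e' b')
    (ht : e.type = e'.type) : e = e' := by
  rcases hx : endv hd e b with f | ⟨i, j⟩
  · rw [hx] at h
    have h1 := (endv_eq_inl hd).1 hx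
    have h2 := (endv_eq_inl hd).1 h.symm
    rw [← h1.1, ← h2.1, ht]
  · rw [hx] at h
    rw [← ((endv_eq_inr hd).1 hx).1, ← ((endv_eq_inr hd).1 h.symm).1]

/-- Whether a vertex is the upper or the lower end of an edge depends on the vertex alone, through
`isUp`; distinct vertices on one edge are therefore its opposite ends. -/
theorem joins_iff (e : HexEdge n d) (x y : DualVertex n d) :
    Joins e x y ↔ ∃ b, endv hd e b = x ∧ endv hd e (!b) = y := by
  constructor
  · rintro ⟨hxy, hx, hy⟩
    rw [isIncident_iff hd] at hx hy
    refine ⟨x.isUp, hx, ?_⟩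
    rcases Bool.eq_or_eq_not y.isUp x.isUp with h | h
    · exact absurd (by rw [← hx, ← hy, h]) hxy
    · rw [← h, hy]
  · rintro ⟨b, rfl, rfl⟩
    refine ⟨fun h => ?_, isIncident_endv hd e b, isIncident_endv hd e _⟩
    have := congrArg DualVertex.isUp h
    rw [isUp_endv, isUp_endv] at this
    cases b <;> cases this

/-- Coordinates of the face at an end of an edge. -/
theorem coord_of_endv {e : HexEdge n d} {b : Bool} {f : HexFace n d} (h : endv hd e b = .inl f) :
    f.coord e.type = e.src e.type ∧ f.coord (e.type + 1) = e.src (e.type + 1) - 1 ∧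
      f.coord (e.type + 2) = e.src (e.type + 2) - lowerOne b := by
  obtain ⟨h1, h2⟩ := (endv_eq_inl hd).1 h
  have h3 := f.edge_src e.type
  rw [h1, h2] at h3
  omega

end

/-! ## Chains -/

instance {n d : ℕ} : Finite (HexEdge n d) :=
  Finite.of_injective
    (fun e : HexEdge n d => (e.type, fun ℓ => (⟨e.src ℓ, e.src_mem.2 ℓ⟩ : Set.Icc (0 : ℤ) n)))
    (by
      intro e e' h
      simp only [Prod.mk.injEq, funext_iff] at h
      exact HexEdge.ext h.1 (funext fun ℓ => congrArg Subtype.val (h.2 ℓ)))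

namespace IsColorMap

variable {n d : ℕ} {C : HexEdge n d → HiveColor}

/-- Among the allowed patterns only `(0,1,m)` contains `m`, and it may be rotated but not reflected.
-/
theorem of_m (hC : IsColorMap C) {f : HexFace n d} {ℓ : Fin 3} (h : C (f.edge ℓ) = .m) :
    C (f.edge (ℓ + 1)) = .col .one ∧ C (f.edge (ℓ + 2)) = .col .zero := by
  obtain ⟨k, hk⟩ := hC.face f
  simp only [Set.mem_insert_iff, Set.mem_singleton_iff, Prod.mk.injEq] at hk
  rcases three_cases k ℓ with rfl | rfl | rfl <;>
    (try simp only [three_add_one_one, three_add_one_two, three_add_two_one, three_add_two_two]) <;>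
    rcases hk with ⟨h0, h1, h2⟩ | ⟨h0, h1, h2⟩ | ⟨h0, h1, h2⟩ | ⟨h0, h1, h2⟩ <;>
    simp_all

theorem color_outerEdge (hC : IsColorMap C) (hd : d ≤ n) (i : Fin 3) (j : Fin n) :
    C (outerEdge hd i j) = if (j : ℕ) < d then .col .one else .col .zero := by
  rcases outerEdge_src hd i j with ⟨h, ht, -, -, h2⟩ | ⟨h, ht, -, -, h2⟩
  · rw [if_pos h]
    exact hC.boundary_one _ _ h2 (by rw [HexEdge.tgt_apply_two, h2])
  · rw [if_neg (by omega)]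
    exact hC.boundary_zero _ _ h2 (by rw [HexEdge.tgt_apply_two, h2])

/-- Boundary edges have color `0` or `1`. -/
theorem endv_of_m (hC : IsColorMap C) (hd : d ≤ n) {e : HexEdge n d} (he : C e = .m) (b : Bool) :
    ∃ f : HexFace n d, endv hd e b = .inl f := by
  rcases h : endv hd e b with f | ⟨i, j⟩
  · exact ⟨f, rfl⟩
  · have h1 := ((endv_eq_inr hd).1 h).1
    have h2 := hC.color_outerEdge hd i j
    rw [h1, he] at h2
    split_ifs at h2

end IsColorMap

section

variable {n d : ℕ} (hd : d ≤ n) (C : HexEdge n d → HiveColor)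

/-- Consecutive edges of color `≠ m` of a chain, the lower end of the first edge and the upper end
of the second edge being joined by an edge of color `m`. -/
def Link (e e' : HexEdge n d) : Prop :=
  e.type = e'.type ∧ C e = C e' ∧ C e ≠ .m ∧ ∃ (g g' : HexFace n d) (k : Fin 3),
    C (g.edge k) = .m ∧ g.edge k = g'.edge k ∧ endv hd e false = .inl g ∧ endv hd e' true = .inl g'

variable {hd C}

/-- The strict decrease of `src (type + 2)` is what makes chains finite and free of repetitions.
Which of the other coordinates grows depends on whether the edge is the one of color `1` or of color
`0` next to the edge of color `m`. -/
theorem Link.src (hC : IsColorMap C) {e e' : HexEdge n d} (h : Link hd C e e') :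
    e'.src (e'.type + 2) = e.src (e.type + 2) - 1 ∧
    ((C e = .col .zero ∧ e'.src e'.type = e.src e.type + 1 ∧
        e'.src (e'.type + 1) = e.src (e.type + 1)) ∨
      (C e = .col .one ∧ e'.src e'.type = e.src e.type ∧
        e'.src (e'.type + 1) = e.src (e.type + 1) + 1)) := by
  obtain ⟨ht, -, hm, g, g', k, hk, hkk, h1, h2⟩ := h
  have h3 := coord_of_endv hd h1
  have h4 := coord_of_endv hd h2
  have h5 := ((endv_eq_inl hd).1 h1)
  have h6 := ((endv_eq_inl hd).1 h2)
  have h7 := g.edge_src k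
  have h8 := g'.edge_src k
  have h9 := hC.of_m hk
  rw [lowerOne_false] at h3
  rw [lowerOne_true] at h4
  rw [h5.2, lowerOne_false, hkk] at h7
  rw [h6.2, lowerOne_true] at h8
  rw [← ht] at h4 ⊢
  have hc : C (g.edge e.type) = C e := by rw [h5.1]
  generalize C e = c at *
  generalize e.type = ℓ at *
  rcases three_cases k ℓ with rfl | rfl | rfl
  · exact absurd (hc.symm.trans hk) hm
  · simp only [three_add_one_one, three_add_one_two] at *
    exact ⟨by omega, Or.inr ⟨hc.symm.trans h9.1, by omega, by omega⟩⟩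
  · simp only [three_add_two_one, three_add_two_two] at *
    exact ⟨by omega, Or.inl ⟨hc.symm.trans h9.2, by omega, by omega⟩⟩

theorem m_unique (hC : IsColorMap C) {g : HexFace n d} {k k' : Fin 3} (h : C (g.edge k) = .m)
    (h' : C (g.edge k') = .m) : k = k' := by
  have h1 := hC.of_m h
  rcases three_cases k k' with rfl | rfl | rfl
  · rfl
  · rw [h1.1] at h'; cases h'
  · rw [h1.2] at h'; cases h'

/-- Every step is forced: the lower face of `e` has a single edge of color `m`, which has a single
upper face, which has a single edge of each type. -/
theorem Link.right_unique (hC : IsColorMap C) {e e₁ e₂ : HexEdge n d} (h₁ : Link hd C e e₁)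
    (h₂ : Link hd C e e₂) : e₁ = e₂ := by
  obtain ⟨ht, -, -, g, g', k, hk, hkk, a1, a2⟩ := h₁
  obtain ⟨ht', -, -, p, p', l, hl, hll, b1, b2⟩ := h₂
  obtain rfl : g = p := Sum.inl.inj (a1.symm.trans b1)
  obtain rfl := m_unique hC hk hl
  have u1 := ((endv_eq_inl hd).1 a2).2
  have u2 := ((endv_eq_inl hd).1 b2).2
  obtain ⟨rfl, -⟩ := HexFace.edge_inj (hkk.symm.trans hll) (u1.trans u2.symm)
  exact eq_of_endv_eq hd (a2.trans b2.symm) (ht.symm.trans ht')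

theorem Link.left_unique (hC : IsColorMap C) {e e₁ e₂ : HexEdge n d} (h₁ : Link hd C e₁ e)
    (h₂ : Link hd C e₂ e) : e₁ = e₂ := by
  obtain ⟨ht, -, -, g, g', k, hk, hkk, a1, a2⟩ := h₁
  obtain ⟨ht', -, -, p, p', l, hl, hll, b1, b2⟩ := h₂
  obtain rfl : g' = p' := Sum.inl.inj (a2.symm.trans b2)
  rw [hkk] at hk
  rw [hll] at hl
  obtain rfl := m_unique hC hk hl
  have u1 := ((endv_eq_inl hd).1 a1).2
  have u2 := ((endv_eq_inl hd).1 b1).2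
  obtain ⟨rfl, -⟩ := HexFace.edge_inj (hkk.trans hll.symm) (u1.trans u2.symm)
  exact eq_of_endv_eq hd (a1.trans b1.symm) (ht.trans ht'.symm)

theorem not_reduced_iff {x : DualVertex n d} : ¬ IsReducedVertex C x ↔
    ∃ g k, x = .inl g ∧ C (g.edge k) = .m := by
  rcases x with f | r
  · simp [IsReducedVertex]
  · simp [IsReducedVertex]

theorem Link.not_reduced {e e' : HexEdge n d} (h : Link hd C e e') :
    ¬ IsReducedVertex C (endv hd e false) ∧ ¬ IsReducedVertex C (endv hd e' true) := by
  obtain ⟨-, -, -, g, g', k, hk, hkk, h1, h2⟩ := h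
  exact ⟨not_reduced_iff.2 ⟨g, k, h1, hk⟩, not_reduced_iff.2 ⟨g', k, h2, hkk ▸ hk⟩⟩

theorem color_eq_of_m (hC : IsColorMap C) {g g' : HexFace n d} {k ℓ : Fin 3}
    (hk : C (g.edge k) = .m) (h : C (g.edge ℓ) ≠ .m) (hk' : C (g'.edge k) = .m) :
    C (g.edge ℓ) = C (g'.edge ℓ) := by
  have h1 := hC.of_m hk
  have h2 := hC.of_m hk'
  rcases three_cases k ℓ with rfl | rfl | rfl
  · exact absurd hk h
  · rw [h1.1, h2.1]
  · rw [h1.2, h2.2]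

/-- Cross the edge of color `m` of the lower face: since the pattern around `m` is rigid, the edge
of the same type on the other side has the same color. -/
theorem exists_link_of_lower (hC : IsColorMap C) {e : HexEdge n d} (he : C e ≠ .m)
    (h : ¬ IsReducedVertex C (endv hd e false)) : ∃ e', Link hd C e e' := by
  obtain ⟨g, k, h1, hk⟩ := not_reduced_iff.1 h
  have hg := (endv_eq_inl hd).1 h1
  obtain ⟨g', hg'⟩ := hC.endv_of_m hd hk true
  have h2 := (endv_eq_inl hd).1 hg'
  rw [HexFace.edge_type] at h2
  refine ⟨g'.edge e.type, rfl, ?_, he, g, g', k, hk, h2.1.symm, h1, ?_⟩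
  · rw [← hg.1] at he
    have := color_eq_of_m hC hk he (h2.1 ▸ hk)
    rw [hg.1] at this
    exact this
  · exact (endv_eq_inl hd).2 ⟨rfl, h2.2⟩

theorem exists_link_of_upper (hC : IsColorMap C) {e : HexEdge n d} (he : C e ≠ .m)
    (h : ¬ IsReducedVertex C (endv hd e true)) : ∃ e', Link hd C e' e := by
  obtain ⟨g, k, h1, hk⟩ := not_reduced_iff.1 h
  have hg := (endv_eq_inl hd).1 h1
  obtain ⟨g', hg'⟩ := hC.endv_of_m hd hk false
  have h2 := (endv_eq_inl hd).1 hg'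
  rw [HexFace.edge_type] at h2
  have hc : C e = C (g'.edge e.type) := by
    have he' := he
    rw [← hg.1] at he'
    have := color_eq_of_m hC hk he' (h2.1 ▸ hk)
    rwa [hg.1] at this
  refine ⟨g'.edge e.type, rfl, hc.symm, hc ▸ he, g', g, k, h2.1 ▸ hk, h2.1, ?_, h1⟩
  exact (endv_eq_inl hd).2 ⟨rfl, h2.2⟩

variable (hd C) in
/-- Runs of linked edges. -/
abbrev Run : HexEdge n d → HexEdge n d → Prop := Relation.ReflTransGen (Link hd C)

theorem Run.spec (hC : IsColorMap C) {e e' : HexEdge n d} (h : Run hd C e e') :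
    e.type = e'.type ∧ C e = C e' ∧ e.src e.type ≤ e'.src e'.type ∧
      e.src (e.type + 1) ≤ e'.src (e'.type + 1) ∧ e'.src (e'.type + 2) ≤ e.src (e.type + 2) := by
  induction h with
  | refl => simp
  | tail _ h ih =>
    have h1 := h.src hC
    exact ⟨ih.1.trans h.1, ih.2.1.trans h.2.1, by omega, by omega, by omega⟩

/-- Links are functional, so the runs from `e` are comparable, and no link starts at an edge whose
lower end is a reduced vertex. -/
theorem Run.eq_of_lower (hC : IsColorMap C) {e e₁ e₂ : HexEdge n d} (h₁ : Run hd C e e₁)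
    (h₂ : Run hd C e e₂) (r₁ : IsReducedVertex C (endv hd e₁ false))
    (r₂ : IsReducedVertex C (endv hd e₂ false)) : e₁ = e₂ := by
  have key : ∀ {a b}, Run hd C a b → IsReducedVertex C (endv hd a false) → a = b := by
    intro a b h hr
    rcases h.cases_head with h | ⟨c, hc, -⟩
    · exact h
    · exact absurd hr hc.not_reduced.1
  rcases Relation.ReflTransGen.total_of_right_unique
    (r := Link hd C) (fun _ _ _ h h' => Link.right_unique hC h h') h₁ h₂ with h | h
  · exact key h r₁
  · exact (key h r₂).symm

theorem Run.eq_of_upper (hC : IsColorMap C) {e e₁ e₂ : HexEdge n d} (h₁ : Run hd C e₁ e)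
    (h₂ : Run hd C e₂ e) (r₁ : IsReducedVertex C (endv hd e₁ true))
    (r₂ : IsReducedVertex C (endv hd e₂ true)) : e₁ = e₂ := by
  have key : ∀ {a b}, Run hd C a b → IsReducedVertex C (endv hd b true) → a = b := by
    intro a b h hr
    rcases h.cases_tail with h | ⟨c, -, hc⟩
    · exact h.symm
    · exact absurd hr hc.not_reduced.2
  rcases Relation.ReflTransGen.total_of_right_unique (r := Function.swap (Link hd C))
    (fun _ _ _ h h' => Link.left_unique hC h h') h₁.swap h₂.swap with h | h
  · exact (key h.swap r₁).symm
  · exact key h.swap r₂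

theorem exists_run_lower (hC : IsColorMap C) (e : HexEdge n d) (he : C e ≠ .m) :
    ∃ e', Run hd C e e' ∧ IsReducedVertex C (endv hd e' false) := by
  -- This coordinate is nonnegative and drops by one along each link.
  generalize hN : (e.src (e.type + 2)).toNat = N
  induction N using Nat.strong_induction_on generalizing e with
  | _ N ih =>
    by_cases hr : IsReducedVertex C (endv hd e false)
    · exact ⟨e, .refl, hr⟩
    · obtain ⟨e', h'⟩ := exists_link_of_lower hC he hr
      have h1 := h'.src hC
      have h2 := e'.src_bounds
      obtain ⟨e'', h3, h4⟩ := ih _ (by omega) e' (h'.2.1 ▸ he) rfl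
      exact ⟨e'', .head h' h3, h4⟩

theorem exists_run_upper (hC : IsColorMap C) (e : HexEdge n d) (he : C e ≠ .m) :
    ∃ e', Run hd C e' e ∧ IsReducedVertex C (endv hd e' true) := by
  generalize hN : (n - e.src (e.type + 2)).toNat = N
  induction N using Nat.strong_induction_on generalizing e with
  | _ N ih =>
    by_cases hr : IsReducedVertex C (endv hd e true)
    · exact ⟨e, .refl, hr⟩
    · obtain ⟨e', h'⟩ := exists_link_of_upper hC he hr
      have h1 := h'.src hC
      have h2 := e'.src_bounds
      obtain ⟨e'', h3, h4⟩ := ih _ (by omega) e' (h'.2.1.symm ▸ he) rfl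
      exact ⟨e'', .tail h3 h', h4⟩

/-! ## Edges of the reduced graph -/

variable (hd C) in
/-- The edges of the reduced graph, represented by the upper edge of the chain. -/
abbrev RedEdge : Type := {e : HexEdge n d // C e ≠ .m ∧ IsReducedVertex C (endv hd e true)}

variable (C) in
/-- Inner vertices of the reduced graph. -/
abbrev RedFace : Type := {f : HexFace n d // IsReducedVertex C (.inl f)}

variable (hC : IsColorMap C)

/-- The edge of the hexagon at the end `b` of an edge of the reduced graph. -/
noncomputable def endEdge (e : RedEdge hd C) (b : Bool) : HexEdge n d :=
  if b then e.1 else (exists_run_lower (hd := hd) hC e.1 e.2.1).choose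

theorem endEdge_true (e : RedEdge hd C) : endEdge hC e true = e.1 := rfl

theorem run_endEdge (e : RedEdge hd C) (b : Bool) : Run hd C e.1 (endEdge hC e b) := by
  cases b
  · exact (exists_run_lower (hd := hd) hC e.1 e.2.1).choose_spec.1
  · exact .refl

theorem isReduced_endEdge (e : RedEdge hd C) (b : Bool) :
    IsReducedVertex C (endv hd (endEdge hC e b) b) := by
  cases b
  · exact (exists_run_lower (hd := hd) hC e.1 e.2.1).choose_spec.2
  · exact e.2.2

theorem endEdge_type (e : RedEdge hd C) (b : Bool) : (endEdge hC e b).type = e.1.type :=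
  ((run_endEdge hC e b).spec hC).1.symm

theorem endEdge_color (e : RedEdge hd C) (b : Bool) : C (endEdge hC e b) = C e.1 :=
  ((run_endEdge hC e b).spec hC).2.1.symm

/-- The vertex at an end of an edge of the reduced graph. -/
noncomputable def endVertex (e : RedEdge hd C) (b : Bool) : ReducedVertex C :=
  ⟨endv hd (endEdge hC e b) b, isReduced_endEdge hC e b⟩

/-- Following the run backwards leads to only one edge whose upper end is a reduced vertex. -/
theorem endEdge_injective {e e' : RedEdge hd C} {b : Bool}
    (h : endEdge hC e b = endEdge hC e' b) : e = e' := by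
  have h1 := run_endEdge hC e b
  have h2 := run_endEdge hC e' b
  rw [← h] at h2
  exact Subtype.ext (Run.eq_of_upper hC h1 h2 e.2.2 e'.2.2)

theorem exists_endEdge (e : HexEdge n d) (b : Bool) (he : C e ≠ .m)
    (hr : IsReducedVertex C (endv hd e b)) : ∃ e' : RedEdge hd C, endEdge hC e' b = e := by
  cases b
  · obtain ⟨e', h1, h2⟩ := exists_run_upper (hd := hd) hC e he
    have hc := (h1.spec hC).2.1
    refine ⟨⟨e', hc ▸ he, h2⟩, ?_⟩
    exact Run.eq_of_lower hC (run_endEdge hC _ false) h1 (isReduced_endEdge hC _ false) hr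
  · exact ⟨⟨e, he, hr⟩, rfl⟩

variable (C) in
/-- The ends of the edges of the reduced graph. -/
abbrev RedEnd : Type := (RedFace C × Fin 3) ⊕ (Fin 3 × Fin n)

/-- Forgets that a face has no edge of color `m`. -/
def RedEnd.hex : RedEnd C → HexEnd n d := Sum.map (Prod.map Subtype.val id) id

theorem RedEnd.hex_injective : Function.Injective (RedEnd.hex (C := C)) :=
  Sum.map_injective.2 ⟨Subtype.val_injective.prodMap fun _ _ h => h, fun _ _ h => h⟩

theorem exists_redEnd (q : RedEnd C) : ∃ p : RedEdge hd C × Bool,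
    (endEdge hC p.1 p.2, p.2) = hexEnds hd q.hex := by
  have hv : endv hd (hexEnds hd q.hex).1 (hexEnds hd q.hex).2 = q.hex.vertex := by
    rw [endv, Prod.mk.eta, Equiv.symm_apply_apply]
  obtain ⟨e, he⟩ := exists_endEdge hC (hexEnds hd q.hex).1 (hexEnds hd q.hex).2 (by
    rcases q with ⟨f, ℓ⟩ | ⟨i, j⟩
    · exact f.2 ℓ
    · have := hC.color_outerEdge hd i j
      change C (outerEdge hd i j) ≠ _
      rw [this]
      split_ifs <;> simp) (by
    rw [hv]
    rcases q with ⟨f, ℓ⟩ | ⟨i, j⟩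
    · exact f.2
    · trivial)
  exact ⟨(e, (hexEnds hd q.hex).2), Prod.ext he rfl⟩

variable (hd) in
/-- The edge of the reduced graph and the direction corresponding to an end. -/
noncomputable def redEnd (q : RedEnd C) : RedEdge hd C × Bool := (exists_redEnd hC q).choose

theorem redEnd_spec (q : RedEnd C) :
    (endEdge hC (redEnd hd hC q).1 (redEnd hd hC q).2, (redEnd hd hC q).2) = hexEnds hd q.hex :=
  (exists_redEnd hC q).choose_spec

/-- The ends of reduced edges correspond to the hexagon ends located at reduced vertices: each of
those is the end of a unique run. -/
theorem redEnd_bijective : Function.Bijective (redEnd hd hC) := by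
  constructor
  · intro q q' h
    have h1 := redEnd_spec (hd := hd) hC q
    rw [h, redEnd_spec] at h1
    exact RedEnd.hex_injective ((hexEnds hd).injective h1.symm)
  · rintro ⟨e, b⟩
    obtain ⟨q, hq⟩ : ∃ q : RedEnd C, q.hex = (hexEnds hd).symm (endEdge hC e b, b) := by
      have hr := isReduced_endEdge hC e b
      rw [endv] at hr
      generalize (hexEnds hd).symm (endEdge hC e b, b) = p at *
      rcases p with ⟨f, ℓ⟩ | r
      · exact ⟨.inl (⟨f, hr⟩, ℓ), rfl⟩
      · exact ⟨.inr r, rfl⟩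
    refine ⟨q, ?_⟩
    have h1 := redEnd_spec (hd := hd) hC q
    rw [hq, Equiv.apply_symm_apply] at h1
    generalize redEnd hd hC q = p at *
    obtain ⟨h2, h3⟩ := Prod.mk.inj h1
    rw [h3] at h2
    exact Prod.ext (endEdge_injective hC h2) h3

/-- The ends of the edges of the reduced graph, as pairs of an edge and a direction. -/
noncomputable def redEnds : RedEnd C ≃ RedEdge hd C × Bool :=
  Equiv.ofBijective _ (redEnd_bijective hC)

theorem redEnds_spec (q : RedEnd C) :
    (endEdge hC (redEnds hC q (hd := hd)).1 (redEnds hC q (hd := hd)).2,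
      (redEnds hC q (hd := hd)).2) = hexEnds hd q.hex :=
  redEnd_spec hC q

/-- The vertex at an end. -/
def RedEnd.vertex : RedEnd C → ReducedVertex C
  | .inl (f, _) => ⟨.inl f.1, f.2⟩
  | .inr b => ⟨.inr b, trivial⟩

theorem endVertex_redEnds (q : RedEnd C) :
    endVertex hC (redEnds hC q (hd := hd)).1 (redEnds hC q (hd := hd)).2 = q.vertex := by
  refine Subtype.ext ?_
  change HexEnd.vertex ((hexEnds hd).symm (_, _)) = _
  rw [redEnds_spec, Equiv.symm_apply_apply]
  rcases q with ⟨f, ℓ⟩ | r <;> rfl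

theorem endVertex_eq (e : RedEdge hd C) (b : Bool) :
    endVertex hC e b = ((redEnds hC).symm (e, b)).vertex := by
  rw [← endVertex_redEnds hC (hd := hd), Equiv.apply_symm_apply]

theorem isUp_endVertex (e : RedEdge hd C) (b : Bool) : (endVertex hC e b).1.isUp = b :=
  isUp_endv hd _ b

/-- An edge of the reduced graph is determined by one of its ends and its type. -/
theorem eq_of_endVertex_eq {e e' : RedEdge hd C} {b : Bool}
    (h : endVertex hC e b = endVertex hC e' b) (ht : e.1.type = e'.1.type) : e = e' :=
  endEdge_injective hC (eq_of_endv_eq hd (congrArg Subtype.val h)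
    (by rw [endEdge_type, endEdge_type, ht]))

theorem eq_of_endVertex_eq_inr {e e' : RedEdge hd C} {b : Bool} {r : Fin 3 × Fin n}
    (h : (endVertex hC e b).1 = .inr r) (h' : (endVertex hC e' b).1 = .inr r) : e = e' := by
  obtain ⟨i, j⟩ := r
  have h1 := (endv_eq_inr hd).1 h
  have h2 := (endv_eq_inr hd).1 h'
  exact endEdge_injective hC (h1.1.symm.trans h2.1)

/-- This excludes multiple edges in the reduced graph. Going from the upper to the lower face along
an edge of type `ℓ`, the coordinate of index `ℓ + 2` is the only one that decreases, so the two
faces determine the type. -/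
theorem type_eq_of_endVertex_eq {e e' : RedEdge hd C} (h : endVertex hC e true = endVertex hC e' true)
    (h' : endVertex hC e false = endVertex hC e' false) : e = e' := by
  rcases hx : (endVertex hC e true).1 with f | r
  · rcases hy : (endVertex hC e false).1 with g | r
    · refine eq_of_endVertex_eq hC h ?_
      have a1 := coord_of_endv hd hx
      have a2 := coord_of_endv hd hy
      rw [h] at hx
      rw [h'] at hy
      have b1 := coord_of_endv hd hx
      have b2 := coord_of_endv hd hy
      have r1 := (run_endEdge hC e false).spec hC
      have r2 := (run_endEdge hC e' false).spec hC
      rw [endEdge_true, lowerOne_true] at a1 b1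
      rw [lowerOne_false, endEdge_type] at a2 b2
      rw [endEdge_type] at r1 r2
      rcases three_cases e.1.type e'.1.type with h | h | h
      · exact h.symm
      all_goals
        exfalso
        rw [h] at b1 b2 r2
        simp only [three_add_one_one, three_add_one_two, three_add_two_one, three_add_two_two] at *
        omega
    · exact eq_of_endVertex_eq_inr hC hy (by rw [← h', hy])
  · exact eq_of_endVertex_eq_inr hC hx (by rw [← h, hx])

end

/-! ### Maximal chains as edges of the reduced graph. -/

section

variable {n d : ℕ} {hd : d ≤ n} {C : HexEdge n d → HiveColor}

theorem Link.exists_m {e e' : HexEdge n d} (h : Link hd C e e') : ∃ M, C M = .m ∧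
    endv hd M false = endv hd e false ∧ endv hd M true = endv hd e' true := by
  obtain ⟨-, -, -, g, g', k, hk, hkk, h1, h2⟩ := h
  refine ⟨g.edge k, hk, ?_, ?_⟩
  · rw [h1]
    exact (endv_eq_inl hd).2 ⟨rfl, ((endv_eq_inl hd).1 h1).2⟩
  · rw [h2, hkk]
    exact (endv_eq_inl hd).2 ⟨rfl, ((endv_eq_inl hd).1 h2).2⟩

theorem Link.of_m (hC : IsColorMap C) {e e' M : HexEdge n d} (hM : C M = .m)
    (h1 : endv hd M false = endv hd e false) (h2 : endv hd M true = endv hd e' true)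
    (ht : e.type = e'.type) (hc : C e = C e') (he : C e ≠ .m) : Link hd C e e' := by
  obtain ⟨g, hg⟩ := hC.endv_of_m hd hM false
  obtain ⟨g', hg'⟩ := hC.endv_of_m hd hM true
  have a1 := ((endv_eq_inl hd).1 hg).1
  have a2 := ((endv_eq_inl hd).1 hg').1
  exact ⟨ht, hc, he, g, g', M.type, by rw [a1, hM], by rw [a1, a2], h1 ▸ hg, h2 ▸ hg'⟩

theorem Run.exists_seq {e e' : HexEdge n d} (h : Run hd C e e') : ∃ (r : ℕ) (g : ℕ → HexEdge n d),
    g 0 = e ∧ g r = e' ∧ ∀ i < r, Link hd C (g i) (g (i + 1)) := by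
  induction h using Relation.ReflTransGen.head_induction_on with
  | refl => exact ⟨0, fun _ => e', rfl, rfl, by simp⟩
  | head h _ ih =>
    rename_i a c _
    obtain ⟨r, g, h0, hr, hg⟩ := ih
    refine ⟨r + 1, fun i => if i = 0 then a else g (i - 1), rfl, by simpa using hr, ?_⟩
    rintro (_ | i) hi
    · simpa [h0] using h
    · simpa using hg i (by omega)

theorem IsMaximalChain.symm {c : EdgeColor} {ℓ : Fin 3} {x y : ReducedVertex C}
    (h : IsMaximalChain C c ℓ x y) : IsMaximalChain C c ℓ y x := by
  obtain ⟨r, u, e, h0, h1, hinj, hj, hc, hm⟩ := h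
  refine ⟨r, fun k => u (2 * r + 1 - k), fun k => e (2 * r - k), by simpa using h1, by simpa using h0,
    ?_, ?_, ?_, ?_⟩
  · intro k hk k' hk' hkk
    have := hinj (by simp) (by simp) hkk
    simp only [Set.mem_Iic] at hk hk'
    omega
  · intro i hi
    obtain ⟨a, b, c⟩ := hj (2 * r - i) (by omega)
    rw [show 2 * r - i + 1 = 2 * r + 1 - i by omega] at a c
    refine ⟨?_, c, ?_⟩ <;> dsimp only <;>
      rw [show 2 * r + 1 - (i + 1) = 2 * r - i by omega]
    exacts [a.symm, b]
  · intro i hi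
    dsimp only
    rw [show 2 * r - 2 * i = 2 * (r - i) by omega]
    exact hc _ (by omega)
  · intro i hi
    dsimp only
    rw [show 2 * r - (2 * i + 1) = 2 * (r - 1 - i) + 1 by omega]
    exact hm _ (by omega)

theorem Run.isMaximalChain (hC : IsColorMap C) {c : EdgeColor} {e e' : HexEdge n d}
    (h : Run hd C e e') (hc : C e = .col c) {x y : ReducedVertex C} (hx : endv hd e true = x)
    (hy : endv hd e' false = y) : IsMaximalChain C c e.type x y := by
  obtain ⟨r, g, h0, hr, hg⟩ := h.exists_seq
  have hM : ∀ i : ℕ, ∃ M, i < r → C M = .m ∧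
      endv hd M false = endv hd (g i) false ∧ endv hd M true = endv hd (g (i + 1)) true := by
    intro i
    by_cases hi : i < r
    · obtain ⟨M, hM⟩ := (hg i hi).exists_m
      exact ⟨M, fun _ => hM⟩
    · exact ⟨e, fun h => absurd h hi⟩
  choose M hM using hM
  have hrun : ∀ i ≤ r, (g i).type = e.type ∧ C (g i) = .col c ∧
      (g i).src (e.type + 2) = e.src (e.type + 2) - i := by
    intro i
    induction i with
    | zero => intro _; simp [h0, hc]
    | succ i ih =>
      intro hi
      obtain ⟨a, b, c⟩ := ih (by omega)
      have h1 := hg i (by omega)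
      have h2 := (h1.src hC).1
      have h3 := h1.1.symm.trans a
      rw [h3, a] at h2
      refine ⟨h3, h1.2.1.symm.trans b, ?_⟩
      rw [h2, c]; push_cast; ring
  -- Even vertices of the path are upper ends and odd ones lower ends of the linked edges; the edges
  -- `M` of color `m` fill the gaps.
  refine ⟨r, fun k => endv hd (g (k / 2)) (decide (k % 2 = 0)),
    fun k => if k % 2 = 0 then g (k / 2) else M (k / 2), ?_, ?_, ?_, ?_, ?_, ?_⟩
  · simp [h0, hx]
  · have h1 : (2 * r + 1) / 2 = r := by omega
    have h2 : (2 * r + 1) % 2 = 1 := by omega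
    simp [h1, h2, hr, hy]
  -- The parity of `k` is read off from `isUp`, and `k / 2` from the coordinate of index `type + 2`,
  -- which drops by one per link.
  · intro k hk k' hk' h
    simp only [Set.mem_Iic] at hk hk'
    have hp := congrArg DualVertex.isUp h
    simp only [isUp_endv, decide_eq_decide] at hp
    have a1 := hrun (k / 2) (by omega)
    have a2 := hrun (k' / 2) (by omega)
    have h3 := eq_of_endv_eq hd h (a1.1.trans a2.1.symm)
    rw [h3] at a1
    omega
  · intro i hi
    rw [joins_iff hd]
    rcases Nat.even_or_odd' i with ⟨m, rfl | rfl⟩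
    · refine ⟨true, ?_, ?_⟩
      · simp
      · have h1 : (2 * m + 1) / 2 = m := by omega
        have h2 : (2 * m + 1) % 2 = 1 := by omega
        simp [h1, h2]
    · have h1 : (2 * m + 1) / 2 = m := by omega
      have h2 : (2 * m + 1) % 2 = 1 := by omega
      have h3 : (2 * m + 1 + 1) / 2 = m + 1 := by omega
      have h4 : (2 * m + 1 + 1) % 2 = 0 := by omega
      have h5 := hM m (by omega)
      refine ⟨false, ?_, ?_⟩
      · simp [h1, h2, h5]
      · simp [h1, h2, h3, h4, h5]
  · intro i hi
    have := hrun i hi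
    simp [this]
  · intro i hi
    have h1 : (2 * i + 1) / 2 = i := by omega
    have h2 : (2 * i + 1) % 2 = 1 := by omega
    simp [h1, h2, (hM i hi).1]

/-- Upper and lower vertices alternate along a path, so the direction `b` in which the first edge is
traversed fixes all the others: the chain either descends or ascends throughout. -/
theorem IsMaximalChain.exists_run (hd : d ≤ n) (hC : IsColorMap C) {c : EdgeColor} {ℓ : Fin 3}
    {x y : ReducedVertex C} (h : IsMaximalChain C c ℓ x y) :
    ∃ e e', Run hd C e e' ∧ C e = .col c ∧ e.type = ℓ ∧
      ((endv hd e true = x ∧ endv hd e' false = y) ∨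
        (endv hd e true = y ∧ endv hd e' false = x)) := by
  obtain ⟨r, u, e, h0, h1, -, hj, hc, hm⟩ := h
  obtain ⟨b, hb, -⟩ := (joins_iff hd _ _ _).1 (hj 0 (by omega))
  have key : ∀ i ≤ r, endv hd (e (2 * i)) b = u (2 * i) ∧
      endv hd (e (2 * i)) (!b) = u (2 * i + 1) ∧
      ((b = true ∧ Run hd C (e 0) (e (2 * i))) ∨ (b = false ∧ Run hd C (e (2 * i)) (e 0))) := by
    intro i
    induction i with
    | zero =>
      intro _
      obtain ⟨b', hb', hb''⟩ := (joins_iff hd _ _ _).1 (hj 0 (by omega))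
      have : b = b' := by
        rw [← isUp_endv hd (e 0) b, hb, ← hb', isUp_endv]
      subst this
      refine ⟨hb', hb'', ?_⟩
      cases b
      · exact Or.inr ⟨rfl, .refl⟩
      · exact Or.inl ⟨rfl, .refl⟩
    | succ i ih =>
      intro hi
      obtain ⟨i1, i2, i3⟩ := ih (by omega)
      obtain ⟨b₁, m1, m2⟩ := (joins_iff hd _ _ _).1 (hj (2 * i + 1) (by omega))
      have e1 : b₁ = !b := by
        rw [← isUp_endv hd (e (2 * i + 1)) b₁, m1, ← i2, isUp_endv]
      subst e1
      rw [Bool.not_not] at m2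
      obtain ⟨b₂, p1, p2⟩ := (joins_iff hd _ _ _).1 (hj (2 * (i + 1)) (by omega))
      have e2 : b₂ = b := by
        rw [← isUp_endv hd (e (2 * (i + 1))) b₂, p1, ← isUp_endv hd (e (2 * i + 1)) b, m2]
        rfl
      subst e2
      refine ⟨p1, p2, ?_⟩
      have hM := hm i (by omega)
      have c1 := hc i (by omega)
      have c2 := hc (i + 1) hi
      have p1' : endv hd (e (2 * (i + 1))) b₂ = u (2 * i + 1 + 1) := p1
      cases b₂
      · refine Or.inr ⟨rfl, ?_⟩
        refine .head (Link.of_m hC hM (m2.trans p1'.symm) (m1.trans i2.symm) (c2.2.trans c1.2.symm)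
          (c2.1.trans c1.1.symm) (by rw [c2.1]; simp)) ?_
        exact (i3.resolve_left (by simp)).2
      · refine Or.inl ⟨rfl, ?_⟩
        refine .tail ?_ (Link.of_m hC hM (m1.trans i2.symm) (m2.trans p1'.symm) (c1.2.trans c2.2.symm)
          (c1.1.trans c2.1.symm) (by rw [c1.1]; simp))
        exact (i3.resolve_right (by simp)).2
  obtain ⟨k1, k2, k3⟩ := key r le_rfl
  rcases k3 with ⟨rfl, h⟩ | ⟨rfl, h⟩
  · exact ⟨_, _, h, (hc 0 (by omega)).1, (hc 0 (by omega)).2, Or.inl ⟨hb.trans h0, k2.trans h1⟩⟩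
  · exact ⟨_, _, h, (hc r le_rfl).1, (hc r le_rfl).2, Or.inr ⟨k2.trans h1, hb.trans h0⟩⟩

variable (hC : IsColorMap C)

theorem isMaximalChain_iff (hd : d ≤ n) {c : EdgeColor} {ℓ : Fin 3} {x y : ReducedVertex C} :
    IsMaximalChain C c ℓ x y ↔ ∃ e : RedEdge hd C, C e.1 = .col c ∧ e.1.type = ℓ ∧
      ∃ b, endVertex hC e b = x ∧ endVertex hC e (!b) = y := by
  constructor
  · intro h
    obtain ⟨e, e', hr, hc, ht, h⟩ := h.exists_run hd hC
    have key : ∀ x y : ReducedVertex C, endv hd e true = x → endv hd e' false = y →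
        ∃ E : RedEdge hd C, E.1 = e ∧ endVertex hC E true = x ∧ endVertex hC E false = y := by
      intro x y hx hy
      have hcm : C e ≠ .m := by rw [hc]; simp
      refine ⟨⟨e, hcm, hx ▸ x.2⟩, rfl, Subtype.ext hx, Subtype.ext ?_⟩
      rw [← hy]
      change endv hd _ false = _
      rw [Run.eq_of_lower hC hr (run_endEdge hC ⟨e, hcm, hx ▸ x.2⟩ false) (hy ▸ y.2)
        (isReduced_endEdge hC _ false)]
    rcases h with ⟨hx, hy⟩ | ⟨hx, hy⟩
    · obtain ⟨E, h1, h2, h3⟩ := key _ _ hx hy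
      exact ⟨E, h1 ▸ hc, h1 ▸ ht, true, h2, h3⟩
    · obtain ⟨E, h1, h2, h3⟩ := key _ _ hx hy
      exact ⟨E, h1 ▸ hc, h1 ▸ ht, false, h3, h2⟩
  · rintro ⟨e, hc, rfl, b, h1, h2⟩
    cases b
    · exact ((run_endEdge hC e false).isMaximalChain hC hc (congrArg Subtype.val h2)
        (congrArg Subtype.val h1)).symm
    · exact (run_endEdge hC e false).isMaximalChain hC hc (congrArg Subtype.val h1)
        (congrArg Subtype.val h2)

theorem endVertex_not_ne (e : RedEdge hd C) (b : Bool) : endVertex hC e b ≠ endVertex hC e (!b) := by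
  intro h
  have := congrArg (fun x : ReducedVertex C => x.1.isUp) h
  simp only [isUp_endVertex] at this
  cases b <;> cases this

theorem colorClass_adj_iff (hd : d ≤ n) {c : EdgeColor} {x y : ReducedVertex C} :
    ((reducedGraph C).colorClass c).Adj x y ↔ ∃ e : RedEdge hd C, C e.1 = .col c ∧
      ∃ b, endVertex hC e b = x ∧ endVertex hC e (!b) = y := by
  simp only [reducedGraph, SimpleGraph.fromRel_adj]
  constructor
  · rintro ⟨-, ⟨ℓ, h⟩ | ⟨ℓ, h⟩⟩
    · obtain ⟨e, h1, -, h2⟩ := (isMaximalChain_iff hC hd).1 h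
      exact ⟨e, h1, h2⟩
    · obtain ⟨e, h1, -, h2⟩ := (isMaximalChain_iff hC hd).1 h.symm
      exact ⟨e, h1, h2⟩
  · rintro ⟨e, hc, b, rfl, rfl⟩
    exact ⟨endVertex_not_ne hC e b, Or.inl ⟨e.1.type, (isMaximalChain_iff hC hd).2
      ⟨e, hc, rfl, b, rfl, rfl⟩⟩⟩

theorem exists_color {c : HiveColor} (h : c ≠ .m) : ∃ c', c = .col c' := by
  cases c with
  | col c => exact ⟨c, rfl⟩
  | m => exact absurd rfl h

theorem graph_adj_iff (hd : d ≤ n) {x y : ReducedVertex C} :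
    (reducedGraph C).graph.Adj x y ↔
      ∃ e : RedEdge hd C, ∃ b, endVertex hC e b = x ∧ endVertex hC e (!b) = y := by
  rw [BdryColoredGraph.graph, SimpleGraph.iSup_adj]
  constructor
  · rintro ⟨c, h⟩
    obtain ⟨e, -, h⟩ := (colorClass_adj_iff hC hd).1 h
    exact ⟨e, h⟩
  · rintro ⟨e, h⟩
    obtain ⟨c, hc⟩ := exists_color e.2.1
    exact ⟨c, (colorClass_adj_iff hC hd).2 ⟨e, hc, h⟩⟩

theorem isTypedEdge_iff (hd : d ≤ n) {ℓ : Fin 3} {x y : ReducedVertex C} :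
    IsTypedEdge C ℓ x y ↔ ∃ e : RedEdge hd C, e.1.type = ℓ ∧
      ∃ b, endVertex hC e b = x ∧ endVertex hC e (!b) = y := by
  constructor
  · rintro ⟨c, h⟩
    obtain ⟨e, -, h1, h2⟩ := (isMaximalChain_iff hC hd).1 (h.elim id fun h => h.symm)
    exact ⟨e, h1, h2⟩
  · rintro ⟨e, h1, h2⟩
    obtain ⟨c, hc⟩ := exists_color e.2.1
    exact ⟨c, Or.inl ((isMaximalChain_iff hC hd).2 ⟨e, hc, h1, h2⟩)⟩

/-- The first vertex determines the direction through `isUp`; the edge is then unique because there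
are no multiple edges. -/
theorem endVertex_inj {e e' : RedEdge hd C} {b b' : Bool}
    (h : endVertex hC e b = endVertex hC e' b') (h' : endVertex hC e (!b) = endVertex hC e' (!b')) :
    e = e' ∧ b = b' := by
  have hb : b = b' := by rw [← isUp_endVertex hC e b, h, isUp_endVertex]
  subst hb
  cases b
  · exact ⟨type_eq_of_endVertex_eq hC h' h, rfl⟩
  · exact ⟨type_eq_of_endVertex_eq hC h h', rfl⟩

/-- The edge of the reduced graph and the direction corresponding to an oriented edge, the first
vertex being at the given end. -/
theorem exists_dart (hd : d ≤ n) (p : (reducedGraph C).graph.Dart) : ∃ q : RedEdge hd C × Bool,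
    endVertex hC q.1 q.2 = p.fst ∧ endVertex hC q.1 (!q.2) = p.snd := by
  obtain ⟨e, b, h1, h2⟩ := (graph_adj_iff hC hd).1 p.adj
  exact ⟨(e, b), h1, h2⟩

/-- The oriented edge starting at an end of an edge of the reduced graph. -/
noncomputable def dartOf (e : RedEdge hd C) (b : Bool) : (reducedGraph C).graph.Dart :=
  ⟨(endVertex hC e b, endVertex hC e (!b)), (graph_adj_iff hC hd).2 ⟨e, b, rfl, rfl⟩⟩

theorem exists_dartOf (hd : d ≤ n) (p : (reducedGraph C).graph.Dart) :
    ∃ (e : RedEdge hd C) (b : Bool), p = dartOf hC e b := by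
  obtain ⟨q, h1, h2⟩ := exists_dart hC hd p
  exact ⟨q.1, q.2, SimpleGraph.Dart.ext _ _ (Prod.ext h1.symm h2.symm)⟩

theorem dartOf_inj {e e' : RedEdge hd C} {b b' : Bool} (h : dartOf hC e b = dartOf hC e' b') :
    e = e' ∧ b = b' :=
  endVertex_inj hC (congrArg (fun p => p.fst) h) (congrArg (fun p => p.snd) h)

theorem dartOf_symm (e : RedEdge hd C) (b : Bool) : (dartOf hC e b).symm = dartOf hC e (!b) := by
  refine SimpleGraph.Dart.ext _ _ (Prod.ext rfl ?_)
  change endVertex hC e b = endVertex hC e (!!b)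
  rw [Bool.not_not]

theorem reducedSign_eq (x : ReducedVertex C) : reducedSign C x = endSign x.1.isUp := by
  rcases x with ⟨f | ⟨i, j⟩, h⟩
  · rfl
  · simp [reducedSign, DualVertex.isUp, endSign]

theorem reducedSign_endVertex (e : RedEdge hd C) (b : Bool) :
    reducedSign C (endVertex hC e b) = endSign b := by
  rw [reducedSign_eq, isUp_endVertex]

/-- At an edge of type `ℓ` between two faces, the coordinate of index `ℓ + 2` is larger at the upper
end, and the coordinate of index `ℓ + 1` is not. -/
theorem coord_lt_of_edge {e : RedEdge hd C} {f g : HexFace n d}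
    (hf : (endVertex hC e true).1 = .inl f) (hg : (endVertex hC e false).1 = .inl g) :
    g.coord (e.1.type + 2) < f.coord (e.1.type + 2) := by
  have a1 := coord_of_endv hd hf
  have a2 := coord_of_endv hd hg
  have r1 := (run_endEdge hC e false).spec hC
  rw [endEdge_true, lowerOne_true] at a1
  rw [lowerOne_false, endEdge_type] at a2
  rw [endEdge_type] at r1
  omega

/-- The cover relation, in terms of three edges `e`, `e₁`, `e'` of types `ℓ`, `ℓ + 1`, `ℓ`. -/
theorem covers_iff (hd : d ≤ n) {p p' : (reducedGraph C).graph.Dart} : Covers C p p' ↔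
    ∃ (e e' e₁ : RedEdge hd C) (f f' : HexFace n d), e'.1.type = e.1.type ∧
      e₁.1.type = e.1.type + 1 ∧ p = dartOf hC e true ∧ p' = dartOf hC e' true ∧
      (endVertex hC e false).1 = .inl f ∧ (endVertex hC e' true).1 = .inl f' ∧
      endVertex hC e₁ false = endVertex hC e false ∧ endVertex hC e₁ true = endVertex hC e' true := by
  constructor
  · rintro ⟨ℓ, f, f', hf, hf', h1, h2, h3, hlt⟩
    obtain ⟨e, rfl, b, hb1, hb2⟩ := (isTypedEdge_iff hC hd).1 h1
    obtain ⟨e', ht, b', hb1', hb2'⟩ := (isTypedEdge_iff hC hd).1 h2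
    obtain ⟨e₁, ht₁, b₁, c1, c2⟩ := (isTypedEdge_iff hC hd).1 h3
    -- The inequality in the cover relation orients the middle edge: its type is `ℓ + 1`, and along
    -- it the coordinate of index `ℓ` is larger at the upper end.
    have hb₁ : b₁ = false := by
      cases b₁
      · rfl
      · exfalso
        have := coord_lt_of_edge hC (f := f) (g := f') (e := e₁) (by rw [c1, hf])
          (by rw [← hf', ← c2]; rfl)
        rw [ht₁, three_add_one_two] at this
        omega
    subst hb₁
    have hb : b = true := by
      have : (!b) = false := by
        rw [← isUp_endVertex hC e (!b), hb2, ← c1, isUp_endVertex]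
      simpa using this
    have hb' : b' = true := by
      rw [← isUp_endVertex hC e' b', hb1', ← c2, isUp_endVertex]; rfl
    subst hb hb'
    refine ⟨e, e', e₁, f, f', ht, ht₁, ?_, ?_, ?_, ?_, ?_, ?_⟩
    · exact SimpleGraph.Dart.ext _ _ (Prod.ext hb1.symm hb2.symm)
    · exact SimpleGraph.Dart.ext _ _ (Prod.ext hb1'.symm hb2'.symm)
    · rw [← hf, ← hb2]; rfl
    · rw [← hf', ← hb1']
    · rw [c1, ← hb2]; rfl
    · rw [hb1', ← c2]; rfl
  · rintro ⟨e, e', e₁, f, f', ht, ht₁, rfl, rfl, hf, hf', c1, c2⟩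
    refine ⟨e.1.type, f, f', hf, hf', ?_, ?_, ?_, ?_⟩
    · exact (isTypedEdge_iff hC hd).2 ⟨e, rfl, true, rfl, rfl⟩
    · exact (isTypedEdge_iff hC hd).2 ⟨e', ht, true, rfl, rfl⟩
    · exact (isTypedEdge_iff hC hd).2 ⟨e₁, ht₁, false, c1, c2⟩
    · have := coord_lt_of_edge hC (f := f') (g := f) (e := e₁) (by rw [c2, hf']) (by rw [c1, hf])
      rwa [ht₁, three_add_one_two] at this

end

/-! ## Weights of colors and types -/

/-- The weight of a pair of colors `0` (`false`) or `1` (`true`) and types. -/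
def baseWeight : Bool → Fin 3 → Bool → Fin 3 → ℤ
  | false, ℓ, true, k => if k = ℓ then -1 else if k = ℓ + 1 then 1 else 0
  | true, ℓ, false, k => if k = ℓ then 1 else if k = ℓ + 2 then -1 else 0
  | _, ℓ, _, k => if k = ℓ + 1 then 1 else if k = ℓ + 2 then -1 else 0

/-- Extension of a function of colors `0` and `1` and of types to all colors. -/
def HiveColor.extend (F : Bool → Fin 3 → ℤ) (ℓ : Fin 3) : HiveColor → ℤ
  | .col .zero => F false ℓ
  | .col .one => F true ℓ
  | .col .three => - F false (ℓ + 1) - F true (ℓ + 2)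
  | .m => - F false (ℓ + 2) - F true (ℓ + 1)

/-- The weight of a pair of colors and types. -/
def colorWeight (c : HiveColor) (ℓ : Fin 3) (c' : HiveColor) (k : Fin 3) : ℤ :=
  c.extend (fun b i => c'.extend (fun b' j => baseWeight b i b' j) k) ℓ

theorem HiveColor.forall {P : HiveColor → Prop} :
    (∀ c, P c) ↔ P (.col .zero) ∧ P (.col .one) ∧ P (.col .three) ∧ P .m :=
  ⟨fun h => ⟨h _, h _, h _, h _⟩, fun ⟨h0, h1, h2, h3⟩ c => by
    rcases c with (_ | _ | _) | _ <;> assumption⟩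

/-- The weight is the determinant of the vectors `e_ℓ`, `-e_{ℓ+1}`, `e_ℓ - e_{ℓ+1}`, `0` attached to
the colors `0, 1, 3, m` in type `ℓ`, where `e_0 + e_1 + e_2 = 0` and `det (e_ℓ, e_{ℓ+1}) = 1`. -/
theorem colorWeight_swap : ∀ (c c' : HiveColor) (ℓ k : Fin 3),
    colorWeight c' k c ℓ = - colorWeight c ℓ c' k := by
  rw [HiveColor.forall]
  refine ⟨?_, ?_, ?_, ?_⟩ <;> rw [HiveColor.forall] <;> decide

/-- The sign of a pair of types, as an integer. -/
def typeSignInt (ℓ k : Fin 3) : ℤ := if k = ℓ + 1 then 1 else if k = ℓ + 2 then -1 else 0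

theorem typeSignInt_cast (ℓ k : Fin 3) : (typeSignInt ℓ k : ℝ) = typeSign ℓ k := by
  simp [typeSign, typeSignInt]

/-- Relative to `e_ℓ`, the vectors of colors `0`, `3`, `1` are turned clockwise by 0, 30 and 60
degrees. From a vector of type `ℓ` to one of type `ℓ + 1` the angle is thus between 60 and 180
degrees. -/
theorem colorWeight_nonneg : ∀ (c c' : HiveColor) (ℓ k : Fin 3), c ≠ .m → c' ≠ .m →
    0 ≤ typeSignInt ℓ k * colorWeight c ℓ c' k := by
  rw [HiveColor.forall]
  refine ⟨?_, ?_, ?_, by simp⟩ <;> rw [HiveColor.forall] <;>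
    refine ⟨?_, ?_, ?_, by simp⟩ <;> intro ℓ k _ _ <;> revert ℓ k <;> decide

/-- The extreme angle of 180 degrees occurs only if the first vector is turned by 60 degrees and the
second is not turned. -/
theorem colorWeight_eq_zero : ∀ (c c' : HiveColor) (ℓ : Fin 3), c ≠ .m → c' ≠ .m →
    colorWeight c ℓ c' (ℓ + 1) = 0 → c = .col .one ∧ c' = .col .zero := by
  have key : ∀ (c c' : HiveColor) (ℓ : Fin 3), c ≠ .m → c' ≠ .m →
    (c = .col .one ∧ c' = .col .zero) ∨ colorWeight c ℓ c' (ℓ + 1) ≠ 0 := by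
    rw [HiveColor.forall]
    refine ⟨?_, ?_, ?_, by simp⟩ <;> rw [HiveColor.forall] <;>
      refine ⟨?_, ?_, ?_, by simp⟩ <;> intro ℓ _ _ <;>
      first
      | exact Or.inl ⟨rfl, rfl⟩
      | (refine Or.inr ?_; revert ℓ; decide)
  intro c c' ℓ h h' h0
  exact (key c c' ℓ h h').resolve_right (not_not.2 h0)

theorem colorWeight_self : ∀ (c : HiveColor) (ℓ : Fin 3), colorWeight c ℓ c ℓ = 0 := by
  rw [HiveColor.forall]
  decide

/-- The colors of the edges of type `k`, `k + 1`, `k + 2` of a face. -/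
theorem IsColorMap.face_cases {n d : ℕ} {C : HexEdge n d → HiveColor} (hC : IsColorMap C)
    (f : HexFace n d) : ∃ k, (C (f.edge k), C (f.edge (k + 1)), C (f.edge (k + 2))) ∈
      ({(.col .zero, .col .zero, .col .zero), (.col .one, .col .one, .col .one),
        (.col .one, .col .three, .col .zero), (.col .zero, .m, .col .one)} :
        Set (HiveColor × HiveColor × HiveColor)) := by
  obtain ⟨k, hk⟩ := hC.face f
  refine ⟨k, ?_⟩
  simp only [Set.mem_insert_iff, Set.mem_singleton_iff, Prod.mk.injEq] at hk ⊢
  tauto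

/-- The vectors of colors `3` and `m` are chosen to close up the triangles `(1,0,3)` and `(0,1,m)`.
-/
theorem sum_colorWeight {n d : ℕ} {C : HexEdge n d → HiveColor} (hC : IsColorMap C)
    (f : HexFace n d) (c : HiveColor) (i : Fin 3) :
    ∑ ℓ, colorWeight (C (f.edge ℓ)) ℓ c i = 0 := by
  obtain ⟨k, hk⟩ := hC.face_cases f
  simp only [Set.mem_insert_iff, Set.mem_singleton_iff, Prod.mk.injEq] at hk
  rw [three_sum k]
  rcases hk with ⟨h0, h1, h2⟩ | ⟨h0, h1, h2⟩ | ⟨h0, h1, h2⟩ | ⟨h0, h1, h2⟩ <;> rw [h0, h1, h2] <;>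
    clear h0 h1 h2 <;> revert k i <;> revert c <;> rw [HiveColor.forall] <;> decide

-- The vectors around a reduced face have consecutive determinants `1`, counted twice here. With an
-- edge of color `m` they are opposite vectors and `0`, so the triangle degenerates.
open Classical in
theorem colorWeight_area {n d : ℕ} {C : HexEdge n d → HiveColor} (hC : IsColorMap C)
    (f : HexFace n d) : colorWeight (C (f.edge 0)) 0 (C (f.edge 1)) 1 -
      colorWeight (C (f.edge 1)) 1 (C (f.edge 0)) 0 =
      if IsReducedVertex C (.inl f) then 2 else 0 := by
  obtain ⟨k, hk⟩ := hC.face_cases f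
  simp only [Set.mem_insert_iff, Set.mem_singleton_iff, Prod.mk.injEq] at hk
  have h : IsReducedVertex C (.inl f) ↔
      C (f.edge k) ≠ .m ∧ C (f.edge (k + 1)) ≠ .m ∧ C (f.edge (k + 2)) ≠ .m := three_forall k
  rw [h]
  clear h
  rcases hk with ⟨h0, h1, h2⟩ | ⟨h0, h1, h2⟩ | ⟨h0, h1, h2⟩ | ⟨h0, h1, h2⟩ <;> rw [h0, h1, h2] <;>
    simp only [ne_eq, reduceCtorEq, not_false_eq_true, not_true_eq_false, and_true, and_false,
      if_true, if_false, and_self] <;>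
    fin_cases k <;> simp at h0 h1 h2 <;> rw [‹C (f.edge 0) = _›, ‹C (f.edge 1) = _›] <;> decide

/-! ## The edges of the hexagon -/

section

variable {n d : ℕ} (hd : d ≤ n) {C : HexEdge n d → HiveColor} (hC : IsColorMap C)

/-- The system of all the edges of the dual graph of the hexagon. -/
noncomputable def hexSystem : EdgeSystem (HexFace n d) (Fin 3 × Fin n) (HexEdge n d) where
  ends := hexEnds hd
  type := HexEdge.type
  up := HexFace.up
  upRay := fun r => decide ((r.2 : ℕ) < d)
  weight := fun e e' => colorWeight (C e) e.type (C e') e'.type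
  hgt := fun e => ((e.src e.type - e.src (e.type + 1) + 2 : ℤ) : ℝ)
  -- The two faces along an edge of type `ℓ` agree in the coordinates of index `ℓ` and `ℓ + 1`, so
  -- this difference is constant along the dual edge: the dual graph is drawn as a regular hexagonal
  -- lattice.
  pos := fun f ℓ => ((f.coord ℓ - f.coord (ℓ + 1) + 1 : ℤ) : ℝ)
  type_ends := fun f ℓ => rfl
  ends_up := fun f ℓ => rfl
  ends_upRay := fun r => rfl
  weight_swap := fun e e' => by
    rw [colorWeight_swap]; push_cast; rfl
  sum_weight := fun f e' => by
    have := sum_colorWeight hC f (C e') e'.type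
    exact_mod_cast this
  weight_ray := fun r r' ht hu => by
    change (outerEdge hd r.1 r.2).type = (outerEdge hd r'.1 r'.2).type at ht
    change ((colorWeight (C (outerEdge hd r.1 r.2)) (outerEdge hd r.1 r.2).type
      (C (outerEdge hd r'.1 r'.2)) (outerEdge hd r'.1 r'.2).type : ℤ) : ℝ) = 0
    have h1 := hC.color_outerEdge hd r.1 r.2
    have h2 := hC.color_outerEdge hd r'.1 r'.2
    have h3 : C (outerEdge hd r.1 r.2) = C (outerEdge hd r'.1 r'.2) := by
      rw [h1, h2]; simp only [decide_eq_decide] at hu; simp only [hu]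
    rw [ht, h3, colorWeight_self, Int.cast_zero]
  pos_eq := fun f ℓ => by
    have h := f.edge_src ℓ
    have h1 : (f.edge ℓ).src (f.edge ℓ).type - (f.edge ℓ).src ((f.edge ℓ).type + 1) + 2 =
      f.coord ℓ - f.coord (ℓ + 1) + 1 := by
      rw [HexFace.edge_type]; omega
    rw [← h1]
    rfl
  sum_pos := fun f g => by
    simp only [Fin.sum_univ_three, ← Int.cast_add]
    congr 1
    have h1 : (1 : Fin 3) + 1 = 2 := rfl
    have h2 : (2 : Fin 3) + 1 = 0 := rfl
    rw [zero_add, h1, h2]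
    ring

theorem hexSystem_fin_inl {e : HexEdge n d} {b : Bool} {f : HexFace n d} {ℓ : Fin 3}
    (h : (hexSystem hd hC).fin e b = .inl (f, ℓ)) : endv hd e b = .inl f := by
  change (hexEnds hd).symm (e, b) = _ at h
  rw [endv, h]; rfl

theorem hexSystem_fin_inr {e : HexEdge n d} {b : Bool} {r : Fin 3 × Fin n}
    (h : (hexSystem hd hC).fin e b = .inr r) :
    e.src (e.type + 2) = if b then (n : ℤ) else 0 := by
  change (hexEnds hd).symm (e, b) = _ at h
  have h1 : endv hd e b = .inr r := by rw [endv, h]; rfl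
  obtain ⟨i, j⟩ := r
  obtain ⟨h2, h3⟩ := (endv_eq_inr hd).1 h1
  rw [← h2]
  rcases outerEdge_src hd i j with h4 | h4
  · rw [h4.2.2.2.2, ← h3, decide_eq_true h4.1]; rfl
  · rw [h4.2.2.2.2, ← h3, decide_eq_false (by omega)]; rfl

/-- Positions of the ends of an edge. -/
theorem hexSystem_pos {e : HexEdge n d} {b : Bool} {f : HexFace n d} {ℓ : Fin 3}
    (h : (hexSystem hd hC).fin e b = .inl (f, ℓ)) :
    (hexSystem hd hC).pos f e.type = ((e.src e.type - e.src (e.type + 1) + 2 : ℤ) : ℝ) ∧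
    (hexSystem hd hC).pos f (e.type + 1) =
      ((e.src (e.type + 1) - e.src (e.type + 2) + lowerOne b : ℤ) : ℝ) ∧
    (hexSystem hd hC).pos f (e.type + 2) =
      ((e.src (e.type + 2) - e.src e.type + 1 - lowerOne b : ℤ) : ℝ) ∧
    (b = true → e.src (e.type + 2) < n) ∧ (b = false → 0 < e.src (e.type + 2)) := by
  have h1 := coord_of_endv hd (hexSystem_fin_inl hd hC h)
  have h2 := f.coord_bounds e.type
  refine ⟨?_, ?_, ?_, ?_, ?_⟩
  · exact congrArg Int.cast (show f.coord e.type - f.coord (e.type + 1) + 1 = _ by omega)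
  · exact congrArg Int.cast (show f.coord (e.type + 1) - f.coord (e.type + 1 + 1) + 1 = _ by
      rw [three_add_one_one]; omega)
  · exact congrArg Int.cast (show f.coord (e.type + 2) - f.coord (e.type + 2 + 1) + 1 = _ by
      rw [three_add_two_one]; omega)
  · rintro rfl; rw [lowerOne_true] at h1; omega
  · rintro rfl; rw [lowerOne_false] at h1; omega

theorem hexSystem_directed : (hexSystem hd hC).Directed := by
  intro e f g ℓ ℓ' hf hg
  have h1 := (hexSystem_pos hd hC hf).2.1
  have h2 := (hexSystem_pos hd hC hg).2.1
  change (hexSystem hd hC).pos f (e.type + 1) < (hexSystem hd hC).pos g (e.type + 1)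
  rw [h1, h2, Int.cast_lt, lowerOne_true, lowerOne_false]
  omega

theorem sign_int_pos {a : ℤ} (h : 0 < a) : Real.sign (a : ℝ) = 1 :=
  Real.sign_of_pos (by exact_mod_cast h)

theorem sign_int_neg {a : ℤ} (h : a < 0) : Real.sign (a : ℝ) = -1 :=
  Real.sign_of_neg (by exact_mod_cast h)

/-- The sides of the ends of an edge with respect to a line of integral height. -/
theorem hexSystem_side (e : HexEdge n d) (b : Bool) (h : ℤ) :
    ((e.src (e.type + 2) = (if b then (n : ℤ) else 0) ∧
      (hexSystem hd hC).side (e.type + 1) h ((hexSystem hd hC).fin e b) = - endSign b ∧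
      (hexSystem hd hC).side (e.type + 2) h ((hexSystem hd hC).fin e b) = endSign b)) ∨
    (∃ f, (hexSystem hd hC).fin e b = .inl (f, e.type) ∧
      e.src (e.type + 2) ≠ (if b then (n : ℤ) else 0) ∧
      (hexSystem hd hC).side (e.type + 1) h ((hexSystem hd hC).fin e b) =
        Real.sign ((e.src (e.type + 1) - e.src (e.type + 2) + lowerOne b - h : ℤ) : ℝ) ∧
      (hexSystem hd hC).side (e.type + 2) h ((hexSystem hd hC).fin e b) =
        Real.sign ((e.src (e.type + 2) - e.src e.type + 1 - lowerOne b - h : ℤ) : ℝ)) := by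
  rcases hf : (hexSystem hd hC).fin e b with ⟨f, ℓ⟩ | r
  · right
    have h1 := hexSystem_pos hd hC hf
    have h2 := ((hexSystem hd hC).fin_inl hf).2.2
    refine ⟨f, by rw [h2]; rfl, ?_, ?_, ?_⟩
    · cases b
      · exact (h1.2.2.2.2 rfl).ne'
      · exact (h1.2.2.2.1 rfl).ne
    · simp only [EdgeSystem.side]
      rw [h1.2.1, ← Int.cast_sub]
    · simp only [EdgeSystem.side]
      rw [h1.2.2.1, ← Int.cast_sub]
  · left
    have h1 := (hexSystem hd hC).fin_inr hf
    refine ⟨hexSystem_fin_inr hd hC hf, ?_, ?_⟩ <;> simp only [EdgeSystem.side] <;>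
      rw [← h1.1, ← h1.2]
    · change -(endSign b * typeSign e.type (e.type + 1)) = _
      rw [show typeSign e.type (e.type + 1) = 1 by simp [typeSign]]; ring
    · change -(endSign b * typeSign e.type (e.type + 2)) = _
      rw [show typeSign e.type (e.type + 2) = -1 by simp [typeSign]]; ring

/-- In the coordinate of index `type + 1` an edge spans a unit interval, extended to infinity at a
boundary vertex; a line that does not reach this interval has both ends on the same side. -/
theorem hexSystem_cross_one {e : HexEdge n d} {h : ℤ}
    (hc : (hexSystem hd hC).cross e (e.type + 1) h ≠ 0) :
    (e.src (e.type + 1) - e.src (e.type + 2) ≤ h ∨ e.src (e.type + 2) = n) ∧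
    (h ≤ e.src (e.type + 1) - e.src (e.type + 2) + 1 ∨ e.src (e.type + 2) = 0) := by
  rw [EdgeSystem.cross_eq] at hc
  have h1 := hexSystem_side hd hC e true h
  have h2 := hexSystem_side hd hC e false h
  simp only [if_true, Bool.false_eq_true, if_false, endSign, lowerOne] at h1 h2
  constructor
  · by_contra! hcon
    rcases h1 with h1 | ⟨f, -, -, h1, -⟩
    · exact hcon.2 h1.1
    · rw [sign_int_pos (by omega)] at h1
      rcases h2 with h2 | ⟨g, -, -, h2, -⟩
      · rw [h1, h2.2.1] at hc; norm_num at hc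
      · rw [sign_int_pos (by omega)] at h2
        rw [h1, h2] at hc; norm_num at hc
  · by_contra! hcon
    rcases h2 with h2 | ⟨f, -, -, h2, -⟩
    · exact hcon.2 h2.1
    · rw [sign_int_neg (by omega)] at h2
      rcases h1 with h1 | ⟨g, -, -, h1, -⟩
      · rw [h2, h1.2.1] at hc; norm_num at hc
      · rw [sign_int_neg (by omega)] at h1
        rw [h1, h2] at hc; norm_num at hc

theorem hexSystem_cross_two {e : HexEdge n d} {h : ℤ}
    (hc : (hexSystem hd hC).cross e (e.type + 2) h ≠ 0) :
    (e.src (e.type + 2) - e.src e.type ≤ h ∨ e.src (e.type + 2) = 0) ∧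
    (h ≤ e.src (e.type + 2) - e.src e.type + 1 ∨ e.src (e.type + 2) = n) := by
  rw [EdgeSystem.cross_eq] at hc
  have h1 := hexSystem_side hd hC e true h
  have h2 := hexSystem_side hd hC e false h
  simp only [if_true, Bool.false_eq_true, if_false, endSign, lowerOne] at h1 h2
  constructor
  · by_contra! hcon
    rcases h2 with h2 | ⟨f, -, -, -, h2⟩
    · exact hcon.2 h2.1
    · rw [sign_int_pos (by omega)] at h2
      rcases h1 with h1 | ⟨g, -, -, -, h1⟩
      · rw [h2, h1.2.2] at hc; norm_num at hc
      · rw [sign_int_pos (by omega)] at h1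
        rw [h1, h2] at hc; norm_num at hc
  · by_contra! hcon
    rcases h1 with h1 | ⟨f, -, -, -, h1⟩
    · exact hcon.2 h1.1
    · rw [sign_int_neg (by omega)] at h1
      rcases h2 with h2 | ⟨g, -, -, -, h2⟩
      · rw [h1, h2.2.2] at hc; norm_num at hc
      · rw [sign_int_neg (by omega)] at h2
        rw [h1, h2] at hc; norm_num at hc

theorem hexSystem_fin_of_ne (e : HexEdge n d) (b : Bool)
    (h : e.src (e.type + 2) ≠ (if b then (n : ℤ) else 0)) :
    ∃ f, (hexSystem hd hC).fin e b = .inl (f, e.type) := by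
  rcases hexSystem_side hd hC e b 0 with h1 | ⟨f, h1, -⟩
  · exact absurd h1.1 h
  · exact ⟨f, h1⟩

/-- The heights are integers and edges span unit intervals, so edges that meet do so at an end of
each; the bounds of the hexagon rule out a meeting on the infinite part of a ray. The ends then have
the same position. -/
theorem hexSystem_meet_eq_inc_of_next {e e' : HexEdge n d} (ht : e'.type = e.type + 1) :
    (hexSystem hd hC).meet e e' = (hexSystem hd hC).inc e e' := by
  have hne : (hexSystem hd hC).type e ≠ (hexSystem hd hC).type e' := by
    change e.type ≠ e'.type
    rw [ht]; exact (three_one_ne _).symm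
  rcases (hexSystem_directed hd hC).inc_cases hne with hi | hi
  swap
  · rw [hi.1, hi.2]
  rw [hi]
  by_contra hm
  rw [EdgeSystem.meet, neg_eq_zero, mul_eq_zero, not_or] at hm
  have hc1 : (hexSystem hd hC).cross e (e.type + 1)
      ((e'.src e'.type - e'.src (e'.type + 1) + 2 : ℤ) : ℝ) ≠ 0 := ht ▸ hm.1
  have hc2 : (hexSystem hd hC).cross e' (e'.type + 2)
      ((e.src e.type - e.src (e.type + 1) + 2 : ℤ) : ℝ) ≠ 0 := by
    rw [ht, three_add_one_two]; exact hm.2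
  have k1 := hexSystem_cross_one hd hC hc1
  have k2 := hexSystem_cross_two hd hC hc2
  have b1 := e.src_bounds
  have b2 := e'.src_bounds
  rw [ht] at k1 k2 b2
  simp only [three_add_one_one, three_add_one_two] at k1 k2 b2
  have n1 : (e.src (e.type + 2) ≠ n ∧ e'.src (e.type + 1) - e'.src (e.type + 2) + 2 =
      e.src (e.type + 1) - e.src (e.type + 2)) ∨ (e.src (e.type + 2) ≠ 0 ∧
      e'.src (e.type + 1) - e'.src (e.type + 2) + 2 =
      e.src (e.type + 1) - e.src (e.type + 2) + 1) := by omega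
  have n2 : (e'.src e.type ≠ n ∧ e.src e.type - e.src (e.type + 1) + 2 =
      e'.src e.type - e'.src (e.type + 1) + 1) ∨ (e'.src e.type ≠ 0 ∧
      e.src e.type - e.src (e.type + 1) + 2 = e'.src e.type - e'.src (e.type + 1)) := by omega
  obtain ⟨b, f, hf, hfp⟩ : ∃ b f, (hexSystem hd hC).fin e b = .inl (f, e.type) ∧
      (hexSystem hd hC).pos f (e.type + 1) =
        ((e'.src (e.type + 1) - e'.src (e.type + 2) + 2 : ℤ) : ℝ) := by
    rcases n1 with n1 | n1
    · obtain ⟨f, hf⟩ := hexSystem_fin_of_ne hd hC e true n1.1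
      refine ⟨true, f, hf, ?_⟩
      rw [(hexSystem_pos hd hC hf).2.1, lowerOne_true, n1.2, add_zero]
    · obtain ⟨f, hf⟩ := hexSystem_fin_of_ne hd hC e false n1.1
      refine ⟨false, f, hf, ?_⟩
      rw [(hexSystem_pos hd hC hf).2.1, lowerOne_false, n1.2]
  obtain ⟨b', g, hg, hgp⟩ : ∃ b f, (hexSystem hd hC).fin e' b = .inl (f, e'.type) ∧
      (hexSystem hd hC).pos f e.type =
        ((e.src e.type - e.src (e.type + 1) + 2 : ℤ) : ℝ) := by
    have h0 : e'.src (e'.type + 2) = e'.src e.type := by rw [ht, three_add_one_two]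
    rcases n2 with n2 | n2
    · obtain ⟨f, hf⟩ := hexSystem_fin_of_ne hd hC e' true (h0 ▸ n2.1)
      refine ⟨true, f, hf, ?_⟩
      have := (hexSystem_pos hd hC hf).2.2.1
      rw [h0, ht, three_add_one_two] at this
      rw [this, lowerOne_true, n2.2, sub_zero]
    · obtain ⟨f, hf⟩ := hexSystem_fin_of_ne hd hC e' false (h0 ▸ n2.1)
      refine ⟨false, f, hf, ?_⟩
      have := (hexSystem_pos hd hC hf).2.2.1
      rw [h0, ht, three_add_one_two] at this
      rw [this, lowerOne_false, n2.2]
      congr 1; ring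
  have hf0 := (hexSystem_pos hd hC hf).1
  have hg0 := (hexSystem_pos hd hC hg).1
  rw [ht, three_add_one_one] at hg0
  have hpos : (hexSystem hd hC).pos f = (hexSystem hd hC).pos g := by
    have p0 := hf0.trans hgp.symm
    have p1 := hfp.trans hg0.symm
    refine three_ext e.type p0 p1 ?_
    have := (hexSystem hd hC).sum_pos f g
    rw [three_sum e.type, three_sum e.type, p0, p1] at this
    exact add_left_cancel this
  have hn : (hexSystem hd hC).near ((hexSystem hd hC).fin e b) ((hexSystem hd hC).fin e' b') = 1 := by
    rw [hf, hg]
    simp only [EdgeSystem.near, if_pos hpos]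
  have hle : (1 : ℝ) ≤ (hexSystem hd hC).inc e e' := by
    rw [EdgeSystem.inc, ← hn]
    have h0 : ∀ q q', 0 ≤ (hexSystem hd hC).near q q' := fun q q' => by
      rcases (hexSystem hd hC).near_cases q q' with h | h
      · rw [h]
      · rw [h.1]; norm_num
    exact (Finset.single_le_sum (f := fun b' => (hexSystem hd hC).near
        ((hexSystem hd hC).fin e b) ((hexSystem hd hC).fin e' b')) (fun b' _ => h0 _ _)
        (Finset.mem_univ b')).trans
      (Finset.single_le_sum (f := fun b => ∑ b', (hexSystem hd hC).near
        ((hexSystem hd hC).fin e b) ((hexSystem hd hC).fin e' b'))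
        (fun b _ => Finset.sum_nonneg fun b' _ => h0 _ _) (Finset.mem_univ b))
  rw [hi] at hle
  norm_num at hle

theorem EdgeSystem.meet_comm {I B E : Type} (S : EdgeSystem I B E) (e e' : E) :
    S.meet e e' = S.meet e' e := by
  rw [EdgeSystem.meet, EdgeSystem.meet, mul_comm]

theorem EdgeSystem.near_comm {I B E : Type} (S : EdgeSystem I B E) (q q' : (I × Fin 3) ⊕ B) :
    S.near q q' = S.near q' q := by
  rcases q with ⟨v, ℓ⟩ | r <;> rcases q' with ⟨v', ℓ'⟩ | r' <;> simp only [EdgeSystem.near, eq_comm]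

theorem EdgeSystem.inc_comm {I B E : Type} (S : EdgeSystem I B E) (e e' : E) :
    S.inc e e' = S.inc e' e := by
  rw [EdgeSystem.inc, EdgeSystem.inc, Finset.sum_comm]
  simp only [S.near_comm]

theorem hexSystem_pos_injective : Function.Injective (hexSystem hd hC).pos := by
  intro f g h
  have h1 : ∀ ℓ, f.coord ℓ - f.coord (ℓ + 1) + 1 = g.coord ℓ - g.coord (ℓ + 1) + 1 := fun ℓ =>
    Int.cast_injective (α := ℝ) (congrFun h ℓ)
  have h2 := h1 0
  have h3 := h1 1
  have h4 := f.coord_bounds 0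
  have h5 := g.coord_bounds 0
  simp only [zero_add] at h2 h4 h5
  rw [show (1 : Fin 3) + 1 = 2 from rfl] at h3
  have h6 : lowerOne f.up = 0 ∨ lowerOne f.up = 1 := by cases f.up <;> simp [lowerOne]
  have h7 : lowerOne g.up = 0 ∨ lowerOne g.up = 1 := by cases g.up <;> simp [lowerOne]
  refine HexFace.ext ?_ (funext ?_)
  -- The coordinates of `f` and `g` differ by a common constant, three times which is a difference
  -- of two numbers in `{0, 1}`; hence the constant is zero.
  · have : lowerOne f.up = lowerOne g.up := by omega
    revert this
    cases f.up <;> cases g.up <;> simp [lowerOne]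
  · rw [Fin.forall_fin_succ, Fin.forall_fin_two]
    exact ⟨by omega, by change f.coord 1 = g.coord 1; omega, by change f.coord 2 = g.coord 2; omega⟩

open Classical in
/-- The contribution of the rays, computed in the hexagon. -/
theorem rayConst_hex (hC : IsColorMap C) [Fintype (HexFace n d)] [Fintype (HexEdge n d)] :
    EdgeSystem.rayConst (fun r : Fin 3 × Fin n => (outerEdge hd r.1 r.2).type)
      (fun r => decide ((r.2 : ℕ) < d))
      (fun r r' => (colorWeight (C (outerEdge hd r.1 r.2)) (outerEdge hd r.1 r.2).type
        (C (outerEdge hd r'.1 r'.2)) (outerEdge hd r'.1 r'.2).type : ℝ)) =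
      2 * ∑ f : HexFace n d, if IsReducedVertex C (.inl f) then 2 else 0 := by
  have h := (hexSystem hd hC).rayConst_eq (hexSystem_pos_injective hd hC) (by
    intro e e' hne
    rcases three_cases e.type e'.type with h | h | h
    · exact absurd h.symm hne
    · exact hexSystem_meet_eq_inc_of_next hd hC h
    · rw [EdgeSystem.meet_comm, EdgeSystem.inc_comm]
      exact hexSystem_meet_eq_inc_of_next hd hC (by rw [h, three_add_two_one]))
  refine Eq.trans h ?_
  congr 1
  refine Finset.sum_congr rfl fun f _ => ?_
  have := colorWeight_area hC f
  rw [← Int.cast_inj (α := ℝ)] at this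
  push_cast at this
  exact this

end

/-! ## Coordinates in the plane -/

theorem bary_sum (ℓ : Fin 3) (z : ℂ) : bary ℓ z + bary (ℓ + 1) z + bary (ℓ + 2) z = 1 := by
  rw [← three_sum ℓ (fun k => bary k z), Fin.sum_univ_three]
  simp [bary]
  ring

theorem bary_sum_univ (z : ℂ) : ∑ ℓ, bary ℓ z = 1 := by rw [three_sum 0, bary_sum]

/-- The point of given coordinates. -/
noncomputable def ofBary (p : Fin 3 → ℝ) : ℂ := ⟨p 1 + p 2 / 2, p 2 * √3 / 2⟩

theorem bary_ofBary {p : Fin 3 → ℝ} (hp : ∑ k, p k = 1) (k : Fin 3) : bary k (ofBary p) = p k := by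
  have h3 : (√3 : ℝ) ≠ 0 := by positivity
  rw [Fin.sum_univ_three] at hp
  fin_cases k
  · simp [bary, ofBary]
    field_simp
    linarith
  · simp [bary, ofBary]
    field_simp
    ring
  · simp [bary, ofBary]
    field_simp

theorem ofBary_bary (z : ℂ) : ofBary (fun k => bary k z) = z := by
  have h3 : (√3 : ℝ) ≠ 0 := by positivity
  apply Complex.ext
  · simp [bary, ofBary]
    field_simp
    ring
  · simp [bary, ofBary]

theorem bary_ext {z w : ℂ} (h : ∀ k, bary k z = bary k w) : z = w := by
  rw [← ofBary_bary z, ← ofBary_bary w, funext h]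

theorem bary_ext_two {z w : ℂ} (ℓ : Fin 3) (h0 : bary ℓ z = bary ℓ w)
    (h1 : bary (ℓ + 1) z = bary (ℓ + 1) w) : z = w := by
  refine bary_ext ((three_forall ℓ).2 ⟨h0, h1, ?_⟩)
  have := bary_sum ℓ z
  have := bary_sum ℓ w
  linarith

theorem typeDir_zero : typeDir 0 = ⟨-1 / 2, √3 / 2⟩ := by
  have h : 2 * Real.pi * (((0 : Fin 3) : ℕ) + 1) / 3 = Real.pi - Real.pi / 3 := by
    simp; ring
  rw [typeDir, h]
  apply Complex.ext
  · rw [Complex.exp_ofReal_mul_I_re, Real.cos_pi_sub, Real.cos_pi_div_three]; norm_num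
  · rw [Complex.exp_ofReal_mul_I_im, Real.sin_pi_sub, Real.sin_pi_div_three]

theorem typeDir_one : typeDir 1 = ⟨-1 / 2, - (√3 / 2)⟩ := by
  have h : 2 * Real.pi * (((1 : Fin 3) : ℕ) + 1) / 3 = Real.pi / 3 + Real.pi := by
    simp; ring
  rw [typeDir, h]
  apply Complex.ext
  · rw [Complex.exp_ofReal_mul_I_re, Real.cos_add_pi, Real.cos_pi_div_three]; norm_num
  · rw [Complex.exp_ofReal_mul_I_im, Real.sin_add_pi, Real.sin_pi_div_three]

theorem typeDir_two : typeDir 2 = ⟨1, 0⟩ := by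
  have h : 2 * Real.pi * (((2 : Fin 3) : ℕ) + 1) / 3 = 2 * Real.pi := by
    simp; ring
  rw [typeDir, h]
  apply Complex.ext
  · rw [Complex.exp_ofReal_mul_I_re, Real.cos_two_pi]
  · rw [Complex.exp_ofReal_mul_I_im, Real.sin_two_pi]

/-- The vector `-typeDir ℓ` has barycentric components `typeSign ℓ`, so one symbol encodes both the
cyclic order of types and the directions of edges. -/
theorem bary_sub_typeDir (k ℓ : Fin 3) (z : ℂ) (t : ℝ) :
    bary k (z - t * typeDir ℓ) = bary k z + t * typeSign ℓ k := by
  have h3 : (√3 : ℝ) ≠ 0 := by positivity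
  have e : typeSign 0 0 = 0 ∧ typeSign 0 1 = 1 ∧ typeSign 0 2 = -1 ∧ typeSign 1 0 = -1 ∧
      typeSign 1 1 = 0 ∧ typeSign 1 2 = 1 ∧ typeSign 2 0 = 1 ∧ typeSign 2 1 = -1 ∧
      typeSign 2 2 = 0 := by simp [typeSign]
  obtain ⟨e1, e2, e3, e4, e5, e6, e7, e8, e9⟩ := e
  fin_cases ℓ <;> fin_cases k <;>
    simp [bary, typeDir_zero, typeDir_one, typeDir_two, e1, e2, e3, e4, e5, e6, e7, e8, e9] <;>
    field_simp <;> ring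

theorem eq_sub_typeDir_iff {z w : ℂ} {ℓ : Fin 3} {t : ℝ} :
    w = z - t * typeDir ℓ ↔ ∀ k, bary k w = bary k z + t * typeSign ℓ k := by
  constructor
  · rintro rfl k
    exact bary_sub_typeDir k ℓ z t
  · intro h
    exact bary_ext fun k => by rw [h, bary_sub_typeDir]

theorem typeSign_one (ℓ : Fin 3) : typeSign ℓ (ℓ + 1) = 1 := by simp [typeSign]

theorem typeSign_two (ℓ : Fin 3) : typeSign ℓ (ℓ + 2) = -1 := by simp [typeSign]

theorem eq_sub_typeDir_of_bary {z w : ℂ} {ℓ : Fin 3} (h : bary ℓ w = bary ℓ z) :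
    w = z - (bary (ℓ + 1) w - bary (ℓ + 1) z : ℝ) * typeDir ℓ := by
  rw [eq_sub_typeDir_iff, three_forall ℓ, typeSign_self, typeSign_one, typeSign_two]
  have := bary_sum ℓ z
  have := bary_sum ℓ w
  exact ⟨by linarith, by linarith, by linarith⟩

theorem hasType_iff {ℓ : Fin 3} {a b : ℂ} : HasType ℓ a b ↔ bary ℓ a = bary ℓ b := by
  constructor
  · rintro ⟨t, ht⟩
    have : b = a - ((-t : ℝ) : ℂ) * typeDir ℓ := by
      rw [Complex.ofReal_neg, neg_mul, sub_neg_eq_add, ← ht]; ring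
    rw [this, bary_sub_typeDir, typeSign_self, mul_zero, add_zero]
  · intro h
    have := eq_sub_typeDir_of_bary h.symm
    refine ⟨-(bary (ℓ + 1) b - bary (ℓ + 1) a), ?_⟩
    rw [Complex.ofReal_neg, neg_mul, ← sub_eq_iff_eq_add'.2 (this.trans (sub_eq_add_neg _ _))]

theorem bary_convex (k : Fin 3) (a b : ℂ) {s t : ℝ} (h : s + t = 1) :
    bary k (s • a + t • b) = s * bary k a + t * bary k b := by
  obtain rfl : s = 1 - t := by linarith
  fin_cases k <;> simp [bary] <;> ring

theorem norm_typeDir (ℓ : Fin 3) : ‖typeDir ℓ‖ = 1 := by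
  rw [typeDir, Complex.norm_exp_ofReal_mul_I]

theorem inner_typeDir (ℓ k : Fin 3) (t s : ℝ) :
    inner ℝ ((t : ℂ) * typeDir ℓ) ((s : ℂ) * typeDir k) = t * s * if ℓ = k then 1 else -1 / 2 := by
  have hs : (√3 : ℝ) * √3 = 3 := Real.mul_self_sqrt (by norm_num)
  rw [Complex.inner]
  fin_cases ℓ <;> fin_cases k <;>
    simp [typeDir_zero, typeDir_one, typeDir_two] <;>
    first
    | ring1
    | linear_combination (t * s / 4) * hs
    | linear_combination (-t * s / 4) * hs

theorem det_typeDir (ℓ k : Fin 3) (t s : ℝ) :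
    ((t : ℂ) * typeDir ℓ).re * ((s : ℂ) * typeDir k).im -
      ((t : ℂ) * typeDir ℓ).im * ((s : ℂ) * typeDir k).re = t * s * typeSign ℓ k * (√3 / 2) := by
  have e : typeSign 0 0 = 0 ∧ typeSign 0 1 = 1 ∧ typeSign 0 2 = -1 ∧ typeSign 1 0 = -1 ∧
      typeSign 1 1 = 0 ∧ typeSign 1 2 = 1 ∧ typeSign 2 0 = 1 ∧ typeSign 2 1 = -1 ∧
      typeSign 2 2 = 0 := by simp [typeSign]
  obtain ⟨e1, e2, e3, e4, e5, e6, e7, e8, e9⟩ := e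
  fin_cases ℓ <;> fin_cases k <;>
    simp [typeDir_zero, typeDir_one, typeDir_two, e1, e2, e3, e4, e5, e6, e7, e8, e9] <;> ring

theorem cos_two_pi_div_three : Real.cos (2 * Real.pi / 3) = -1 / 2 := by
  rw [show 2 * Real.pi / 3 = Real.pi - Real.pi / 3 by ring, Real.cos_pi_sub,
    Real.cos_pi_div_three]; norm_num

theorem norm_mul_typeDir (ℓ : Fin 3) (t : ℝ) : ‖(t : ℂ) * typeDir ℓ‖ = |t| := by
  rw [norm_mul, norm_typeDir, mul_one, Complex.norm_real, Real.norm_eq_abs]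

theorem isAngle_next {ℓ : Fin 3} {t s : ℝ} (h : 0 < t * s) :
    IsAngle ((t : ℂ) * typeDir ℓ) ((s : ℂ) * typeDir (ℓ + 1)) (2 * Real.pi / 3) := by
  refine ⟨?_, ?_⟩
  · rw [det_typeDir, typeSign_one]; positivity
  · rw [InnerProductGeometry.angle, inner_typeDir, norm_mul_typeDir, norm_mul_typeDir, ← abs_mul,
      abs_of_pos h, if_neg (three_one_ne ℓ).symm, mul_div_cancel_left₀ _ h.ne',
      ← cos_two_pi_div_three, Real.arccos_cos] <;> linarith [Real.pi_pos]

theorem isAngle_prev {ℓ : Fin 3} {t s : ℝ} (h : t * s < 0) :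
    IsAngle ((t : ℂ) * typeDir ℓ) ((s : ℂ) * typeDir (ℓ + 2)) (Real.pi / 3) := by
  refine ⟨?_, ?_⟩
  · rw [det_typeDir, typeSign_two]
    have := neg_pos.2 h
    have h3 : (0 : ℝ) < √3 / 2 := by positivity
    nlinarith [mul_pos this h3]
  · rw [InnerProductGeometry.angle, inner_typeDir, norm_mul_typeDir, norm_mul_typeDir, ← abs_mul,
      abs_of_neg h, if_neg (three_two_ne ℓ).symm]
    rw [show t * s * (-1 / 2) / -(t * s) = 1 / 2 by
        rw [div_neg, mul_div_cancel_left₀ _ h.ne]; norm_num,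
      ← Real.cos_pi_div_three, Real.arccos_cos] <;> linarith [Real.pi_pos]

/-- The cosine of the angle is `-1/2`, while parallel directions would give `±1`, and directions of
distinct types give `-1/2` only for coefficients of equal sign. -/
theorem of_isAngle {ℓ k : Fin 3} {t s : ℝ} (ht : t ≠ 0) (hs : s ≠ 0)
    (h : IsAngle ((t : ℂ) * typeDir ℓ) ((s : ℂ) * typeDir k) (2 * Real.pi / 3)) :
    ℓ ≠ k ∧ 0 < t * s := by
  have h1 := InnerProductGeometry.cos_angle_mul_norm_mul_norm ((t : ℂ) * typeDir ℓ)
    ((s : ℂ) * typeDir k)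
  rw [h.2, cos_two_pi_div_three, inner_typeDir, norm_mul_typeDir, norm_mul_typeDir,
    ← abs_mul] at h1
  have h2 : 0 < |t * s| := abs_pos.2 (mul_ne_zero ht hs)
  by_cases hk : ℓ = k
  · exfalso
    rw [if_pos hk] at h1
    rcases abs_cases (t * s) with h3 | h3 <;> linarith
  · rw [if_neg hk] at h1
    exact ⟨hk, by linarith⟩

/-! ## Drawings of the reduced graph -/

section

variable {n d : ℕ} {hd : d ≤ n} {C : HexEdge n d → HiveColor} (hC : IsColorMap C)

/-- An inner vertex of the reduced graph. -/
def RedFace.vertex (f : RedFace C) : ReducedVertex C := ⟨.inl f.1, f.2⟩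

variable (C) in
/-- A boundary vertex of the reduced graph. -/
def bdryVertex (r : Fin 3 × Fin n) : ReducedVertex C := ⟨.inr r, trivial⟩

theorem reducedVertex_cases (x : ReducedVertex C) :
    (∃ f : RedFace C, x = f.vertex) ∨ ∃ r, x = bdryVertex C r := by
  rcases x with ⟨f | r, h⟩
  · exact Or.inl ⟨⟨f, h⟩, rfl⟩
  · exact Or.inr ⟨r, rfl⟩

theorem bdryVertex_injective : Function.Injective (bdryVertex C) := fun _ _ h =>
  Sum.inr.inj (congrArg Subtype.val h)

theorem RedFace.vertex_ne (f : RedFace C) (r : Fin 3 × Fin n) : f.vertex ≠ bdryVertex C r :=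
  fun h => by cases congrArg Subtype.val h

variable (hd)

/-- The edge of type `ℓ` at an inner vertex. -/
noncomputable def redLeg (f : RedFace C) (ℓ : Fin 3) : RedEdge hd C := (redEnds hC (.inl (f, ℓ))).1

/-- The edge at a boundary vertex. -/
noncomputable def redRay (r : Fin 3 × Fin n) : RedEdge hd C := (redEnds hC (.inr r)).1

theorem redEnds_inl (f : RedFace C) (ℓ : Fin 3) :
    redEnds hC (.inl (f, ℓ)) = (redLeg hd hC f ℓ, f.1.up) :=
  Prod.ext rfl (Prod.mk.inj (redEnds_spec hC (hd := hd) (.inl (f, ℓ)))).2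

theorem redEnds_inr (r : Fin 3 × Fin n) :
    redEnds hC (.inr r) = (redRay hd hC r, decide ((r.2 : ℕ) < d)) :=
  Prod.ext rfl (Prod.mk.inj (redEnds_spec hC (hd := hd) (.inr r))).2

theorem endEdge_redLeg (f : RedFace C) (ℓ : Fin 3) :
    endEdge hC (redLeg hd hC f ℓ) f.1.up = f.1.edge ℓ := by
  have h := congrArg Prod.fst (redEnds_spec hC (hd := hd) (.inl (f, ℓ)))
  rw [redEnds_inl] at h
  exact h

theorem endEdge_redRay (r : Fin 3 × Fin n) :
    endEdge hC (redRay hd hC r) (decide ((r.2 : ℕ) < d)) = outerEdge hd r.1 r.2 := by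
  have h := congrArg Prod.fst (redEnds_spec hC (hd := hd) (.inr r))
  rw [redEnds_inr] at h
  exact h

theorem redLeg_type (f : RedFace C) (ℓ : Fin 3) : (redLeg hd hC f ℓ).1.type = ℓ := by
  rw [← endEdge_type hC _ f.1.up, endEdge_redLeg]; rfl

theorem redLeg_color (f : RedFace C) (ℓ : Fin 3) : C (redLeg hd hC f ℓ).1 = C (f.1.edge ℓ) := by
  rw [← endEdge_color hC _ f.1.up, endEdge_redLeg]

theorem redRay_type (r : Fin 3 × Fin n) : (redRay hd hC r).1.type = (outerEdge hd r.1 r.2).type := by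
  rw [← endEdge_type hC _ (decide ((r.2 : ℕ) < d)), endEdge_redRay]

theorem redRay_color (r : Fin 3 × Fin n) : C (redRay hd hC r).1 = C (outerEdge hd r.1 r.2) := by
  rw [← endEdge_color hC _ (decide ((r.2 : ℕ) < d)), endEdge_redRay]

theorem endVertex_redLeg (f : RedFace C) (ℓ : Fin 3) :
    endVertex hC (redLeg hd hC f ℓ) f.1.up = f.vertex := by
  have h := endVertex_redEnds hC (hd := hd) (.inl (f, ℓ))
  rw [redEnds_inl] at h
  exact h

theorem endVertex_redRay (r : Fin 3 × Fin n) :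
    endVertex hC (redRay hd hC r) (decide ((r.2 : ℕ) < d)) = bdryVertex C r := by
  have h := endVertex_redEnds hC (hd := hd) (.inr r)
  rw [redEnds_inr] at h
  exact h

variable {hd}

theorem eq_redLeg {e : RedEdge hd C} {b : Bool} {f : RedFace C} (h : endVertex hC e b = f.vertex) :
    e = redLeg hd hC f e.1.type ∧ b = f.1.up := by
  have hb : b = f.1.up := by rw [← isUp_endVertex hC e b, h]; rfl
  subst hb
  exact ⟨eq_of_endVertex_eq hC (h.trans (endVertex_redLeg hd hC f _).symm)
    (redLeg_type hd hC f _).symm, rfl⟩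

theorem eq_redRay {e : RedEdge hd C} {b : Bool} {r : Fin 3 × Fin n}
    (h : endVertex hC e b = bdryVertex C r) :
    e = redRay hd hC r ∧ b = decide ((r.2 : ℕ) < d) := by
  have hb : b = decide ((r.2 : ℕ) < d) := by rw [← isUp_endVertex hC e b, h]; rfl
  subst hb
  exact ⟨eq_of_endVertex_eq_inr hC (congrArg Subtype.val h)
    (congrArg Subtype.val (endVertex_redRay hd hC r)), rfl⟩

variable (hd) in
theorem redRay_cases (r : Fin 3 × Fin n) :
    ((r.2 : ℕ) < d ∧ decide ((r.2 : ℕ) < d) = true ∧ (redRay hd hC r).1.type = r.1 + 2 ∧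
      C (redRay hd hC r).1 = .col .one) ∨
    (¬ (r.2 : ℕ) < d ∧ decide ((r.2 : ℕ) < d) = false ∧ (redRay hd hC r).1.type = r.1 + 1 ∧
      C (redRay hd hC r).1 = .col .zero) := by
  rw [redRay_type, redRay_color hd hC, hC.color_outerEdge]
  rcases outerEdge_src hd r.1 r.2 with h | h
  · exact Or.inl ⟨h.1, decide_eq_true h.1, h.2.1, if_pos h.1⟩
  · have : ¬ (r.2 : ℕ) < d := by omega
    exact Or.inr ⟨this, decide_eq_false this, h.2.1, if_neg this⟩

/-- One of the ends of an edge is an inner vertex. -/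
theorem exists_face_of_bdry {e : RedEdge hd C} {b : Bool} {r : Fin 3 × Fin n}
    (h : endVertex hC e b = bdryVertex C r) : ∃ f : RedFace C, endVertex hC e (!b) = f.vertex := by
  rcases reducedVertex_cases (endVertex hC e (!b)) with h1 | ⟨r', h'⟩
  · exact h1
  · exfalso
    have h1 := eq_redRay hC h
    have h2 := eq_redRay hC h'
    have h3 := redRay_cases hd hC r
    have h4 := redRay_cases hd hC r'
    rw [← h1.1, ← h1.2] at h3
    rw [← h2.1, ← h2.2] at h4
    cases b <;> simp_all

theorem divergence_face (hd : d ≤ n) (ω : (reducedGraph C).graph.Dart → ℝ) (f : RedFace C) :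
    ∑ᶠ p : {p : (reducedGraph C).graph.Dart // p.fst = f.vertex}, ω p =
      ∑ ℓ, ω (dartOf hC (redLeg hd hC f ℓ) f.1.up) := by
  rw [← finsum_eq_sum_of_fintype]
  symm
  refine finsum_eq_of_bijective
    (fun ℓ => ⟨dartOf hC (redLeg hd hC f ℓ) f.1.up, endVertex_redLeg hd hC f ℓ⟩) ⟨?_, ?_⟩
    (fun ℓ => rfl)
  · intro ℓ k h
    have := (dartOf_inj hC (congrArg Subtype.val h)).1
    rw [← redLeg_type hd hC f ℓ, this, redLeg_type]
  · rintro ⟨p, hp⟩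
    obtain ⟨e, b, rfl⟩ := exists_dartOf hC hd p
    obtain ⟨h1, h2⟩ := eq_redLeg hC (f := f) (e := e) (b := b) hp
    refine ⟨e.1.type, Subtype.ext ?_⟩
    simp only
    rw [← h1, ← h2]

theorem divergence_bdry (hd : d ≤ n) (ω : (reducedGraph C).graph.Dart → ℝ) (r : Fin 3 × Fin n) :
    ∑ᶠ p : {p : (reducedGraph C).graph.Dart // p.fst = bdryVertex C r}, ω p =
      ω (dartOf hC (redRay hd hC r) (decide ((r.2 : ℕ) < d))) := by
  rw [finsum_eq_single _ (⟨dartOf hC (redRay hd hC r) (decide ((r.2 : ℕ) < d)),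
    endVertex_redRay hd hC r⟩ : {p : (reducedGraph C).graph.Dart // p.fst = bdryVertex C r})]
  rintro ⟨p, hp⟩ hne
  exfalso
  obtain ⟨e, b, rfl⟩ := exists_dartOf hC hd p
  obtain ⟨h1, h2⟩ := eq_redRay hC (r := r) (e := e) (b := b) hp
  refine hne (Subtype.ext ?_)
  simp only
  rw [← h1, ← h2]

variable (hd) in
/-- The vertices of the reduced graph are placed in the plane in such a way that edges of type `ℓ`
leave upper vertices in the direction `-exp (2πi(ℓ+1)/3)`. -/
structure IsDrawing (h : ColoredSegments) (Z : ReducedVertex C → ℂ) : Prop where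
  injective : Function.Injective Z
  mem_edges : ∀ a b, s(a, b) ∈ h.edges ↔ ∃ (e : RedEdge hd C) (b' : Bool),
    Z (endVertex hC e b') = a ∧ Z (endVertex hC e (!b')) = b
  height_eq : ∀ e : RedEdge hd C,
    bary e.1.type (Z (endVertex hC e false)) = bary e.1.type (Z (endVertex hC e true))
  lt : ∀ e : RedEdge hd C, bary (e.1.type + 1) (Z (endVertex hC e true)) <
    bary (e.1.type + 1) (Z (endVertex hC e false))

namespace IsDrawing

variable {hC} {h : ColoredSegments} {Z : ReducedVertex C → ℂ} (hZ : IsDrawing hd hC h Z)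

/-- The length of an edge, in barycentric coordinates. -/
noncomputable def _root_.drawLength (hC : IsColorMap C) (Z : ReducedVertex C → ℂ)
    (e : RedEdge hd C) : ℝ :=
  bary (e.1.type + 1) (Z (endVertex hC e false)) - bary (e.1.type + 1) (Z (endVertex hC e true))

theorem length_pos (hZ : IsDrawing hd hC h Z) (e : RedEdge hd C) : 0 < drawLength hC Z e :=
  sub_pos.2 (hZ.lt e)

theorem lower_eq (hZ : IsDrawing hd hC h Z) (e : RedEdge hd C) : Z (endVertex hC e false) =
    Z (endVertex hC e true) - (drawLength hC Z e : ℝ) * typeDir e.1.type :=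
  eq_sub_typeDir_of_bary (hZ.height_eq e)

theorem bary_lower (hZ : IsDrawing hd hC h Z) (e : RedEdge hd C) (k : Fin 3) :
    bary k (Z (endVertex hC e false)) =
      bary k (Z (endVertex hC e true)) + drawLength hC Z e * typeSign e.1.type k :=
  eq_sub_typeDir_iff.1 (hZ.lower_eq e) k

theorem height_end (hZ : IsDrawing hd hC h Z) (e : RedEdge hd C) (b : Bool) :
    bary e.1.type (Z (endVertex hC e b)) = bary e.1.type (Z (endVertex hC e true)) := by
  cases b
  · exact hZ.height_eq e
  · rfl

theorem hasType_iff (hZ : IsDrawing hd hC h Z) (e : RedEdge hd C) (b : Bool) (k : Fin 3) :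
    HasType k (Z (endVertex hC e b)) (Z (endVertex hC e (!b))) ↔ k = e.1.type := by
  rw [_root_.hasType_iff]
  have key : bary k (Z (endVertex hC e false)) = bary k (Z (endVertex hC e true)) ↔
      k = e.1.type := by
    rw [hZ.bary_lower]
    have := (hZ.length_pos e).ne'
    constructor
    · intro hk
      have h1 : typeSign e.1.type k = 0 := by
        have : drawLength hC Z e * typeSign e.1.type k = 0 := by linarith
        exact (mul_eq_zero.1 this).resolve_left (hZ.length_pos e).ne'
      rcases three_cases e.1.type k with rfl | rfl | rfl
      · rfl
      · rw [typeSign_one] at h1; norm_num at h1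
      · rw [typeSign_two] at h1; norm_num at h1
    · rintro rfl
      rw [typeSign_self, mul_zero, add_zero]
  cases b
  · exact key
  · exact eq_comm.trans key

theorem vertexSign_eq (hZ : IsDrawing hd hC h Z) (e : RedEdge hd C) (b : Bool) :
    h.vertexSign (Z (endVertex hC e b)) = endSign b := by
  rw [ColoredSegments.vertexSign]
  cases b
  · rw [if_neg]
    · rfl
    · rintro ⟨w, ℓ, t, hw, ht, hwt⟩
      obtain ⟨e', b', h1, rfl⟩ := (hZ.mem_edges _ _).1 hw
      have hv := hZ.injective h1
      have hb : b' = false := by rw [← isUp_endVertex hC e' b', hv, isUp_endVertex]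
      subst hb
      have h2 := eq_sub_typeDir_iff.1 hwt
      have h3 := hZ.bary_lower e'
      rw [hv] at h3
      -- Two positive multiples of vectors `typeSign` would add up to zero, which the coordinates of
      -- index `ℓ` and `ℓ + 1` refute.
      have h4 : ∀ k, t * typeSign ℓ k + drawLength hC Z e' * typeSign e'.1.type k = 0 := fun k => by
        have a := h2 k
        have b := h3 k
        change bary k (Z (endVertex hC e' true)) = _ at a
        linarith
      have h5 := hZ.length_pos e'
      have h6 := h4 ℓ
      have h7 := h4 (ℓ + 1)
      rw [typeSign_self] at h6
      rw [typeSign_one] at h7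
      rcases three_cases e'.1.type ℓ with h8 | h8 | h8
      · rw [h8, typeSign_one] at h7; linarith
      · rw [h8, typeSign_one] at h6; linarith
      · rw [h8, typeSign_two] at h6; linarith
  · rw [if_pos]
    · rfl
    · exact ⟨_, e.1.type, _, (hZ.mem_edges _ _).2 ⟨e, true, rfl, rfl⟩, hZ.length_pos e, hZ.lower_eq e⟩

theorem edgeHeight_eq (hZ : IsDrawing hd hC h Z) (e : RedEdge hd C) (b : Bool) :
    ColoredSegments.edgeHeight (Z (endVertex hC e b)) (Z (endVertex hC e (!b))) =
      bary e.1.type (Z (endVertex hC e true)) := by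
  have : ColoredSegments.edgeType (Z (endVertex hC e b)) (Z (endVertex hC e (!b))) = e.1.type := by
    simp only [ColoredSegments.edgeType, hZ.hasType_iff]
    generalize e.1.type = k
    fin_cases k <;> simp
  rw [ColoredSegments.edgeHeight, this, hZ.height_end]

/-- The flow of a drawing. -/
theorem flow_eq (hZ : IsDrawing hd hC h Z) (e : RedEdge hd C) (b : Bool) :
    h.flow (Z (endVertex hC e b)) (Z (endVertex hC e (!b))) =
      endSign b * bary e.1.type (Z (endVertex hC e true)) := by
  rw [ColoredSegments.flow, hZ.vertexSign_eq, hZ.edgeHeight_eq]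

theorem flow_leg (hZ : IsDrawing hd hC h Z) (f : RedFace C) (ℓ : Fin 3) :
    bary ℓ (Z (endVertex hC (redLeg hd hC f ℓ) true)) = bary ℓ (Z f.vertex) := by
  have h1 := hZ.height_end (redLeg hd hC f ℓ) f.1.up
  rw [redLeg_type, endVertex_redLeg] at h1
  exact h1.symm

end IsDrawing

end

/-! ## The graph of a honeycomb is drawn in the plane -/

namespace ColoredSegments

variable {h : ColoredSegments}

theorem HasColor.mem {c : EdgeColor} {a b : ℂ} (hc : h.HasColor c a b) : s(a, b) ∈ h.edges := hc.1

theorem HasColor.unique {c c' : EdgeColor} {a b : ℂ} (hc : h.HasColor c a b)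
    (hc' : h.HasColor c' a b) : c = c' := hc.2.symm.trans hc'.2

theorem exists_hasColor {a b : ℂ} (hab : s(a, b) ∈ h.edges) : ∃ c, h.HasColor c a b :=
  ⟨_, hab, rfl⟩

theorem mem_vertices_left {a b : ℂ} (hab : s(a, b) ∈ h.edges) : a ∈ h.vertices :=
  ⟨_, hab, Sym2.mem_mk_left a b⟩

theorem mem_vertices_right {a b : ℂ} (hab : s(a, b) ∈ h.edges) : b ∈ h.vertices :=
  ⟨_, hab, Sym2.mem_mk_right a b⟩

theorem vertices_subset_support : h.vertices ⊆ h.support := by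
  rintro v ⟨e, he, hv⟩
  obtain ⟨w, rfl⟩ := Sym2.mem_iff_exists.1 hv
  exact ⟨v, w, he, left_mem_segment ℝ v w⟩

end ColoredSegments

theorem sum_typeSign_mul_typeSign (ℓ k : Fin 3) :
    ∑ i, typeSign ℓ i * typeSign k i = if ℓ = k then 2 else -1 := by
  fin_cases ℓ <;> fin_cases k <;> simp [typeSign, Fin.sum_univ_three] <;> norm_num

theorem sum_typeSign (k : Fin 3) : ∑ ℓ, typeSign ℓ k = 0 := by
  fin_cases k <;> simp [typeSign, Fin.sum_univ_three]

/-! ### Isomorphisms with the structure graph preserve types and directions. -/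

section

variable {n d : ℕ} {hd : d ≤ n} {C : HexEdge n d → HiveColor} {hC : IsColorMap C}
  {h : ColoredSegments}

theorem hasColor_iso_iff (hC : IsColorMap C) (hh : h.IsTriangular n)
    (ι : BdryColoredIso (reducedGraph C) (h.structureGraph n)) (hd : d ≤ n)
    {c : EdgeColor} {a b : ℂ} : h.HasColor c a b ↔ ∃ e : RedEdge hd C, C e.1 = .col c ∧ ∃ b',
      (ι.toEquiv (endVertex hC e b') : ℂ) = a ∧ (ι.toEquiv (endVertex hC e (!b')) : ℂ) = b := by
  constructor
  · intro hc
    have hab : a ≠ b := hh.isHoneycomb.nontrivial _ hc.mem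
    set v : h.vertices := ⟨a, ColoredSegments.mem_vertices_left hc.mem⟩ with hv
    set w : h.vertices := ⟨b, ColoredSegments.mem_vertices_right hc.mem⟩ with hw
    have hadj : ((h.structureGraph n).colorClass c).Adj v w :=
      ⟨fun h => hab (congrArg Subtype.val h), hc⟩
    rw [← ι.toEquiv.apply_symm_apply v, ← ι.toEquiv.apply_symm_apply w, ← ι.adj_iff] at hadj
    obtain ⟨e, he, b', h1, h2⟩ := (colorClass_adj_iff hC hd).1 hadj
    refine ⟨e, he, b', ?_, ?_⟩
    · rw [h1, Equiv.apply_symm_apply]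
    · rw [h2, Equiv.apply_symm_apply]
  · rintro ⟨e, he, b', rfl, rfl⟩
    have hadj := (colorClass_adj_iff hC hd).2 ⟨e, he, b', rfl, rfl⟩
    exact ((ι.adj_iff c _ _).1 hadj).2

theorem mem_edges_iso_iff (hC : IsColorMap C) (hh : h.IsTriangular n)
    (ι : BdryColoredIso (reducedGraph C) (h.structureGraph n)) (hd : d ≤ n)
    (a b : ℂ) : s(a, b) ∈ h.edges ↔ ∃ (e : RedEdge hd C) (b' : Bool),
      (ι.toEquiv (endVertex hC e b') : ℂ) = a ∧ (ι.toEquiv (endVertex hC e (!b')) : ℂ) = b := by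
  constructor
  · intro hab
    obtain ⟨c, hc⟩ := ColoredSegments.exists_hasColor hab
    obtain ⟨e, -, h⟩ := (hasColor_iso_iff hC hh ι hd).1 hc
    exact ⟨e, h⟩
  · rintro ⟨e, h⟩
    obtain ⟨c, hc⟩ := exists_color e.2.1
    exact ((hasColor_iso_iff hC hh ι hd).2 ⟨e, hc, h⟩).mem

/-- An isomorphism from the reduced graph to the structure graph of a honeycomb preserves the types
and the orientations of edges. -/
theorem isDrawing_iso (hC : IsColorMap C) (hh : h.IsTriangular n)
    (ι : BdryColoredIso (reducedGraph C) (h.structureGraph n)) (hd : d ≤ n) :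
    IsDrawing hd hC h fun x => (ι.toEquiv x : ℂ) := by
  classical
  have : Fintype (RedEdge hd C) := Fintype.ofFinite _
  have : Fintype (RedFace C) := Fintype.ofFinite _
  set Z : ReducedVertex C → ℂ := fun x => (ι.toEquiv x : ℂ) with hZ
  have hinj : Function.Injective Z := Subtype.val_injective.comp ι.toEquiv.injective
  have hmem := mem_edges_iso_iff hC hh ι hd
  have hT : ∀ e : RedEdge hd C, ∃ (T : Fin 3) (τ : ℝ), τ ≠ 0 ∧
      Z (endVertex hC e false) = Z (endVertex hC e true) - τ * typeDir T := by
    intro e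
    have he : s(Z (endVertex hC e true), Z (endVertex hC e false)) ∈ h.edges :=
      (hmem _ _).2 ⟨e, true, rfl, rfl⟩
    obtain ⟨T, hT⟩ := hh.hasType _ _ he
    obtain ⟨t, ht⟩ := hT
    refine ⟨T, -t, ?_, ?_⟩
    · intro h0
      have : t = 0 := by linarith
      rw [this, Complex.ofReal_zero, zero_mul, sub_eq_zero] at ht
      exact hh.isHoneycomb.nontrivial _ he ht.symm
    · rw [Complex.ofReal_neg, neg_mul, sub_neg_eq_add, ← ht]; ring
  choose T τ hτ hTτ using hT
  have hbary : ∀ e k, bary k (Z (endVertex hC e false)) =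
      bary k (Z (endVertex hC e true)) + τ e * typeSign (T e) k := fun e =>
    eq_sub_typeDir_iff.1 (hTτ e)
  -- `D e` is the actual direction of the segment from its upper to its lower end, normalized like
  -- `typeSign`. The sum of `G` over the two ends of an edge is, up to a factor, its length minus
  -- its component along the prescribed direction.
  set D : RedEdge hd C → Fin 3 → ℝ := fun e k => Real.sign (τ e) * typeSign (T e) k with hD
  set G : RedEdge hd C × Bool → ℝ := fun p => -endSign p.2 *
    ∑ k, bary k (Z (endVertex hC p.1 p.2)) * (D p.1 k - typeSign p.1.1.type k) with hG
  have hGe : ∀ e, ∑ b, G (e, b) =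
      |τ e| * (2 - Real.sign (τ e) * if T e = e.1.type then 2 else -1) := by
    intro e
    have h1 : ∑ b, G (e, b) = ∑ k, (τ e * typeSign (T e) k) * (D e k - typeSign e.1.type k) := by
      simp only [hG, Fintype.sum_bool, endSign, if_true, Bool.false_eq_true, if_false, hbary]
      simp only [neg_mul, one_mul, neg_neg, ← Finset.sum_neg_distrib, ← Finset.sum_add_distrib]
      exact Finset.sum_congr rfl fun k _ => by ring
    have h2 : ∀ k, (τ e * typeSign (T e) k) * (D e k - typeSign e.1.type k) =
        (τ e * Real.sign (τ e)) * (typeSign (T e) k * typeSign (T e) k) -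
          τ e * (typeSign (T e) k * typeSign e.1.type k) := fun k => by simp only [hD]; ring
    rw [h1, Finset.sum_congr rfl fun k _ => h2 k, Finset.sum_sub_distrib, ← Finset.mul_sum,
      ← Finset.mul_sum, sum_typeSign_mul_typeSign, sum_typeSign_mul_typeSign, if_pos rfl]
    rcases lt_or_gt_of_ne (hτ e) with h3 | h3
    · rw [Real.sign_of_neg h3, abs_of_neg h3]; ring
    · rw [Real.sign_of_pos h3, abs_of_pos h3]; ring
  have hGnonneg : ∀ e, 0 ≤ ∑ b, G (e, b) := by
    intro e
    rw [hGe]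
    refine mul_nonneg (abs_nonneg _) ?_
    rcases Real.sign_apply_eq_of_ne_zero _ (hτ e) with h3 | h3 <;> rw [h3] <;> split_ifs <;> norm_num
  -- At an inner vertex the prescribed directions sum to zero, and so do the actual ones: as corners
  -- have angle `2π/3`, the three segments have distinct types and the same sense.
  have hface : ∀ f : RedFace C, ∑ ℓ, G (redEnds hC (.inl (f, ℓ))) = 0 := by
    intro f
    simp only [redEnds_inl, hG, endVertex_redLeg, redLeg_type]
    rw [← Finset.mul_sum, Finset.sum_comm]
    simp only [← Finset.mul_sum, Finset.sum_sub_distrib, sum_typeSign, sub_zero]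
    have hcorner : ∀ ℓ ℓ', ℓ ≠ ℓ' → T (redLeg hd hC f ℓ) ≠ T (redLeg hd hC f ℓ') ∧
        0 < τ (redLeg hd hC f ℓ) * τ (redLeg hd hC f ℓ') := by
      intro ℓ ℓ' hne
      have hdir : ∀ ℓ, Z (endVertex hC (redLeg hd hC f ℓ) (!f.1.up)) - Z f.vertex =
          ((-endSign f.1.up * τ (redLeg hd hC f ℓ) : ℝ) : ℂ) * typeDir (T (redLeg hd hC f ℓ)) := by
        intro ℓ
        have h1 := hTτ (redLeg hd hC f ℓ)
        have h2 := endVertex_redLeg hd hC f ℓ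
        revert h2
        cases f.1.up <;> intro h2
        · rw [← h2, h1]; simp [endSign]
        · rw [← h2, Bool.not_true, h1]; simp [endSign]
      have hm : ∀ ℓ, s(Z f.vertex, Z (endVertex hC (redLeg hd hC f ℓ) (!f.1.up))) ∈ h.edges :=
        fun ℓ => (hmem _ _).2 ⟨redLeg hd hC f ℓ, f.1.up, by rw [endVertex_redLeg], rfl⟩
      have hZne : Z (endVertex hC (redLeg hd hC f ℓ) (!f.1.up)) ≠
          Z (endVertex hC (redLeg hd hC f ℓ') (!f.1.up)) := by
        intro h0
        have h1 := (endVertex_inj hC (b := f.1.up) (b' := f.1.up)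
          ((endVertex_redLeg hd hC f ℓ).trans (endVertex_redLeg hd hC f ℓ').symm) (hinj h0)).1
        exact hne (by rw [← redLeg_type hd hC f ℓ, h1, redLeg_type])
      have hs0 : -endSign f.1.up ≠ 0 := by cases f.1.up <;> simp [endSign]
      have hs1 : endSign f.1.up * endSign f.1.up = 1 := endSign_mul_self _
      have hfin : ∀ ℓ ℓ', IsAngle (Z (endVertex hC (redLeg hd hC f ℓ) (!f.1.up)) - Z f.vertex)
          (Z (endVertex hC (redLeg hd hC f ℓ') (!f.1.up)) - Z f.vertex) (2 * Real.pi / 3) →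
          T (redLeg hd hC f ℓ) ≠ T (redLeg hd hC f ℓ') ∧
            0 < τ (redLeg hd hC f ℓ) * τ (redLeg hd hC f ℓ') := by
        intro ℓ ℓ' ha
        rw [hdir, hdir] at ha
        obtain ⟨h1, h2⟩ := of_isAngle (mul_ne_zero hs0 (hτ _)) (mul_ne_zero hs0 (hτ _)) ha
        refine ⟨h1, ?_⟩
        have h3 : -endSign f.1.up * τ (redLeg hd hC f ℓ) * (-endSign f.1.up * τ (redLeg hd hC f ℓ')) =
            (endSign f.1.up * endSign f.1.up) *
              (τ (redLeg hd hC f ℓ) * τ (redLeg hd hC f ℓ')) := by ring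
        rwa [h3, hs1, one_mul] at h2
      rcases hh.isHoneycomb.corner _ _ _ (hm ℓ) (hm ℓ') hZne with h1 | h1
      · exact hfin _ _ h1.2
      · obtain ⟨h2, h3⟩ := hfin _ _ h1.2
        exact ⟨h2.symm, by rwa [mul_comm]⟩
    have hTinj : Function.Injective fun ℓ => T (redLeg hd hC f ℓ) := by
      intro ℓ ℓ' h0
      by_contra hne
      exact (hcorner ℓ ℓ' hne).1 h0
    have hsign : ∀ ℓ, Real.sign (τ (redLeg hd hC f ℓ)) = Real.sign (τ (redLeg hd hC f 0)) := by
      intro ℓ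
      by_cases h0 : ℓ = 0
      · rw [h0]
      · have h1 := (hcorner ℓ 0 h0).2
        rcases lt_or_gt_of_ne (hτ (redLeg hd hC f 0)) with h2 | h2
        · rw [Real.sign_of_neg h2, Real.sign_of_neg (by nlinarith)]
        · rw [Real.sign_of_pos h2, Real.sign_of_pos (by nlinarith)]
    have hDsum : ∀ k, ∑ ℓ, D (redLeg hd hC f ℓ) k = 0 := by
      intro k
      simp only [hD, hsign]
      rw [← Finset.mul_sum]
      have hb := Finite.injective_iff_bijective.1 hTinj
      rw [hb.sum_comp fun m => typeSign m k, sum_typeSign, mul_zero]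
    simp only [hDsum, mul_zero, Finset.sum_const_zero]
  have hray : ∀ r, G (redEnds hC (.inr r)) = 0 := by
    intro r
    obtain ⟨i, j⟩ := r
    rw [redEnds_inr]
    -- At a boundary vertex the color determines the type, and the sense is forced because the other
    -- end lies in the triangle.
    suffices hs : T (redRay hd hC (i, j)) = (redRay hd hC (i, j)).1.type ∧
        0 < τ (redRay hd hC (i, j)) by
      simp only [hG, hD, hs.1, Real.sign_of_pos hs.2, one_mul, sub_self, mul_zero,
        Finset.sum_const_zero]
    have hv : Z (bdryVertex C (i, j)) ∈ triangleSide i :=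
      ((ι.bdry_iff i j (bdryVertex C (i, j))).1 rfl).1
    have hvtx := endVertex_redRay hd hC (i, j)
    have hb := hbary (redRay hd hC (i, j))
    have ht0 := hτ (redRay hd hC (i, j))
    have htri : ∀ b, Z (endVertex hC (redRay hd hC (i, j)) b) ∈ triangle := fun b =>
      hh.isHoneycomb.subset (ι.toEquiv _).2
    have hed : ∀ c b, C (redRay hd hC (i, j)).1 = .col c →
        h.HasColor c (Z (endVertex hC (redRay hd hC (i, j)) b))
          (Z (endVertex hC (redRay hd hC (i, j)) (!b))) := fun c b hc =>
      (hasColor_iso_iff hC hh ι hd).2 ⟨_, hc, b, rfl, rfl⟩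
    have htype : ∀ k, bary k (Z (endVertex hC (redRay hd hC (i, j)) true)) =
        bary k (Z (endVertex hC (redRay hd hC (i, j)) false)) → T (redRay hd hC (i, j)) = k := by
      intro k hk
      rw [hb] at hk
      have h1 : typeSign (T (redRay hd hC (i, j))) k = 0 := by
        have : τ (redRay hd hC (i, j)) * typeSign (T (redRay hd hC (i, j))) k = 0 := by linarith
        exact (mul_eq_zero.1 this).resolve_left ht0
      rcases three_cases (T (redRay hd hC (i, j))) k with h2 | h2 | h2
      · exact h2.symm
      · rw [h2, typeSign_one] at h1; norm_num at h1
      · rw [h2, typeSign_two] at h1; norm_num at h1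
    rcases redRay_cases hd hC (i, j) with ⟨h1, h2, h3, h4⟩ | ⟨h1, h2, h3, h4⟩
    · rw [h2] at hvtx
      have hvc := hed _ true h4
      have hTy : T (redRay hd hC (i, j)) = i + 2 := by
        rcases hh.boundary_edge i _ _ hvc.mem (hvtx ▸ hv) with h5 | h5
        · cases hvc.unique h5.1
        · exact htype _ (hasType_iff.1 h5.2)
      refine ⟨hTy.trans h3.symm, ?_⟩
      have h6 := hb i
      have h7 := htri false i
      rw [h6, hvtx, hv.2, hTy, zero_add] at h7
      have h8 : typeSign (i + 2) i = 1 := by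
        conv_lhs => rw [← three_add_two_one i, three_add_two_one i]
        simpa only [three_add_two_one] using typeSign_one (i + 2)
      rw [h8, mul_one] at h7
      exact lt_of_le_of_ne h7 (Ne.symm ht0)
    · rw [h2] at hvtx
      have hvc := hed _ false h4
      have hTy : T (redRay hd hC (i, j)) = i + 1 := by
        rcases hh.boundary_edge i _ _ hvc.mem (hvtx ▸ hv) with h5 | h5
        · exact htype _ (hasType_iff.1 h5.2).symm
        · cases hvc.unique h5.1
      refine ⟨hTy.trans h3.symm, ?_⟩
      have h6 := hb i
      have h7 := htri true i
      rw [hvtx, hv.2, hTy] at h6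
      have h8 : typeSign (i + 1) i = -1 := by
        simpa only [three_add_one_two] using typeSign_two (i + 1)
      rw [h8] at h6
      exact lt_of_le_of_ne (by linarith) (Ne.symm ht0)
  have hsum : ∑ e, ∑ b, G (e, b) = 0 := by
    rw [← Fintype.sum_prod_type', ← (redEnds hC (hd := hd)).sum_comp, Fintype.sum_sum_type,
      Fintype.sum_prod_type]
    simp only [hface, hray, Finset.sum_const_zero, add_zero]
  have hzero := (Finset.sum_eq_zero_iff_of_nonneg fun e _ => hGnonneg e).1 hsum
  have hfin : ∀ e, T e = e.1.type ∧ 0 < τ e := by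
    intro e
    have h1 := hzero e (Finset.mem_univ e)
    rw [hGe] at h1
    have h2 := (mul_eq_zero.1 h1).resolve_left (abs_ne_zero.2 (hτ e))
    rcases lt_or_gt_of_ne (hτ e) with h3 | h3
    · rw [Real.sign_of_neg h3] at h2
      split_ifs at h2 <;> norm_num at h2
    · rw [Real.sign_of_pos h3] at h2
      split_ifs at h2 with h4
      · exact ⟨h4, h3⟩
      · norm_num at h2
  refine ⟨hinj, hmem, fun e => ?_, fun e => ?_⟩
  · have := hbary e e.1.type
    rw [(hfin e).1, typeSign_self, mul_zero, add_zero] at this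
    exact this
  · have := hbary e (e.1.type + 1)
    rw [(hfin e).1, typeSign_one, mul_one] at this
    change bary _ (Z _) < bary _ (Z _)
    rw [this]
    linarith [(hfin e).2]

end

/-! ### The flow of a honeycomb lies in the cone. -/

section

variable {n d : ℕ} {hd : d ≤ n} {C : HexEdge n d → HiveColor} {hC : IsColorMap C}
  {h : ColoredSegments}

/-- The number of values larger than the value of index `j` is `j`. -/
theorem ncard_lt_of_strictAnti {θ : Fin n → ℝ} (hθ : StrictAnti θ) (j : Fin n) :
    {k : Fin n | θ j < θ k}.ncard = j := by
  have : {k : Fin n | θ j < θ k} = ↑(Finset.Iio j) := by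
    ext k
    simp [hθ.lt_iff_gt]
  rw [this, Set.ncard_coe_finset, Fin.card_Iio]

theorem bary_injOn_side (i : Fin 3) : Set.InjOn (bary (i + 1)) (triangleSide i) := by
  intro z hz w hw hzw
  exact bary_ext_two i (hz.2.trans hw.2.symm) hzw

/-- The points of a side of the triangle whose coordinate is larger than a given boundary value. -/
theorem ncard_support_lt {S : Set ℂ} {i : Fin 3} {θ : Fin n → ℝ} (hθ : StrictAnti θ)
    (hS : S ⊆ triangleSide i) (himg : bary (i + 1) '' S = Set.range θ) {v : ℂ} {j : Fin n}
    (hv : bary (i + 1) v = θ j) : {z ∈ S | bary (i + 1) v < bary (i + 1) z}.ncard = j := by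
  rw [← ncard_lt_of_strictAnti hθ j, ← Set.ncard_image_of_injective _ hθ.injective,
    ← ((bary_injOn_side i).mono fun z (hz : z ∈ {z ∈ S | _}) => hS hz.1).ncard_image]
  congr 1
  ext x
  constructor
  · rintro ⟨z, ⟨hz, hlt⟩, rfl⟩
    obtain ⟨k, hk⟩ : bary (i + 1) z ∈ Set.range θ := himg ▸ ⟨z, hz, rfl⟩
    exact ⟨k, by rw [Set.mem_ofPred_eq, ← hv, hk]; exact hlt, hk⟩
  · rintro ⟨k, hk, rfl⟩
    obtain ⟨z, hz, hzk⟩ : θ k ∈ bary (i + 1) '' S := himg ▸ ⟨k, rfl⟩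
    exact ⟨z, ⟨hz, by rw [hv, hzk]; exact hk⟩, hzk⟩

theorem infinite_segment {a b : ℂ} (hab : a ≠ b) : (segment ℝ a b).Infinite := by
  rw [segment_eq_image_lineMap]
  refine Set.Infinite.image (AffineMap.lineMap_injective ℝ hab).injOn ?_
  exact Set.Icc_infinite zero_lt_one

theorem bary_segment {k : Fin 3} {a b z : ℂ} (hz : z ∈ segment ℝ a b) :
    ∃ s t : ℝ, 0 ≤ s ∧ 0 ≤ t ∧ s + t = 1 ∧ s • a + t • b = z ∧
      bary k z = s * bary k a + t * bary k b := by
  obtain ⟨s, t, hs, ht, hst, rfl⟩ := hz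
  exact ⟨s, t, hs, ht, hst, rfl, bary_convex k a b hst⟩

/-- The heights of the edges of a triangular honeycomb are positive. -/
theorem height_pos_of_isTriangular (hn : 0 < n) (hh : h.IsTriangular n) {a b : ℂ} {ℓ : Fin 3}
    (hab : s(a, b) ∈ h.edges) (ht : bary ℓ a = bary ℓ b) : 0 < bary ℓ a := by
  have ha := hh.isHoneycomb.subset (ColoredSegments.mem_vertices_left hab)
  have hb := hh.isHoneycomb.subset (ColoredSegments.mem_vertices_right hab)
  refine lt_of_le_of_ne (ha ℓ) fun h0 => ?_
  have hsub : segment ℝ a b ⊆ h.support ∩ triangleSide ℓ := by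
    intro z hz
    refine ⟨⟨a, b, hab, hz⟩, fun k => ?_, ?_⟩
    · obtain ⟨s, t, hs, ht, -, -, hk⟩ := bary_segment (k := k) hz
      rw [hk]
      exact add_nonneg (mul_nonneg hs (ha k)) (mul_nonneg ht (hb k))
    · obtain ⟨s, t, -, -, -, -, hk⟩ := bary_segment (k := ℓ) hz
      rw [hk, ← ht, ← h0]; ring
  have hinf := (infinite_segment (hh.isHoneycomb.nontrivial _ hab)).mono hsub
  -- The `ncard` of an infinite set is `0`, which contradicts `0 < n`.
  have := hh.card_side ℓ
  rw [hinf.ncard] at this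
  omega

/-- The flow of a drawing with the given boundary values satisfies the divergence condition and
lies in the cone. -/
theorem IsDrawing.flow_mem {Z : ReducedVertex C → ℂ} (hZ : IsDrawing hd hC h Z)
    {α β γ : Fin n → ℝ}
    (hpos : ∀ e : RedEdge hd C, 0 < bary e.1.type (Z (endVertex hC e true)))
    (hside : ∀ i j, bary i (Z (bdryVertex C (i, j))) = 0)
    (hval : ∀ i j, bary (i + 1) (Z (bdryVertex C (i, j))) = ![β, α, γ] i j)
    {ω : (reducedGraph C).graph.Dart → ℝ} (hω : ω = fun p => h.flow (Z p.fst) (Z p.snd)) :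
    ω ∈ divergenceSpace (reducedGraph C).graph (flowDivergence C α β γ) ∩ flowCone C := by
  have hdart : ∀ (e : RedEdge hd C) b, ω (dartOf hC e b) = endSign b * bary e.1.type (Z (endVertex hC e true)) := by
    intro e b
    rw [hω]
    exact hZ.flow_eq e b
  have hanti : ω ∈ flowSpace (reducedGraph C).graph := by
    intro p
    obtain ⟨e, b, rfl⟩ := exists_dartOf hC hd p
    rw [dartOf_symm, hdart, hdart]
    cases b <;> simp [endSign]
  refine ⟨⟨hanti, fun v => ?_⟩, hanti, fun p => ?_, fun p p' hpp => ?_⟩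
  · rcases reducedVertex_cases v with ⟨f, rfl⟩ | ⟨⟨i, j⟩, rfl⟩
    · rw [divergence_face hC hd]
      simp only [hdart]
      rw [← Finset.mul_sum]
      have : ∀ ℓ, bary (redLeg hd hC f ℓ).1.type (Z (endVertex hC (redLeg hd hC f ℓ) true)) =
          bary ℓ (Z f.vertex) := by
        intro ℓ
        rw [redLeg_type, hZ.flow_leg]
      rw [Finset.sum_congr rfl fun ℓ _ => this ℓ, bary_sum_univ, mul_one]
      exact (reducedSign_eq f.vertex).symm
    · rw [divergence_bdry hC hd, hdart]
      have h1 := hZ.height_end (redRay hd hC (i, j)) (decide ((j : ℕ) < d))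
      rw [endVertex_redRay hd hC (i, j)] at h1
      rw [← h1]
      have h2 := bary_sum i (Z (bdryVertex C (i, j)))
      have h3 := hside i j
      have h4 := hval i j
      simp only [bdryVertex, flowDivergence] at h2 h3 h4 ⊢
      rcases redRay_cases hd hC (i, j) with ⟨h5, h6, h7, -⟩ | ⟨h5, h6, h7, -⟩
      · rw [h6, h7, if_pos h5, endSign, if_pos rfl]; linarith
      · rw [h6, h7, if_neg h5, endSign, if_neg (by simp), h4]; ring
  · obtain ⟨e, b, rfl⟩ := exists_dartOf hC hd p
    rw [hdart]
    change 0 < reducedSign C (endVertex hC e b) * _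
    rw [reducedSign_endVertex, ← mul_assoc, endSign_mul_self, one_mul]
    exact hpos e
  -- The edge `e₁` of type `ℓ + 1` leads from the line of `e'` to the line of `e`, and along it the
  -- coordinate of index `ℓ` drops by its length.
  · obtain ⟨e, e', e₁, f, f', ht, ht₁, rfl, rfl, -, -, h1, h2⟩ := (covers_iff hC hd).1 hpp
    have ha : ∀ e : RedEdge hd C, |ω (dartOf hC e true)| =
        bary e.1.type (Z (endVertex hC e true)) := by
      intro e
      rw [hdart, endSign, if_pos rfl, one_mul, abs_of_pos (hpos e)]
    rw [ha, ha, ht, ← hZ.height_eq e, ← h1, ← h2, hZ.bary_lower e₁, ht₁]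
    have h3 : typeSign (e.1.type + 1) e.1.type = -1 := by
      simpa only [three_add_one_two] using typeSign_two (e.1.type + 1)
    rw [h3]
    linarith [hZ.length_pos e₁]

theorem flow_mem_of_honeycomb (hn : 0 < n) (hd : d ≤ n) (hC : IsColorMap C) {α β γ : Fin n → ℝ}
    (hα : IsRegularClass α) (hβ : IsRegularClass β) (hγ : IsRegularClass γ)
    {ω : (reducedGraph C).graph.Dart → ℝ} (hω : ω ∈ honeycombFlows C α β γ) :
    ω ∈ divergenceSpace (reducedGraph C).graph (flowDivergence C α β γ) ∩ flowCone C := by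
  obtain ⟨h, ⟨hh, -, himg⟩, ι, rfl⟩ := hω
  have hZ := isDrawing_iso hC hh ι hd
  have hanti : ∀ i, StrictAnti (![β, α, γ] i) := by
    intro i
    fin_cases i
    exacts [hβ.1, hα.1, hγ.1]
  have hb : ∀ i j, (ι.toEquiv (bdryVertex C (i, j)) : ℂ) ∈ triangleSide i ∧
      bary (i + 1) (ι.toEquiv (bdryVertex C (i, j)) : ℂ) = ![β, α, γ] i j := by
    intro i j
    obtain ⟨h1, h2⟩ := (ι.bdry_iff i j (bdryVertex C (i, j))).1 rfl
    refine ⟨h1, ?_⟩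
    have h3 : (ι.toEquiv (bdryVertex C (i, j)) : ℂ) ∈ h.support ∩ triangleSide i :=
      ⟨ColoredSegments.vertices_subset_support (ι.toEquiv _).2, h1⟩
    obtain ⟨k, hk⟩ : bary (i + 1) (ι.toEquiv (bdryVertex C (i, j)) : ℂ) ∈
      Set.range (![β, α, γ] i) := himg i ▸ ⟨_, h3, rfl⟩
    -- Both the index of the boundary value and the index of the vertex count the points of the side
    -- with larger coordinate.
    have h4 := ncard_support_lt (hanti i) Set.inter_subset_right (himg i) hk.symm
    rw [← hk]
    rw [Fin.ext (h4.symm.trans h2)]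
  refine hZ.flow_mem (fun e => ?_) (fun i j => (hb i j).1.2) (fun i j => (hb i j).2) rfl
  exact height_pos_of_isTriangular hn hh ((hZ.mem_edges _ _).2 ⟨e, true, rfl, rfl⟩)
    (hZ.height_eq e).symm

end

/-! ## The honeycomb of a flow -/

section

variable {n d : ℕ} (hd : d ≤ n) {C : HexEdge n d → HiveColor} (hC : IsColorMap C)

/-- Heights of the edges of the reduced graph with boundary values `θ`, such that the heights at a
vertex have sum `1`, and edges have positive length. -/
structure IsHeight (θ : Fin 3 → Fin n → ℝ) (L : RedEdge hd C → ℝ) : Prop where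
  pos : ∀ e : RedEdge hd C, 0 < L e
  sum : ∀ f : RedFace C, ∑ ℓ, L (redLeg hd hC f ℓ) = 1
  ray : ∀ i (j : Fin n), L (redRay hd hC (i, j)) = if (j : ℕ) < d then 1 - θ i j else θ i j
  lt : ∀ (e : RedEdge hd C) (f g : RedFace C), endVertex hC e true = RedFace.vertex f → endVertex hC e false = RedFace.vertex g →
    L (redLeg hd hC g (e.1.type + 2)) < L (redLeg hd hC f (e.1.type + 2))

/-- The edges at a given vertex all have the same sign there, so the divergence turns into the sum
of heights at an inner vertex and into the boundary values. The field `lt` is the cover relation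
with `e` as middle edge, between the legs of type `e.type + 2` at its two ends: `e` has the type
following theirs. -/
theorem isHeight_of_flow {α β γ : Fin n → ℝ} {ω : (reducedGraph C).graph.Dart → ℝ}
    (hω : ω ∈ divergenceSpace (reducedGraph C).graph (flowDivergence C α β γ) ∩ flowCone C) :
    IsHeight hd hC ![β, α, γ] (fun e => ω (dartOf hC e true)) ∧
      ∀ (e : RedEdge hd C) b, ω (dartOf hC e b) = endSign b * ω (dartOf hC e true) := by
  obtain ⟨⟨hanti, hdiv⟩, -, hpos, hcov⟩ := hω
  have hsign : ∀ (e : RedEdge hd C) b,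
      ω (dartOf hC e b) = endSign b * ω (dartOf hC e true) := by
    intro e b
    cases b
    · have := hanti (dartOf hC e true)
      rw [dartOf_symm] at this
      change ω (dartOf hC e (!true)) = _
      rw [this]; simp [endSign]
    · simp [endSign]
  have hp : ∀ e : RedEdge hd C, 0 < ω (dartOf hC e true) := by
    intro e
    have := hpos (dartOf hC e true)
    change 0 < reducedSign C (endVertex hC e true) * _ at this
    rw [reducedSign_endVertex] at this
    simpa [endSign] using this
  refine ⟨⟨hp, ?_, ?_, ?_⟩, hsign⟩
  · intro f
    have h1 := hdiv f.vertex
    rw [divergence_face hC hd] at h1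
    simp only [hsign _ f.1.up] at h1
    rw [← Finset.mul_sum] at h1
    have h2 : flowDivergence C α β γ f.vertex = endSign f.1.up := reducedSign_eq f.vertex
    rw [h2] at h1
    have h3 := endSign_mul_self f.1.up
    have h4 : endSign f.1.up ≠ 0 := fun h0 => by rw [h0] at h3; norm_num at h3
    exact mul_left_cancel₀ h4 (by rw [h1, mul_one])
  · intro i j
    have h1 := hdiv (bdryVertex C (i, j))
    rw [divergence_bdry hC hd, hsign] at h1
    simp only [bdryVertex, flowDivergence] at h1
    by_cases h : (j : ℕ) < d
    · simp only [h, decide_true, endSign, if_true] at h1 ⊢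
      linarith
    · simp only [h, decide_false, endSign, if_false, Bool.false_eq_true] at h1 ⊢
      linarith
  · intro e f g hf hg
    have hgu : g.1.up = false := by
      rw [← isUp_endVertex hC e false, hg]; rfl
    have hfu : f.1.up = true := by
      rw [← isUp_endVertex hC e true, hf]; rfl
    have h1 := endVertex_redLeg hd hC g (e.1.type + 2)
    have h2 := endVertex_redLeg hd hC f (e.1.type + 2)
    rw [hgu] at h1
    rw [hfu] at h2
    have h3 := hcov (dartOf hC (redLeg hd hC g (e.1.type + 2)) true)
      (dartOf hC (redLeg hd hC f (e.1.type + 2)) true)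
      ((covers_iff hC hd).2 ⟨_, _, e, g.1, f.1, by rw [redLeg_type, redLeg_type],
        by rw [redLeg_type, three_add_two_one], rfl, rfl, by rw [h1]; rfl, by rw [h2]; rfl,
        by rw [h1, hg], by rw [h2, hf]⟩)
    rwa [abs_of_pos (hp _), abs_of_pos (hp _)] at h3

variable {θ : Fin 3 → Fin n → ℝ} {L : RedEdge hd C → ℝ}

variable {hd hC} in
/-- The system of the edges of the reduced graph, with given heights. -/
noncomputable def IsHeight.system (hL : IsHeight hd hC θ L) :
    EdgeSystem (RedFace C) (Fin 3 × Fin n) (RedEdge hd C) where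
  ends := redEnds hC
  type := fun e => e.1.type
  up := fun f => f.1.up
  upRay := fun r => decide ((r.2 : ℕ) < d)
  weight := fun e e' => colorWeight (C e.1) e.1.type (C e'.1) e'.1.type
  hgt := L
  pos := fun f ℓ => L (redLeg hd hC f ℓ)
  type_ends := fun f ℓ => redLeg_type hd hC f ℓ
  ends_up := fun f ℓ => by rw [redEnds_inl]
  ends_upRay := fun r => by rw [redEnds_inr]
  weight_swap := fun e e' => by
    rw [colorWeight_swap]; push_cast; rfl
  sum_weight := fun f e' => by
    have h1 := sum_colorWeight hC f.1 (C e'.1) e'.1.type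
    have h2 : ∀ ℓ, colorWeight (C (redLeg hd hC f ℓ).1) (redLeg hd hC f ℓ).1.type (C e'.1)
        e'.1.type = colorWeight (C (f.1.edge ℓ)) ℓ (C e'.1) e'.1.type := fun ℓ => by
      rw [redLeg_color hd hC, redLeg_type]
    rw [← Finset.sum_congr rfl fun ℓ _ => h2 ℓ] at h1
    exact_mod_cast h1
  weight_ray := fun r r' ht hu => by
    change (redRay hd hC r).1.type = (redRay hd hC r').1.type at ht
    change ((colorWeight (C (redRay hd hC r).1) (redRay hd hC r).1.type
      (C (redRay hd hC r').1) (redRay hd hC r').1.type : ℤ) : ℝ) = 0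
    have h3 : C (redRay hd hC r).1 = C (redRay hd hC r').1 := by
      rw [redRay_color hd hC, redRay_color hd hC, hC.color_outerEdge, hC.color_outerEdge]
      simp only [decide_eq_decide] at hu
      simp only [hu]
    rw [ht, h3, colorWeight_self, Int.cast_zero]
  pos_eq := fun f ℓ => rfl
  sum_pos := fun f g => by rw [hL.sum, hL.sum]

variable {hd hC} (hL : IsHeight hd hC θ L)

namespace IsHeight

theorem pos_lt (hL : IsHeight hd hC θ L) (f : RedFace C) (ℓ : Fin 3) :
    L (redLeg hd hC f ℓ) < 1 := by
  have h1 := hL.sum f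
  rw [three_sum ℓ] at h1
  have := hL.pos (redLeg hd hC f (ℓ + 1))
  have := hL.pos (redLeg hd hC f (ℓ + 2))
  linarith

theorem system_fin_inl {e : RedEdge hd C} {b : Bool} {f : RedFace C}
    (h : endVertex hC e b = f.vertex) : hL.system.fin e b = .inl (f, e.1.type) := by
  obtain ⟨h1, h2⟩ := eq_redLeg hC h
  change (redEnds hC).symm (e, b) = _
  rw [Equiv.symm_apply_eq, redEnds_inl, ← h1, ← h2]

theorem system_fin_inr {e : RedEdge hd C} {b : Bool} {r : Fin 3 × Fin n}
    (h : endVertex hC e b = bdryVertex C r) : hL.system.fin e b = .inr r := by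
  obtain ⟨h1, h2⟩ := eq_redRay hC h
  change (redEnds hC).symm (e, b) = _
  rw [Equiv.symm_apply_eq, redEnds_inr, ← h1, ← h2]

theorem endVertex_of_fin {e : RedEdge hd C} {b : Bool} {f : RedFace C} {ℓ : Fin 3}
    (h : hL.system.fin e b = .inl (f, ℓ)) : endVertex hC e b = f.vertex := by
  change (redEnds hC).symm (e, b) = _ at h
  rw [endVertex_eq, h]; rfl

/-- The coordinate of index `type e` agrees at both ends and all sums are `1`, so the inequality
`lt` at index `+ 2` becomes the opposite one at index `+ 1`. -/
theorem system_directed : hL.system.Directed := by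
  intro e f g ℓ ℓ' hf hg
  have hf' := hL.endVertex_of_fin hf
  have hg' := hL.endVertex_of_fin hg
  have h1 := hL.lt e f g hf' hg'
  have h2 := hL.sum f
  have h3 := hL.sum g
  have h4 := hL.system.pos_eq_hgt hf
  have h5 := hL.system.pos_eq_hgt hg
  rw [three_sum e.1.type] at h2 h3
  change L (redLeg hd hC f e.1.type) = L e at h4
  change L (redLeg hd hC g e.1.type) = L e at h5
  change L (redLeg hd hC f (e.1.type + 1)) < L (redLeg hd hC g (e.1.type + 1))
  linarith

theorem system_typeSign_mul (e e' : RedEdge hd C) :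
    typeSign (hL.system.type e) (hL.system.type e') * hL.system.weight e e' =
      ((typeSignInt e.1.type e'.1.type * colorWeight (C e.1) e.1.type (C e'.1) e'.1.type : ℤ) : ℝ) := by
  rw [Int.cast_mul, typeSignInt_cast]; rfl

/-- The rays have the types, colors and directions of the boundary edges of the hexagon, so
`rayConst_hex` gives their contribution. Only reduced faces count in it, each with area `2`, and
these are the vertices of the present system. -/
theorem system_eq_zero :
    (∀ e e', typeSign (hL.system.type e) (hL.system.type e') * hL.system.weight e e' = 0 ∨
      hL.system.meet e e' = hL.system.inc e e') ∧
    ∀ v v', v ≠ v' → hL.system.pos v = hL.system.pos v' → ∀ ℓ ℓ',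
      typeSign ℓ ℓ' * hL.system.weight (hL.system.leg v ℓ) (hL.system.leg v' ℓ') = 0 := by
  classical
  have : Fintype (HexFace n d) := Fintype.ofFinite _
  have : Fintype (HexEdge n d) := Fintype.ofFinite _
  have : Fintype (RedEdge hd C) := Fintype.ofFinite _
  have : Fintype (RedFace C) := Fintype.ofFinite _
  refine hL.system_directed.eq_zero (fun e e' => ?_) ?_
  · rw [system_typeSign_mul]
    exact_mod_cast colorWeight_nonneg _ _ _ _ e.2.1 e'.2.1
  · have h1 := rayConst_hex hd hC
    have ht : (fun r => hL.system.type (hL.system.ray r)) =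
        fun r : Fin 3 × Fin n => (outerEdge hd r.1 r.2).type := funext fun r => redRay_type hd hC r
    have hw : (fun r r' => hL.system.weight (hL.system.ray r) (hL.system.ray r')) =
        fun r r' => (colorWeight (C (outerEdge hd r.1 r.2)) (outerEdge hd r.1 r.2).type
        (C (outerEdge hd r'.1 r'.2)) (outerEdge hd r'.1 r'.2).type : ℝ) := by
      funext r r'
      change ((colorWeight (C (redRay hd hC r).1) (redRay hd hC r).1.type
        (C (redRay hd hC r').1) (redRay hd hC r').1.type : ℤ) : ℝ) = _
      simp only [redRay_type, redRay_color hd hC]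
    have harea : ∀ f, hL.system.area f f = 2 := by
      intro f
      have h2 := colorWeight_area hC f.1
      rw [if_pos f.2] at h2
      change ((colorWeight (C (redLeg hd hC f 0).1) (redLeg hd hC f 0).1.type
        (C (redLeg hd hC f 1).1) (redLeg hd hC f 1).1.type : ℤ) : ℝ) -
        ((colorWeight (C (redLeg hd hC f 1).1) (redLeg hd hC f 1).1.type
        (C (redLeg hd hC f 0).1) (redLeg hd hC f 0).1.type : ℤ) : ℝ) = 2
      simp only [redLeg_color hd hC, redLeg_type]
      exact_mod_cast h2
    rw [ht, hw]
    refine Eq.trans h1 ?_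
    congr 1
    simp only [harea, Finset.sum_ite, Finset.sum_const_zero, add_zero, Finset.sum_const,
      Finset.card_univ, Fintype.card_subtype]

/-- If `v` and `v'` coincided, the leg of type `1` at `v'` would need color `0` to have weight `0`
with the leg of type `0` at `v`, and color `1` for the leg of type `2`. -/
theorem system_pos_injective : Function.Injective hL.system.pos := by
  intro v v' h
  by_contra hne
  have h1 := hL.system_eq_zero.2 v v' hne h
  have key : ∀ ℓ ℓ', typeSign ℓ ℓ' ≠ 0 → colorWeight (C (redLeg hd hC v ℓ).1) ℓ
      (C (redLeg hd hC v' ℓ').1) ℓ' = 0 := by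
    intro ℓ ℓ' h0
    have h2 := (mul_eq_zero.1 (h1 ℓ ℓ')).resolve_left h0
    change ((colorWeight (C (redLeg hd hC v ℓ).1) (redLeg hd hC v ℓ).1.type
        (C (redLeg hd hC v' ℓ').1) (redLeg hd hC v' ℓ').1.type : ℤ) : ℝ) = 0 at h2
    rw [redLeg_type, redLeg_type] at h2
    exact_mod_cast h2
  have c1 := colorWeight_eq_zero _ _ 0 (redLeg hd hC v 0).2.1 (redLeg hd hC v' (0 + 1)).2.1
    (key 0 (0 + 1) (by rw [typeSign_one]; norm_num))
  have c2 := colorWeight_eq_zero _ _ (0 + 1) (redLeg hd hC v' (0 + 1)).2.1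
    (redLeg hd hC v (0 + 1 + 1)).2.1 (by
      rw [colorWeight_swap, key (0 + 1 + 1) (0 + 1) (by
        rw [typeSign_swap (0 + 1), typeSign_one]; norm_num), neg_zero])
  rw [c1.2] at c2
  cases c2.1

/-- The coordinates of the vertices. -/
noncomputable def coords (_ : IsHeight hd hC θ L) : ReducedVertex C → Fin 3 → ℝ
  | ⟨.inl f, hf⟩ => fun ℓ => L (redLeg hd hC ⟨f, hf⟩ ℓ)
  | ⟨.inr (i, j), _⟩ => tri i 0 (θ i j) (1 - θ i j)

/-- The position of the vertices in the plane. -/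
noncomputable def place (x : ReducedVertex C) : ℂ := ofBary (hL.coords x)

theorem bary_place_face (f : RedFace C) (ℓ : Fin 3) :
    bary ℓ (hL.place f.vertex) = L (redLeg hd hC f ℓ) :=
  bary_ofBary (hL.sum f) ℓ

theorem bary_place_bdry (i : Fin 3) (j : Fin n) :
    bary i (hL.place (bdryVertex C (i, j))) = 0 ∧
    bary (i + 1) (hL.place (bdryVertex C (i, j))) = θ i j ∧
    bary (i + 2) (hL.place (bdryVertex C (i, j))) = 1 - θ i j := by
  have h1 : ∀ k, bary k (hL.place (bdryVertex C (i, j))) = tri i 0 (θ i j) (1 - θ i j) k := by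
    refine bary_ofBary ?_
    change ∑ k, tri i 0 (θ i j) (1 - θ i j) k = 1
    rw [three_sum i, tri_zero, tri_one, tri_two]; ring
  rw [h1, h1, h1, tri_zero, tri_one, tri_two]
  simp

theorem height_lt_one (hL : IsHeight hd hC θ L) (e : RedEdge hd C) : L e < 1 := by
  rcases reducedVertex_cases (endVertex hC e true) with ⟨f, hf⟩ | ⟨r, hr⟩
  · rw [(eq_redLeg hC hf).1]; exact hL.pos_lt _ _
  · obtain ⟨f, hf⟩ := exists_face_of_bdry hC hr
    rw [(eq_redLeg hC hf).1]; exact hL.pos_lt _ _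

/-- The height of a boundary edge is `θ i j` or `1 - θ i j`, and every height lies strictly between
`0` and `1` because every edge has an inner end. -/
theorem boundary_mem (hL : IsHeight hd hC θ L) (i : Fin 3) (j : Fin n) : 0 < θ i j ∧ θ i j < 1 := by
  have h1 := hL.ray i j
  have h2 := hL.pos (redRay hd hC (i, j))
  have h3 := hL.height_lt_one (redRay hd hC (i, j))
  split_ifs at h1 <;> constructor <;> linarith

theorem bary_place_height (e : RedEdge hd C) (b : Bool) :
    bary e.1.type (hL.place (endVertex hC e b)) = L e := by
  rcases reducedVertex_cases (endVertex hC e b) with ⟨f, hf⟩ | ⟨⟨i, j⟩, hr⟩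
  · rw [hf, bary_place_face, ← (eq_redLeg hC hf).1]
  · have h1 := eq_redRay hC hr
    have h2 := hL.ray i j
    have h3 := hL.bary_place_bdry i j
    have h4 := redRay_cases hd hC (i, j)
    rw [← h1.1] at h2 h4
    rw [hr]
    rcases h4 with ⟨h4, -, h5, -⟩ | ⟨h4, -, h5, -⟩
    · rw [h5, h2, h3.2.2, if_pos h4]
    · rw [h5, h2, h3.2.1, if_neg h4]

theorem bary_place_nonneg (x : ReducedVertex C) (k : Fin 3) : 0 ≤ bary k (hL.place x) := by
  rcases reducedVertex_cases x with ⟨f, rfl⟩ | ⟨⟨i, j⟩, rfl⟩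
  · rw [bary_place_face]; exact (hL.pos _).le
  · have h1 := hL.boundary_mem i j
    have h2 := hL.bary_place_bdry i j
    rcases three_cases i k with rfl | rfl | rfl
    · rw [h2.1]
    · rw [h2.2.1]; exact h1.1.le
    · rw [h2.2.2]; linarith

theorem bary_place_eq_zero {x : ReducedVertex C} {i : Fin 3} (h : bary i (hL.place x) = 0) :
    ∃ j, x = bdryVertex C (i, j) := by
  rcases reducedVertex_cases x with ⟨f, rfl⟩ | ⟨⟨k, j⟩, rfl⟩
  · rw [bary_place_face] at h
    exact absurd h (hL.pos _).ne'
  · have h1 := hL.boundary_mem k j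
    have h2 := hL.bary_place_bdry k j
    rcases three_cases k i with rfl | rfl | rfl
    · exact ⟨j, rfl⟩
    · rw [h2.2.1] at h; linarith
    · rw [h2.2.2] at h; linarith

/-- Between inner vertices this is `system_directed`. At a boundary vertex, use the coordinate that
vanishes there and is positive at the inner end. -/
theorem place_lt (e : RedEdge hd C) : bary (e.1.type + 1) (hL.place (endVertex hC e true)) <
    bary (e.1.type + 1) (hL.place (endVertex hC e false)) := by
  rcases reducedVertex_cases (endVertex hC e true) with ⟨f, hf⟩ | ⟨⟨i, j⟩, hr⟩
  · rcases reducedVertex_cases (endVertex hC e false) with ⟨g, hg⟩ | ⟨⟨i, j⟩, hr⟩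
    · rw [hf, hg, bary_place_face, bary_place_face]
      exact hL.system_directed e f g _ _ (hL.system_fin_inl hf) (hL.system_fin_inl hg)
    · have h1 := eq_redRay hC hr
      have h4 := redRay_cases hd hC (i, j)
      rw [← h1.1, ← h1.2] at h4
      rcases h4 with ⟨-, h4, -⟩ | ⟨h3, -, h4, -⟩
      · cases h4
      · have h5 := hL.bary_place_height e true
        have h6 := hL.bary_place_height e false
        have h7 := bary_sum e.1.type (hL.place (endVertex hC e true))
        have h8 := bary_sum e.1.type (hL.place (endVertex hC e false))
        have h9 := (hL.bary_place_bdry i j).1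
        have h10 := hL.pos (redLeg hd hC f (e.1.type + 2))
        rw [← bary_place_face hL, ← hf] at h10
        have h11 : i = e.1.type + 2 := by rw [h4, three_add_one_two]
        rw [← hr] at h9
        rw [← h11] at h7 h8 h10
        linarith
  · have h1 := eq_redRay hC hr
    have h4 := redRay_cases hd hC (i, j)
    rw [← h1.1, ← h1.2] at h4
    obtain ⟨f, hf⟩ := exists_face_of_bdry hC hr
    rcases h4 with ⟨-, -, h4, -⟩ | ⟨-, h4, -⟩
    · have h9 := (hL.bary_place_bdry i j).1
      have h10 := hL.pos (redLeg hd hC f (e.1.type + 1))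
      rw [← bary_place_face hL, ← hf] at h10
      have h11 : i = e.1.type + 1 := by rw [h4, three_add_two_one]
      rw [← hr] at h9
      rw [← h11] at h10 ⊢
      rw [h9]
      exact h10
    · cases h4

theorem place_injective (hθ : ∀ i, Function.Injective (θ i)) : Function.Injective hL.place := by
  intro x y h
  rcases reducedVertex_cases x with ⟨f, rfl⟩ | ⟨⟨i, j⟩, rfl⟩
  · rcases reducedVertex_cases y with ⟨g, rfl⟩ | ⟨⟨i', j'⟩, rfl⟩
    · congr 1
      refine hL.system_pos_injective (funext fun ℓ => ?_)
      have := congrArg (bary ℓ) h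
      rwa [bary_place_face, bary_place_face] at this
    · have h1 := (hL.bary_place_bdry i' j').1
      rw [← h] at h1
      obtain ⟨j, hj⟩ := hL.bary_place_eq_zero h1
      exact absurd hj (f.vertex_ne _)
  · have h1 := hL.bary_place_bdry i j
    rw [h] at h1
    obtain ⟨j', rfl⟩ := hL.bary_place_eq_zero h1.1
    rw [(hL.bary_place_bdry i j').2.1] at h1
    rw [hθ i h1.2.1]

end IsHeight

/-- The color of an edge of the reduced graph. -/
noncomputable def redColor (e : RedEdge hd C) : EdgeColor := (exists_color e.2.1).choose

theorem redColor_spec (e : RedEdge hd C) : C e.1 = .col (redColor e) :=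
  (exists_color e.2.1).choose_spec

open Classical in
/-- The set of colored segments defined by positions of the vertices. -/
noncomputable def drawSegments (hd : d ≤ n) (hC : IsColorMap C) (Z : ReducedVertex C → ℂ) :
    ColoredSegments where
  edges := (Set.toFinite (Set.range fun e : RedEdge hd C =>
    s(Z (endVertex hC e true), Z (endVertex hC e false)))).toFinset
  color := fun p => redColor ((Set.Finite.mem_toFinset _).1 p.2).choose

theorem mem_drawSegments {Z : ReducedVertex C → ℂ} {a b : ℂ} :
    s(a, b) ∈ (drawSegments hd hC Z).edges ↔ ∃ (e : RedEdge hd C) (b' : Bool),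
      Z (endVertex hC e b') = a ∧ Z (endVertex hC e (!b')) = b := by
  simp only [drawSegments, Set.Finite.mem_toFinset, Set.mem_range]
  constructor
  · rintro ⟨e, he⟩
    rcases Sym2.eq_iff.1 he with ⟨h1, h2⟩ | ⟨h1, h2⟩
    · exact ⟨e, true, h1, h2⟩
    · exact ⟨e, false, h2, h1⟩
  · rintro ⟨e, b', rfl, rfl⟩
    cases b'
    · exact ⟨e, Sym2.eq_swap⟩
    · exact ⟨e, rfl⟩

/-- The color of a segment is that of a chosen edge drawn as this segment; injectivity of `Z` makes
the choice unique. -/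
theorem hasColor_drawSegments {Z : ReducedVertex C → ℂ} (hZ : Function.Injective Z)
    {c : EdgeColor} {a b : ℂ} : (drawSegments hd hC Z).HasColor c a b ↔
      ∃ e : RedEdge hd C, C e.1 = .col c ∧ ∃ b' : Bool,
        Z (endVertex hC e b') = a ∧ Z (endVertex hC e (!b')) = b := by
  have key : ∀ he : s(a, b) ∈ (drawSegments hd hC Z).edges, ∃ e : RedEdge hd C,
      (drawSegments hd hC Z).color ⟨_, he⟩ = redColor e ∧ ∃ b' : Bool,
        Z (endVertex hC e b') = a ∧ Z (endVertex hC e (!b')) = b := by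
    intro he
    have h1 := ((Set.Finite.mem_toFinset _).1 he).choose_spec
    refine ⟨((Set.Finite.mem_toFinset _).1 he).choose, rfl, ?_⟩
    rcases Sym2.eq_iff.1 h1 with ⟨h1, h2⟩ | ⟨h1, h2⟩
    · exact ⟨true, h1, h2⟩
    · exact ⟨false, h2, h1⟩
  constructor
  · rintro ⟨he, rfl⟩
    obtain ⟨e, h1, h2⟩ := key he
    exact ⟨e, by rw [h1]; exact redColor_spec e, h2⟩
  · rintro ⟨e, hc, b', h1, h2⟩
    have he := mem_drawSegments.2 ⟨e, b', h1, h2⟩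
    obtain ⟨e', h3, b'', h4, h5⟩ := key he
    obtain ⟨rfl, -⟩ := endVertex_inj hC (hZ (h1.trans h4.symm)) (hZ (h2.trans h5.symm))
    refine ⟨he, ?_⟩
    rw [h3]
    have := redColor_spec e
    rw [hc] at this
    exact (HiveColor.col.inj this).symm

theorem IsHeight.isDrawing (hL : IsHeight hd hC θ L) (hθ : ∀ i, Function.Injective (θ i)) :
    IsDrawing hd hC (drawSegments hd hC hL.place) hL.place where
  injective := hL.place_injective hθ
  mem_edges := fun _ _ => mem_drawSegments
  height_eq := fun e => by rw [hL.bary_place_height, hL.bary_place_height]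
  lt := hL.place_lt

end

/-! ## Intersections of the edges of a drawing -/

section

variable {n d : ℕ} {hd : d ≤ n} {C : HexEdge n d → HiveColor} {hC : IsColorMap C}

theorem bary_ext_of_ne {z w : ℂ} {ℓ k : Fin 3} (hk : ℓ ≠ k) (h0 : bary ℓ z = bary ℓ w)
    (h1 : bary k z = bary k w) : z = w := by
  rcases three_cases ℓ k with h | h | h
  · exact absurd h.symm hk
  · exact bary_ext_two ℓ h0 (h ▸ h1)
  · refine bary_ext_two k h1 ?_
    rwa [h, three_add_two_one]

namespace IsDrawing

variable {h : ColoredSegments} {Z : ReducedVertex C → ℂ}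

theorem sub_eq (hZ : IsDrawing hd hC h Z) (e : RedEdge hd C) (b : Bool) :
    Z (endVertex hC e (!b)) - Z (endVertex hC e b) =
      ((-endSign b * drawLength hC Z e : ℝ) : ℂ) * typeDir e.1.type := by
  have h1 := hZ.lower_eq e
  cases b
  · rw [h1, Bool.not_false]; simp [endSign]
  · rw [Bool.not_true, h1]; simp [endSign]

theorem ne (hZ : IsDrawing hd hC h Z) (e : RedEdge hd C) (b : Bool) :
    Z (endVertex hC e b) ≠ Z (endVertex hC e (!b)) :=
  fun h0 => endVertex_not_ne hC e b (hZ.injective h0)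

/-- Coordinates on the segment of an edge. -/
theorem bary_mem_segment (hZ : IsDrawing hd hC h Z) {e : RedEdge hd C} {P : ℂ}
    (hP : P ∈ segment ℝ (Z (endVertex hC e true)) (Z (endVertex hC e false))) :
    ∃ t, 0 ≤ t ∧ t ≤ drawLength hC Z e ∧ (∀ k, bary k P =
      bary k (Z (endVertex hC e true)) + t * typeSign e.1.type k) ∧ ∀ k, bary k P =
      bary k (Z (endVertex hC e false)) - (drawLength hC Z e - t) * typeSign e.1.type k := by
  obtain ⟨s, t, hs, ht, hst, rfl⟩ := hP
  have hl := hZ.length_pos e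
  have key : ∀ k, bary k (s • Z (endVertex hC e true) + t • Z (endVertex hC e false)) =
      bary k (Z (endVertex hC e true)) + t * drawLength hC Z e * typeSign e.1.type k := by
    intro k
    rw [bary_convex k _ _ hst, hZ.bary_lower e]
    obtain rfl : s = 1 - t := by linarith
    ring
  refine ⟨t * drawLength hC Z e, by positivity, by nlinarith, key, fun k => ?_⟩
  rw [key, hZ.bary_lower e]
  ring

theorem mem_segment_of_bary (hZ : IsDrawing hd hC h Z) {e : RedEdge hd C} {P : ℂ}
    (h0 : bary e.1.type P = bary e.1.type (Z (endVertex hC e true)))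
    (h1 : bary (e.1.type + 1) (Z (endVertex hC e true)) ≤ bary (e.1.type + 1) P)
    (h2 : bary (e.1.type + 1) P ≤ bary (e.1.type + 1) (Z (endVertex hC e false))) :
    P ∈ segment ℝ (Z (endVertex hC e true)) (Z (endVertex hC e false)) := by
  have hl := hZ.length_pos e
  have h3 := hZ.bary_lower e (e.1.type + 1)
  rw [typeSign_one, mul_one] at h3
  set t := (bary (e.1.type + 1) P - bary (e.1.type + 1) (Z (endVertex hC e true))) /
    drawLength hC Z e with ht
  have h4 : t * drawLength hC Z e =
      bary (e.1.type + 1) P - bary (e.1.type + 1) (Z (endVertex hC e true)) :=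
    div_mul_cancel₀ _ hl.ne'
  refine ⟨1 - t, t, ?_, div_nonneg (sub_nonneg.2 h1) hl.le, by ring, ?_⟩
  · have : t ≤ 1 := by rw [ht, div_le_one hl]; linarith
    linarith
  · refine bary_ext_two e.1.type ?_ ?_
    · rw [bary_convex _ _ _ (by ring), hZ.height_eq, h0]; ring
    · rw [bary_convex _ _ _ (by ring), h3]; linarith

end IsDrawing

variable {θ : Fin 3 → Fin n → ℝ} {L : RedEdge hd C → ℝ} (hL : IsHeight hd hC θ L)

namespace IsHeight

/-- Passes from actual positions, where a boundary edge stops at the side of the triangle, to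
`side`, where it continues to infinity: prolonging the edge cannot move its end back across the
line, and `side` is then nonzero. -/
theorem side_of_le {e : RedEdge hd C} {b : Bool} {k : Fin 3} {x : ℝ} (hk : e.1.type ≠ k)
    (hx : endSign b * typeSign e.1.type k * (bary k (hL.place (endVertex hC e b)) - x) ≤ 0) :
    endSign b * typeSign e.1.type k * hL.system.side k x (hL.system.fin e b) ≤ 0 ∧
      (hL.system.side k x (hL.system.fin e b) = 0 → bary k (hL.place (endVertex hC e b)) = x) := by
  have h1 := (EdgeSystem.typeSign_ne hk).1
  have h2 := endSign_mul_self b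
  rcases reducedVertex_cases (endVertex hC e b) with ⟨f, hf⟩ | ⟨r, hr⟩
  · rw [hL.system_fin_inl hf]
    change endSign b * typeSign e.1.type k * Real.sign (L (redLeg hd hC f k) - x) ≤ 0 ∧
      (Real.sign (L (redLeg hd hC f k) - x) = 0 → _)
    rw [hf, bary_place_face] at hx ⊢
    constructor
    · rcases lt_trichotomy (L (redLeg hd hC f k) - x) 0 with h3 | h3 | h3
      · rw [Real.sign_of_neg h3]
        nlinarith
      · rw [h3, Real.sign_zero, mul_zero]
      · rw [Real.sign_of_pos h3]
        nlinarith
    · intro h3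
      linarith [Real.sign_eq_zero_iff.1 h3]
  · have h3 := hL.system_fin_inr hr
    obtain ⟨h4, h5⟩ := hL.system.fin_inr h3
    rw [h3]
    change endSign b * typeSign e.1.type k * -(endSign (hL.system.upRay r) *
      typeSign (hL.system.type (hL.system.ray r)) k) ≤ 0 ∧ (-(endSign (hL.system.upRay r) *
      typeSign (hL.system.type (hL.system.ray r)) k) = 0 → _)
    rw [← h4, ← h5]
    change endSign b * typeSign e.1.type k * -(endSign b * typeSign e.1.type k) ≤ 0 ∧
      (-(endSign b * typeSign e.1.type k) = 0 → _)
    have h6 : endSign b * typeSign e.1.type k * (endSign b * typeSign e.1.type k) = 1 := by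
      rw [mul_mul_mul_comm, h1, h2, one_mul]
    constructor
    · linarith
    · intro h0
      rw [neg_eq_zero] at h0
      rw [h0] at h6
      norm_num at h6

variable (hθ : ∀ i, Function.Injective (θ i))
include hθ

/-- The line through `P` weakly separates the ends of the edge. If the crossing number vanished,
both ends would lie on this line, which is impossible for a segment of positive length and another
type. -/
theorem cross_ne {e : RedEdge hd C} {k : Fin 3} {P : ℂ} (hk : e.1.type ≠ k) (hP : P ∈
    segment ℝ (hL.place (endVertex hC e true)) (hL.place (endVertex hC e false))) :
    hL.system.cross e k (bary k P) ≠ 0 := by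
  have hZ := hL.isDrawing hθ
  obtain ⟨t, h1, h2, h3, h4⟩ := hZ.bary_mem_segment hP
  have hl := hZ.length_pos e
  have hs := (EdgeSystem.typeSign_ne hk).1
  have a := hL.side_of_le (b := true) (x := bary k P) hk (by
    rw [h3 k, endSign, if_pos rfl]
    linear_combination h1 - t * hs)
  have b := hL.side_of_le (b := false) (x := bary k P) hk (by
    rw [h4 k, endSign, if_neg (by simp)]
    linear_combination h2 - (drawLength hC hL.place e - t) * hs)
  rw [EdgeSystem.cross_eq]
  intro h0
  simp only [endSign, if_true, Bool.false_eq_true, if_false, one_mul] at a b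
  have h5 : typeSign e.1.type k * hL.system.side k (bary k P) (hL.system.fin e true) = 0 := by
    have := sub_eq_zero.1 h0
    have h6 := a.1
    have h7 := b.1
    rw [← this] at h7
    linarith
  have h8 : typeSign e.1.type k ≠ 0 := fun h => by rw [h] at hs; norm_num at hs
  have h9 := (mul_eq_zero.1 h5).resolve_left h8
  have h10 := a.2 h9
  have h11 := b.2 (by rw [← sub_eq_zero.1 h0, h9])
  have h12 := hZ.bary_lower e k
  rw [h10, h11] at h12
  have : drawLength hC hL.place e * typeSign e.1.type k = 0 := by linarith
  exact (mul_ne_zero hl.ne' h8) this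

/-- Edges of distinct types that meet outside of their common vertices have weight `0`. -/
theorem meet_cases {e e' : RedEdge hd C} {P : ℂ} (ht : e.1.type ≠ e'.1.type)
    (hP : P ∈ segment ℝ (hL.place (endVertex hC e true)) (hL.place (endVertex hC e false)))
    (hP' : P ∈ segment ℝ (hL.place (endVertex hC e' true)) (hL.place (endVertex hC e' false))) :
    colorWeight (C e.1) e.1.type (C e'.1) e'.1.type = 0 ∨
      ∃ b b', endVertex hC e b = endVertex hC e' b' ∧ P = hL.place (endVertex hC e b) := by
  have hZ := hL.isDrawing hθ
  have hh : ∀ {e : RedEdge hd C}, P ∈ segment ℝ (hL.place (endVertex hC e true))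
      (hL.place (endVertex hC e false)) → bary e.1.type P = L e := by
    intro e hP
    obtain ⟨t, -, -, h3, -⟩ := hZ.bary_mem_segment hP
    rw [h3, typeSign_self, mul_zero, add_zero, bary_place_height]
  have h1 := hL.cross_ne hθ ht hP
  have h2 := hL.cross_ne hθ ht.symm hP'
  rw [hh hP'] at h1
  rw [hh hP] at h2
  have h3 : hL.system.meet e e' ≠ 0 := neg_ne_zero.2 (mul_ne_zero h1 h2)
  rcases hL.system_eq_zero.1 e e' with h4 | h4
  · left
    rw [system_typeSign_mul] at h4
    have h5 : typeSignInt e.1.type e'.1.type ≠ 0 := by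
      intro h0
      have h6 := (EdgeSystem.typeSign_ne ht).1
      rw [← typeSignInt_cast, h0] at h6
      norm_num at h6
    exact (mul_eq_zero.1 (by exact_mod_cast h4)).resolve_left h5
  · right
    rw [h4, EdgeSystem.inc] at h3
    obtain ⟨b, -, h5⟩ := Finset.exists_ne_zero_of_sum_ne_zero h3
    obtain ⟨b', -, h6⟩ := Finset.exists_ne_zero_of_sum_ne_zero h5
    obtain ⟨-, v, ℓ, v', ℓ', h7, h8, h9⟩ := (hL.system.near_cases _ _).resolve_left h6
    obtain rfl := hL.system_pos_injective h9
    have h10 := hL.endVertex_of_fin h7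
    have h11 := hL.endVertex_of_fin h8
    refine ⟨b, b', by rw [h10, h11], bary_ext_of_ne ht ?_ ?_⟩
    · rw [hh hP, bary_place_height]
    · rw [hh hP', h10, ← h11, bary_place_height]

-- The coordinate is nonnegative at both ends, and it cannot vanish at both since one end of the
-- edge is an inner vertex.
omit hθ in
theorem bary_pos_of_openSegment {e : RedEdge hd C} {b : Bool} {P : ℂ} (hP : P ∈
    openSegment ℝ (hL.place (endVertex hC e b)) (hL.place (endVertex hC e (!b)))) (k : Fin 3) :
    0 < bary k P := by
  obtain ⟨s, t, hs, ht, hst, rfl⟩ := hP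
  rw [bary_convex k _ _ hst]
  have h1 := hL.bary_place_nonneg (endVertex hC e b) k
  have h2 := hL.bary_place_nonneg (endVertex hC e (!b)) k
  rcases h1.eq_or_lt with h3 | h3
  · rcases h2.eq_or_lt with h4 | h4
    · obtain ⟨j, hj⟩ := hL.bary_place_eq_zero h3.symm
      obtain ⟨j', hj'⟩ := hL.bary_place_eq_zero h4.symm
      obtain ⟨f, hf⟩ := exists_face_of_bdry hC hj
      rw [hj'] at hf
      exact absurd hf.symm (f.vertex_ne _)
    · have := mul_nonneg hs.le h1
      have := mul_pos ht h4
      linarith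
  · have := mul_pos hs h3
    have := mul_nonneg ht.le h2
    linarith

omit hθ in
theorem openSegment_bool {e : RedEdge hd C} {b : Bool} :
    openSegment ℝ (hL.place (endVertex hC e b)) (hL.place (endVertex hC e (!b))) =
      openSegment ℝ (hL.place (endVertex hC e true)) (hL.place (endVertex hC e false)) := by
  cases b
  · exact openSegment_symm ℝ _ _
  · rfl

theorem ne_of_openSegment {e : RedEdge hd C} {P : ℂ} (hP : P ∈
    openSegment ℝ (hL.place (endVertex hC e true)) (hL.place (endVertex hC e false))) (b : Bool) :
    P ≠ hL.place (endVertex hC e b) := by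
  rintro rfl
  rw [← hL.openSegment_bool (b := b), left_mem_openSegment_iff] at hP
  exact (hL.isDrawing hθ).ne e b hP

/-- No upper vertex lies in the interior of an edge. -/
theorem not_upper_mem {e e' : RedEdge hd C}
    (hP : hL.place (endVertex hC e' true) ∈
      openSegment ℝ (hL.place (endVertex hC e true)) (hL.place (endVertex hC e false))) : False := by
  rcases reducedVertex_cases (endVertex hC e' true) with ⟨f, hf⟩ | ⟨⟨i, j⟩, hr⟩
  · rw [hf] at hP
    -- Both legs not parallel to `e` must have weight `0` with it. The one of type `+ 1` forces
    -- color `1` on `e`, and the one of type `+ 2` forces color `0`.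
    have hw : ∀ ℓ, e.1.type ≠ ℓ → colorWeight (C e.1) e.1.type (C (redLeg hd hC f ℓ).1) ℓ = 0 := by
      intro ℓ hℓ
      have hmem : hL.place f.vertex ∈
          segment ℝ (hL.place (endVertex hC (redLeg hd hC f ℓ) true))
            (hL.place (endVertex hC (redLeg hd hC f ℓ) false)) := by
        have h1 := endVertex_redLeg hd hC f ℓ
        cases hu : f.1.up
        · rw [hu] at h1
          rw [← h1]; exact right_mem_segment ℝ _ _
        · rw [hu] at h1
          rw [← h1]; exact left_mem_segment ℝ _ _
      rcases hL.meet_cases hθ (by rwa [redLeg_type]) (openSegment_subset_segment ℝ _ _ hP) hmem with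
        h1 | ⟨b, -, -, h1⟩
      · rwa [redLeg_type] at h1
      · exact absurd h1 (hL.ne_of_openSegment hθ hP b)
    have h1 := colorWeight_eq_zero _ _ _ e.2.1 (redLeg hd hC f _).2.1
      (hw (e.1.type + 1) (three_one_ne _).symm)
    have h2 := hw (e.1.type + 2) (three_two_ne _).symm
    rw [colorWeight_swap, neg_eq_zero] at h2
    have h3 := colorWeight_eq_zero (C (redLeg hd hC f (e.1.type + 2)).1) (C e.1) (e.1.type + 2)
      (redLeg hd hC f _).2.1 e.2.1 (by rwa [three_add_two_one])
    rw [h1.1] at h3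
    cases h3.2
  · have h1 := hL.bary_pos_of_openSegment (b := true) hP i
    rw [hr, (hL.bary_place_bdry i j).1] at h1
    exact lt_irrefl _ h1

/-- The interiors of two distinct edges of the same type are disjoint. -/
theorem eq_of_openSegment {e e' : RedEdge hd C} {P : ℂ} (ht : e.1.type = e'.1.type)
    (hP : P ∈ openSegment ℝ (hL.place (endVertex hC e true)) (hL.place (endVertex hC e false)))
    (hP' : P ∈ openSegment ℝ (hL.place (endVertex hC e' true))
      (hL.place (endVertex hC e' false))) : e = e' := by
  have hZ := hL.isDrawing hθ
  have key : ∀ {e e' : RedEdge hd C}, e.1.type = e'.1.type →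
      P ∈ openSegment ℝ (hL.place (endVertex hC e true)) (hL.place (endVertex hC e false)) →
      P ∈ openSegment ℝ (hL.place (endVertex hC e' true)) (hL.place (endVertex hC e' false)) →
      bary (e.1.type + 1) (hL.place (endVertex hC e true)) ≤
        bary (e.1.type + 1) (hL.place (endVertex hC e' true)) → e = e' := by
    intro e e' ht hP hP' hle
    obtain ⟨t, h1, h2, h3, h4⟩ := hZ.bary_mem_segment (openSegment_subset_segment ℝ _ _ hP)
    obtain ⟨t', h1', h2', h3', h4'⟩ := hZ.bary_mem_segment (openSegment_subset_segment ℝ _ _ hP')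
    rw [← ht] at h3' h4'
    have h0 : bary e.1.type (hL.place (endVertex hC e' true)) =
        bary e.1.type (hL.place (endVertex hC e true)) := by
      have a := h3 e.1.type
      have b := h3' e.1.type
      rw [typeSign_self, mul_zero, add_zero] at a b
      rw [← a, ← b]
    have hne : bary (e.1.type + 1) P ≠ bary (e.1.type + 1) (hL.place (endVertex hC e false)) := by
      intro h5
      refine hL.ne_of_openSegment hθ hP false (bary_ext_two e.1.type ?_ h5)
      rw [h4, typeSign_self, mul_zero, sub_zero]
    have h5 : bary (e.1.type + 1) (hL.place (endVertex hC e' true)) <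
        bary (e.1.type + 1) (hL.place (endVertex hC e false)) := by
      have a := h3' (e.1.type + 1)
      have b := h4 (e.1.type + 1)
      rw [typeSign_one, mul_one] at a b
      exact lt_of_le_of_lt (by linarith) (lt_of_le_of_ne (by linarith) hne)
    -- Of two overlapping parallel segments, the one that starts later has its upper end inside the
    -- other, unless they start together.
    by_cases h6 : endVertex hC e true = endVertex hC e' true
    · exact eq_of_endVertex_eq hC h6 ht
    · exfalso
      refine hL.not_upper_mem hθ (e := e) (e' := e') ?_
      have h7 := hZ.mem_segment_of_bary h0 hle h5.le
      refine mem_openSegment_of_ne_left_right ?_ ?_ h7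
      · exact fun h => h6 (hZ.injective h)
      · intro h
        rw [h] at h5
        exact lt_irrefl _ h5
  rcases le_total (bary (e.1.type + 1) (hL.place (endVertex hC e true)))
    (bary (e.1.type + 1) (hL.place (endVertex hC e' true))) with h | h
  · exact key ht hP hP' h
  · exact (key ht.symm hP' hP (by rwa [← ht])).symm

end IsHeight

end

/-! ## The honeycomb of a flow is triangular -/

section

variable {n d : ℕ} {hd : d ≤ n} {C : HexEdge n d → HiveColor} {hC : IsColorMap C}
  {θ : Fin 3 → Fin n → ℝ} {L : RedEdge hd C → ℝ} (hL : IsHeight hd hC θ L)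

namespace IsHeight

/-- The honeycomb with given heights. -/
noncomputable def honeycomb (hL : IsHeight hd hC θ L) : ColoredSegments :=
  drawSegments hd hC hL.place

theorem mem_honeycomb {a b : ℂ} : s(a, b) ∈ hL.honeycomb.edges ↔
    ∃ (e : RedEdge hd C) (b' : Bool),
      hL.place (endVertex hC e b') = a ∧ hL.place (endVertex hC e (!b')) = b :=
  mem_drawSegments

theorem vertices_honeycomb : hL.honeycomb.vertices = Set.range hL.place := by
  ext v
  constructor
  · rintro ⟨e, he, hv⟩
    obtain ⟨w, rfl⟩ := Sym2.mem_iff_exists.1 hv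
    obtain ⟨e, b, h1, -⟩ := hL.mem_honeycomb.1 he
    exact ⟨_, h1⟩
  · rintro ⟨x, rfl⟩
    have key : ∀ (e : RedEdge hd C) b, hL.place (endVertex hC e b) ∈ hL.honeycomb.vertices :=
      fun e b => ColoredSegments.mem_vertices_left (hL.mem_honeycomb.2 ⟨e, b, rfl, rfl⟩)
    rcases reducedVertex_cases x with ⟨f, rfl⟩ | ⟨r, rfl⟩
    · rw [← endVertex_redLeg hd hC f 0]; exact key _ _
    · rw [← endVertex_redRay hd hC r]; exact key _ _

theorem place_mem_triangle (x : ReducedVertex C) : hL.place x ∈ triangle :=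
  hL.bary_place_nonneg x

theorem place_mem_side_iff {x : ReducedVertex C} {i : Fin 3} :
    hL.place x ∈ triangleSide i ↔ ∃ j, x = bdryVertex C (i, j) := by
  constructor
  · exact fun h => hL.bary_place_eq_zero h.2
  · rintro ⟨j, rfl⟩
    exact ⟨hL.place_mem_triangle _, (hL.bary_place_bdry i j).1⟩

theorem support_inter_side (i : Fin 3) : hL.honeycomb.support ∩ triangleSide i =
    Set.range fun j => hL.place (bdryVertex C (i, j)) := by
  ext z
  constructor
  · rintro ⟨⟨a, b, hab, hz⟩, hi⟩
    have key : ∀ x, hL.place x = z → z ∈ Set.range fun j => hL.place (bdryVertex C (i, j)) := by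
      rintro x rfl
      obtain ⟨j, rfl⟩ := hL.place_mem_side_iff.1 hi
      exact ⟨j, rfl⟩
    obtain ⟨e, b', rfl, rfl⟩ := hL.mem_honeycomb.1 hab
    rw [← insert_endpoints_openSegment] at hz
    rcases hz with rfl | rfl | hz
    · exact key _ rfl
    · exact key _ rfl
    · exact absurd hi.2 (hL.bary_pos_of_openSegment hz i).ne'
  · rintro ⟨j, rfl⟩
    refine ⟨ColoredSegments.vertices_subset_support ?_, hL.place_mem_side_iff.2 ⟨j, rfl⟩⟩
    rw [vertices_honeycomb]
    exact ⟨_, rfl⟩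

variable (hθ : ∀ i, Function.Injective (θ i))
include hθ

theorem hasColor_honeycomb {c : EdgeColor} {a b : ℂ} : hL.honeycomb.HasColor c a b ↔
      ∃ e : RedEdge hd C, C e.1 = .col c ∧ ∃ b' : Bool,
        hL.place (endVertex hC e b') = a ∧ hL.place (endVertex hC e (!b')) = b :=
  hasColor_drawSegments (hL.place_injective hθ)

/-- Weight `0` determines the two colors. Lines of distinct types meet at angle `π/3` once the
segments are suitably oriented, and one of the two orientations of the second segment is the right
one. -/
theorem allowedCrossing_honeycomb {e e' : RedEdge hd C} (ht : e'.1.type = e.1.type + 1)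
    (hw : colorWeight (C e.1) e.1.type (C e'.1) e'.1.type = 0) (b b' : Bool) :
    hL.honeycomb.AllowedCrossing (hL.place (endVertex hC e' b')) (hL.place (endVertex hC e' (!b')))
      (hL.place (endVertex hC e b)) (hL.place (endVertex hC e (!b))) := by
  have hZ := hL.isDrawing hθ
  rw [ht] at hw
  obtain ⟨h1, h2⟩ := colorWeight_eq_zero _ _ _ e.2.1 e'.2.1 hw
  refine ⟨(hL.hasColor_honeycomb hθ).2 ⟨e', h2, b', rfl, rfl⟩,
    (hL.hasColor_honeycomb hθ).2 ⟨e, h1, b, rfl, rfl⟩, ?_⟩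
  have key : ∀ b, b ≠ b' → IsAngle (hL.place (endVertex hC e' (!b')) - hL.place (endVertex hC e' b'))
      (hL.place (endVertex hC e (!b)) - hL.place (endVertex hC e b)) (Real.pi / 3) := by
    intro b hb
    have h3 : e.1.type = e'.1.type + 2 := by rw [ht, three_add_one_two]
    rw [hZ.sub_eq, hZ.sub_eq, h3]
    refine isAngle_prev ?_
    have h4 : endSign b' * endSign b = -1 := by
      cases b <;> cases b' <;> simp [endSign] at hb ⊢
    have h5 := mul_pos (hZ.length_pos e') (hZ.length_pos e)
    have h6 : -endSign b' * drawLength hC hL.place e' * (-endSign b * drawLength hC hL.place e) =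
      (endSign b' * endSign b) * (drawLength hC hL.place e' * drawLength hC hL.place e) := by ring
    rw [h6, h4]
    linarith
  by_cases hb : b = b'
  · right
    have := key (!b) (by rw [← hb]; cases b <;> simp)
    rwa [Bool.not_not] at this
  · exact Or.inl (key b hb)

/-- In the order of types, the colors around a reduced face are `0,0,0`, `1,1,1` or a rotation of
`1,3,0`; the consecutive pairs are exactly the allowed ones. -/
theorem allowedCorner_honeycomb (f : RedFace C) (ℓ : Fin 3) :
    hL.honeycomb.AllowedCorner (hL.place f.vertex)
      (hL.place (endVertex hC (redLeg hd hC f ℓ) (!f.1.up)))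
      (hL.place (endVertex hC (redLeg hd hC f (ℓ + 1)) (!f.1.up))) := by
  have hZ := hL.isDrawing hθ
  have hc : ∀ k c, C (f.1.edge k) = .col c → hL.honeycomb.HasColor c (hL.place f.vertex)
      (hL.place (endVertex hC (redLeg hd hC f k) (!f.1.up))) := fun k c h =>
    (hL.hasColor_honeycomb hθ).2 ⟨redLeg hd hC f k, by rw [redLeg_color hd hC, h], f.1.up,
      by rw [endVertex_redLeg], rfl⟩
  constructor
  · obtain ⟨k, hk⟩ := hC.face_cases f.1
    simp only [Set.mem_insert_iff, Set.mem_singleton_iff, Prod.mk.injEq] at hk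
    rcases three_cases k ℓ with rfl | rfl | rfl
    · rcases hk with ⟨h0, h1, -⟩ | ⟨h0, h1, -⟩ | ⟨h0, h1, -⟩ | ⟨-, h1, -⟩
      · exact Or.inl ⟨hc _ _ h0, hc _ _ h1⟩
      · exact Or.inr (Or.inl ⟨hc _ _ h0, hc _ _ h1⟩)
      · exact Or.inr (Or.inr (Or.inr (Or.inl ⟨hc _ _ h0, hc _ _ h1⟩)))
      · exact absurd h1 (f.2 _)
    · rw [three_add_one_one]
      rcases hk with ⟨-, h0, h1⟩ | ⟨-, h0, h1⟩ | ⟨-, h0, h1⟩ | ⟨-, h1, -⟩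
      · exact Or.inl ⟨hc _ _ h0, hc _ _ h1⟩
      · exact Or.inr (Or.inl ⟨hc _ _ h0, hc _ _ h1⟩)
      · exact Or.inr (Or.inr (Or.inr (Or.inr ⟨hc _ _ h0, hc _ _ h1⟩)))
      · exact absurd h1 (f.2 _)
    · rw [three_add_two_one]
      rcases hk with ⟨h1, -, h0⟩ | ⟨h1, -, h0⟩ | ⟨h1, -, h0⟩ | ⟨-, h1, -⟩
      · exact Or.inl ⟨hc _ _ h0, hc _ _ h1⟩
      · exact Or.inr (Or.inl ⟨hc _ _ h0, hc _ _ h1⟩)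
      · exact Or.inr (Or.inr (Or.inl ⟨hc _ _ h0, hc _ _ h1⟩))
      · exact absurd h1 (f.2 _)
  · have hv : ∀ k, hL.place (endVertex hC (redLeg hd hC f k) (!f.1.up)) - hL.place f.vertex =
        ((-endSign f.1.up * drawLength hC hL.place (redLeg hd hC f k) : ℝ) : ℂ) * typeDir k := by
      intro k
      have := hZ.sub_eq (redLeg hd hC f k) f.1.up
      rwa [endVertex_redLeg, redLeg_type] at this
    rw [hv, hv]
    refine isAngle_next ?_
    have h1 := mul_pos (hZ.length_pos (redLeg hd hC f ℓ)) (hZ.length_pos (redLeg hd hC f (ℓ + 1)))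
    have h2 := endSign_mul_self f.1.up
    rw [mul_mul_mul_comm, neg_mul_neg, h2, one_mul]
    exact h1

theorem isHoneycomb_honeycomb : hL.honeycomb.IsHoneycomb triangle where
  nontrivial := by
    intro e he
    induction e with
    | _ a b =>
      obtain ⟨e, b', rfl, rfl⟩ := hL.mem_honeycomb.1 he
      exact fun h => (hL.isDrawing hθ).ne e b' (Sym2.mk_isDiag_iff.1 h)
  subset := by
    rw [vertices_honeycomb]
    rintro _ ⟨x, rfl⟩
    exact hL.place_mem_triangle x
  crossing := by
    rintro _ _ _ _ h1 h2 hne ⟨P, hP, hP'⟩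
    obtain ⟨e, b, rfl, rfl⟩ := hL.mem_honeycomb.1 h1
    obtain ⟨e', b', rfl, rfl⟩ := hL.mem_honeycomb.1 h2
    rw [hL.openSegment_bool] at hP hP'
    have hee : e.1.type ≠ e'.1.type := by
      intro ht
      obtain rfl := hL.eq_of_openSegment hθ ht hP hP'
      refine hne (Sym2.eq_iff.2 ?_)
      cases b <;> cases b' <;> simp
    have hw : colorWeight (C e.1) e.1.type (C e'.1) e'.1.type = 0 := by
      rcases hL.meet_cases hθ hee (openSegment_subset_segment ℝ _ _ hP)
        (openSegment_subset_segment ℝ _ _ hP') with h3 | ⟨b, -, -, h3⟩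
      · exact h3
      · exact absurd h3 (hL.ne_of_openSegment hθ hP b)
    rcases three_cases e.1.type e'.1.type with h3 | h3 | h3
    · exact absurd h3.symm hee
    · exact Or.inr (hL.allowedCrossing_honeycomb hθ h3 hw b b')
    · refine Or.inl (hL.allowedCrossing_honeycomb hθ (by rw [h3, three_add_two_one]) ?_ b' b)
      rw [colorWeight_swap, hw, neg_zero]
  corner := by
    intro v a b ha hb hab
    obtain ⟨e, s, rfl, rfl⟩ := hL.mem_honeycomb.1 ha
    obtain ⟨e', s', h1, rfl⟩ := hL.mem_honeycomb.1 hb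
    have h2 := hL.place_injective hθ h1
    rcases reducedVertex_cases (endVertex hC e s) with ⟨f, hf⟩ | ⟨r, hr⟩
    · rw [hf] at h2 ⊢
      obtain ⟨h3, rfl⟩ := eq_redLeg hC hf
      obtain ⟨h4, rfl⟩ := eq_redLeg hC h2
      rw [h3, h4]
      rcases three_cases e.1.type e'.1.type with h5 | h5 | h5
      · rw [h5, ← h3] at h4
        exact absurd (by rw [h4]) hab
      · rw [h5]
        exact Or.inl (hL.allowedCorner_honeycomb hθ f _)
      · right
        have h6 : e.1.type = e'.1.type + 1 := by rw [h5, three_add_two_one]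
        rw [h6]
        exact hL.allowedCorner_honeycomb hθ f _
    · rw [hr] at h2
      obtain ⟨h3, h4⟩ := eq_redRay hC hr
      obtain ⟨h5, h6⟩ := eq_redRay hC h2
      exact absurd (by rw [h3, h4, h5, h6]) hab

theorem degree_face (f : RedFace C) : hL.honeycomb.degree (hL.place f.vertex) = 3 := by
  have h1 : {w | s(hL.place f.vertex, w) ∈ hL.honeycomb.edges} =
      (fun ℓ => hL.place (endVertex hC (redLeg hd hC f ℓ) (!f.1.up))) '' Set.univ := by
    ext w
    rw [Set.image_univ, Set.mem_ofPred_eq, hL.mem_honeycomb]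
    constructor
    · rintro ⟨e, b, h1, rfl⟩
      obtain ⟨h2, rfl⟩ := eq_redLeg hC (hL.place_injective hθ h1)
      exact ⟨e.1.type, by simp only; rw [← h2]⟩
    · rintro ⟨ℓ, rfl⟩
      exact ⟨redLeg hd hC f ℓ, f.1.up, by rw [endVertex_redLeg], rfl⟩
  rw [ColoredSegments.degree, h1, Set.ncard_image_of_injective, Set.ncard_univ, Nat.card_fin]
  intro ℓ k h
  have h2 := (endVertex_inj hC (b := f.1.up) (b' := f.1.up)
    (by rw [endVertex_redLeg, endVertex_redLeg]) (hL.place_injective hθ h)).1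
  rw [← redLeg_type hd hC f ℓ, h2, redLeg_type]

theorem degree_bdry (r : Fin 3 × Fin n) :
    hL.honeycomb.degree (hL.place (bdryVertex C r)) = 1 := by
  rw [ColoredSegments.degree, Set.ncard_eq_one]
  refine ⟨hL.place (endVertex hC (redRay hd hC r) (!decide ((r.2 : ℕ) < d))), ?_⟩
  ext w
  rw [Set.mem_ofPred_eq, hL.mem_honeycomb, Set.mem_singleton_iff]
  constructor
  · rintro ⟨e, b, h1, rfl⟩
    obtain ⟨h2, rfl⟩ := eq_redRay hC (hL.place_injective hθ h1)
    rw [← h2]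
  · rintro rfl
    exact ⟨redRay hd hC r, _, by rw [endVertex_redRay], rfl⟩

/-- The colors of the edges at the boundary. -/
theorem hasColor_bdry {i : Fin 3} {v w : ℂ} {c : EdgeColor} (hc : hL.honeycomb.HasColor c v w)
    (hv : v ∈ triangleSide i) : ∃ j : Fin n, v = hL.place (bdryVertex C (i, j)) ∧
      bary (i + 1) v = θ i j ∧
      (((j : ℕ) < d ∧ c = .one ∧ HasType (i + 2) v w) ∨
        (¬ (j : ℕ) < d ∧ c = .zero ∧ HasType (i + 1) v w)) := by
  obtain ⟨e, hce, b, rfl, rfl⟩ := (hL.hasColor_honeycomb hθ).1 hc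
  obtain ⟨j, hj⟩ := hL.place_mem_side_iff.1 hv
  refine ⟨j, by rw [hj], by rw [hj, (hL.bary_place_bdry i j).2.1], ?_⟩
  obtain ⟨h1, -⟩ := eq_redRay hC hj
  have h2 := redRay_cases hd hC (i, j)
  rw [← h1, hce] at h2
  rw [(hL.isDrawing hθ).hasType_iff, (hL.isDrawing hθ).hasType_iff]
  rcases h2 with ⟨h2, -, h3, h4⟩ | ⟨h2, -, h3, h4⟩
  · exact Or.inl ⟨h2, HiveColor.col.inj h4, h3.symm⟩
  · exact Or.inr ⟨h2, HiveColor.col.inj h4, h3.symm⟩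

omit hθ in
theorem isTriangular_honeycomb (hθ : ∀ i, StrictAnti (θ i)) : hL.honeycomb.IsTriangular n where
  isHoneycomb := hL.isHoneycomb_honeycomb fun i => (hθ i).injective
  degree_eq := by
    rw [vertices_honeycomb]
    rintro _ ⟨x, rfl⟩
    rcases reducedVertex_cases x with ⟨f, rfl⟩ | ⟨r, rfl⟩
    · exact Or.inr (hL.degree_face (fun i => (hθ i).injective) f)
    · exact Or.inl (hL.degree_bdry (fun i => (hθ i).injective) r)
  support_inter := by
    rw [triangleBoundary, Set.inter_iUnion, vertices_honeycomb]
    ext z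
    simp only [Set.mem_iUnion, support_inter_side]
    constructor
    · rintro ⟨i, j, rfl⟩
      exact ⟨⟨_, rfl⟩, hL.degree_bdry (fun i => (hθ i).injective) _⟩
    · rintro ⟨⟨x, rfl⟩, hx⟩
      rcases reducedVertex_cases x with ⟨f, rfl⟩ | ⟨r, rfl⟩
      · rw [hL.degree_face fun i => (hθ i).injective] at hx
        norm_num at hx
      · exact ⟨r.1, r.2, rfl⟩
  hasType := by
    intro a b hab
    obtain ⟨e, b', rfl, rfl⟩ := hL.mem_honeycomb.1 hab
    exact ⟨e.1.type, ((hL.isDrawing fun i => (hθ i).injective).hasType_iff e b' _).2 rfl⟩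
  card_side := by
    intro i
    rw [support_inter_side, ← Set.image_univ, Set.ncard_image_of_injective, Set.ncard_univ,
      Nat.card_fin]
    intro j k h
    exact (Prod.mk.inj (bdryVertex_injective
      (hL.place_injective (fun i => (hθ i).injective) h))).2
  boundary_edge := by
    intro i v w hvw hv
    obtain ⟨c, hc⟩ := ColoredSegments.exists_hasColor hvw
    obtain ⟨j, -, -, ⟨-, rfl, h⟩ | ⟨-, rfl, h⟩⟩ :=
      hL.hasColor_bdry (fun i => (hθ i).injective) hc hv
    · exact Or.inr ⟨hc, h⟩
    · exact Or.inl ⟨hc, h⟩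
  color_mono := by
    intro i v w v' w' c c' hc hc' hv hv' hlt
    obtain ⟨j, -, h1, h2⟩ := hL.hasColor_bdry (fun i => (hθ i).injective) hc hv
    obtain ⟨j', -, h1', h2'⟩ := hL.hasColor_bdry (fun i => (hθ i).injective) hc' hv'
    rw [h1, h1', (hθ i).lt_iff_gt, Fin.lt_def] at hlt
    rcases h2 with ⟨h2, rfl, -⟩ | ⟨-, rfl, -⟩
    · rcases h2' with ⟨-, rfl, -⟩ | ⟨h2', -⟩
      · exact le_rfl
      · omega
    · exact Nat.zero_le _

omit hθ in
theorem bary_image_side (i : Fin 3) :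
    bary (i + 1) '' (hL.honeycomb.support ∩ triangleSide i) = Set.range (θ i) := by
  rw [support_inter_side, ← Set.range_comp]
  congr 1
  exact funext fun j => (hL.bary_place_bdry i j).2.1

theorem ncard_one_side (i : Fin 3) : {e : Sym2 ℂ | ∃ v w, e = s(v, w) ∧
    hL.honeycomb.HasColor .one v w ∧ v ∈ triangleSide i}.ncard = d := by
  have h0 : ∀ j : Fin n, (j : ℕ) < d →
      endVertex hC (redRay hd hC (i, j)) true = bdryVertex C (i, j) := by
    intro j hj
    have := endVertex_redRay hd hC (i, j)
    rwa [decide_eq_true hj] at this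
  have h1 : {e : Sym2 ℂ | ∃ v w, e = s(v, w) ∧
      hL.honeycomb.HasColor .one v w ∧ v ∈ triangleSide i} =
      (fun j => s(hL.place (endVertex hC (redRay hd hC (i, j)) true),
        hL.place (endVertex hC (redRay hd hC (i, j)) false))) '' {j | (j : ℕ) < d} := by
    ext p
    constructor
    · rintro ⟨v, w, rfl, hc, hv⟩
      obtain ⟨e, hce, b, rfl, rfl⟩ := (hL.hasColor_honeycomb hθ).1 hc
      obtain ⟨j, hj⟩ := hL.place_mem_side_iff.1 hv
      obtain ⟨h1, h2⟩ := eq_redRay hC hj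
      rcases redRay_cases hd hC (i, j) with ⟨h3, h4, -⟩ | ⟨-, -, -, h3⟩
      · rw [h4] at h2
        subst h2
        exact ⟨j, h3, by simp only; rw [← h1, Bool.not_true]⟩
      · rw [← h1, hce] at h3
        cases h3
    · rintro ⟨j, hj, rfl⟩
      refine ⟨_, _, rfl, (hL.hasColor_honeycomb hθ).2 ⟨redRay hd hC (i, j), ?_, true, rfl, rfl⟩, ?_⟩
      · rcases redRay_cases hd hC (i, j) with ⟨-, -, -, h3⟩ | ⟨h3, -⟩
        · exact h3
        · exact absurd hj h3
      · rw [h0 j hj]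
        exact hL.place_mem_side_iff.2 ⟨j, rfl⟩
  have h2 : (Fin.val '' {j : Fin n | (j : ℕ) < d}) = ↑(Finset.range d) := by
    ext k
    simp only [Set.mem_image, Set.mem_ofPred_eq, Finset.coe_range, Set.mem_Iio]
    exact ⟨fun ⟨j, hj, hk⟩ => hk ▸ hj, fun hk => ⟨⟨k, by omega⟩, hk, rfl⟩⟩
  rw [h1, Set.InjOn.ncard_image, ← Set.ncard_image_of_injective _ Fin.val_injective, h2,
    Set.ncard_coe_finset, Finset.card_range]
  intro j hj k hk h
  rcases Sym2.eq_iff.1 h with ⟨h3, -⟩ | ⟨h3, -⟩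
  · have h4 := hL.place_injective hθ h3
    rw [h0 j hj, h0 k hk] at h4
    exact (Prod.mk.inj (bdryVertex_injective h4)).2
  -- Matching the segments with exchanged ends would identify an upper vertex with a lower one.
  · have h4 := congrArg (fun x : ReducedVertex C => x.1.isUp) (hL.place_injective hθ h3)
    simp only [isUp_endVertex] at h4
    cases h4

/-- The vertices of the reduced graph are the vertices of the honeycomb. -/
noncomputable def vertexEquiv : ReducedVertex C ≃ hL.honeycomb.vertices :=
  (Equiv.ofInjective hL.place (hL.place_injective hθ)).trans
    (Equiv.setCongr hL.vertices_honeycomb.symm)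

omit hθ in
/-- The structure graph of the honeycomb is the reduced graph. -/
noncomputable def honeycombIso (hθ : ∀ i, StrictAnti (θ i)) :
    BdryColoredIso (reducedGraph C) (hL.honeycomb.structureGraph n) where
  toEquiv := hL.vertexEquiv fun i => (hθ i).injective
  adj_iff := by
    intro c v w
    have hinj := hL.place_injective fun i => (hθ i).injective
    rw [colorClass_adj_iff hC hd]
    change _ ↔ hL.vertexEquiv _ v ≠ hL.vertexEquiv _ w ∧
      hL.honeycomb.HasColor c (hL.place v) (hL.place w)
    rw [hL.hasColor_honeycomb fun i => (hθ i).injective]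
    constructor
    · rintro ⟨e, hc, b, rfl, rfl⟩
      exact ⟨fun h => endVertex_not_ne hC e b (Equiv.injective _ h), e, hc, b, rfl, rfl⟩
    · rintro ⟨-, e, hc, b, h1, h2⟩
      exact ⟨e, hc, b, hinj h1, hinj h2⟩
  bdry_iff := by
    intro i j x
    have h1 : ∀ j, {z ∈ hL.honeycomb.support ∩ triangleSide i |
        bary (i + 1) (hL.place (bdryVertex C (i, j))) < bary (i + 1) z}.ncard = j := fun j =>
      ncard_support_lt (hθ i) Set.inter_subset_right (hL.bary_image_side i)
        (hL.bary_place_bdry i j).2.1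
    change x.1 = .inr (i, j) ↔ hL.place x ∈ triangleSide i ∧ {z ∈ hL.honeycomb.support ∩
      triangleSide i | bary (i + 1) (hL.place x) < bary (i + 1) z}.ncard = j
    rw [hL.place_mem_side_iff]
    constructor
    · intro h
      obtain rfl : x = bdryVertex C (i, j) := Subtype.ext h
      exact ⟨⟨j, rfl⟩, h1 j⟩
    · rintro ⟨⟨j', rfl⟩, h2⟩
      rw [h1 j'] at h2
      rw [← Fin.ext h2]
      rfl

end IsHeight

theorem mem_honeycombFlows (hd : d ≤ n) (hC : IsColorMap C) {α β γ : Fin n → ℝ}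
    (hα : IsRegularClass α) (hβ : IsRegularClass β) (hγ : IsRegularClass γ)
    {ω : (reducedGraph C).graph.Dart → ℝ}
    (hω : ω ∈ divergenceSpace (reducedGraph C).graph (flowDivergence C α β γ) ∩ flowCone C) :
    ω ∈ honeycombFlows C α β γ := by
  obtain ⟨hL, hsign⟩ := isHeight_of_flow hd hC hω
  have hθ : ∀ i, StrictAnti (![β, α, γ] i) := by
    intro i
    fin_cases i
    exacts [hβ.1, hα.1, hγ.1]
  refine ⟨hL.honeycomb, ⟨hL.isTriangular_honeycomb hθ,
    hL.ncard_one_side fun i => (hθ i).injective, hL.bary_image_side⟩, hL.honeycombIso hθ, ?_⟩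
  funext p
  obtain ⟨e, b, rfl⟩ := exists_dartOf hC hd p
  have h1 := (hL.isDrawing fun i => (hθ i).injective).flow_eq e b
  rw [hL.bary_place_height] at h1
  rw [hsign]
  exact h1.symm

end

theorem mainTheorem11 (n d : ℕ) (hn : 3 ≤ n) (hd : d ≤ n)
    (C : HexEdge n d → HiveColor) (hC : IsColorMap C)
    (α β γ : Fin n → ℝ) (hα : IsRegularClass α) (hβ : IsRegularClass β) (hγ : IsRegularClass γ) :
    honeycombFlows C α β γ =
      divergenceSpace (reducedGraph C).graph (flowDivergence C α β γ) ∩ flowCone C :=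
  Set.Subset.antisymm (fun _ h => flow_mem_of_honeycomb (by omega) hd hC hα hβ hγ h)
    fun _ h => mem_honeycombFlows hd hC hα hβ hγ h
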